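/- Let $\beta>0$. For an integer $N\ge 1$ and a real random variable $h$, let $(h_{ij})_{1\le i,j\le N}$ be i.i.d. copies of $h$, and let $$F_N(\beta)=\log\sum_{\sigma\in\{-1,1\}^N}\exp\Bigl(\frac{\beta}{\sqrt N}\sum_{i,j=1}^N h_{ij}\sigma_i\sigma_j\Bigr)$$ be the free energy of the Sherrington–Kirkpatrick model with disorder $h$. For a nondecreasing $f:\mathbb R\to\mathbb R$ with $\mathbb E f(g)^2<\infty$, $g$ standard Gaussian, and for $0\le t\le 1$, put $$w(t)=\mathbb E\bigl[f(\sqrt t\,g+\sqrt{1-t}\,g^1)\,f(\sqrt t\,g+\sqrt{1-t}\,g^2)\bigr],$$ where $g,g^1,g^2$ are independent standard Gaussian random variables. There are constants $c,K>0$ depending only on $\beta$ such that for every random variable $h$ with $\mathbb E h=0$, $\mathbb E h^2=1$, $\mathbb E|h|^3<\infty$, and every nondecreasing $f$ such that $h$ has the law of $f(g)$, for all $N\ge 2$ the free energy $F_N(\beta)$ is square integrable and $$\mathrm{Var}(F_N(\beta))\le K\bigl(\mathbb E|h|^3+1\bigr)\,N\,\Bigl(1-w(r_N)+\frac1{\log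 N}\Bigr),\qquad r_N=\min\bigl\{(\log N)^{-c/\log N},\,1\bigr\}.$$ (For $N\ge 3$ the minimum equals $(\log N)^{-c/\log N}$; it is needed only for $N=2$, where $\log 2<1$ and the power exceeds $1$.) Consequently, for every $\beta>0$ and every random variable $h$ with $\mathbb E h=0$, $\mathbb E h^2=1$ and $\mathbb E|h|^3<\infty$, the free energy is superconcentrated: $\mathrm{Var}(F_N(\beta))=o(N)$ as $N\to\infty$. -/

import Mathlib

open MeasureTheory ProbabilityTheory
open scoped Asymptotics

/-- `-H_N(σ) = (β / √N) ∑_{i,j} x_{ij} σ_i σ_j`, for a matrix `x` of couplings and spins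
`σ ∈ {-1, 1}^N` (the units of `ℤ` are exactly `1` and `-1`). -/
noncomputable def negHamiltonian (β : ℝ) {N : ℕ} (x : Fin N → Fin N → ℝ) (σ : Fin N → ℤˣ) : ℝ :=
  β / √(N : ℝ) * ∑ i, ∑ j, x i j * ((σ i : ℤ) : ℝ) * ((σ j : ℤ) : ℝ)

/-- The free energy `log ∑_σ exp (-H_N(σ))` for the couplings `x`. -/
noncomputable def freeEnergy (β : ℝ) {N : ℕ} (x : Fin N → Fin N → ℝ) : ℝ :=
  Real.log (∑ σ : Fin N → ℤˣ, Real.exp (negHamiltonian β x σ))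

/-- The array `h = (h_{ij})` consists of independent random variables with common law `ν`. -/
def IsIIDArray {Ω : Type*} [MeasurableSpace Ω] {N : ℕ} (h : Fin N → Fin N → Ω → ℝ)
    (ν : Measure ℝ) (P : Measure Ω) : Prop :=
  iIndepFun (fun (p : Fin N × Fin N) => h p.1 p.2) P ∧ ∀ i j, HasLaw (h i j) ν P

/-- The random free energy `F_N(β)` of the array `h`. -/
noncomputable def randomFreeEnergy (β : ℝ) {Ω : Type*} {N : ℕ}
    (h : Fin N → Fin N → Ω → ℝ) (ω : Ω) : ℝ :=
  freeEnergy β (fun i j => h i j ω)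

/-- `ν` is the law of a random variable `h` with `E h = 0`, `E h² = 1` and `E |h|³ < ∞`. -/
structure IsNormalizedDisorder (ν : Measure ℝ) : Prop where
  isProbabilityMeasure : IsProbabilityMeasure ν
  mean_eq_zero : ∫ x, x ∂ν = 0
  second_moment_eq_one : ∫ x, x ^ 2 ∂ν = 1
  integrable_third_moment : Integrable (fun x => |x| ^ 3) ν

/-- `w(t) = E f(√t g + √(1-t) g¹) f(√t g + √(1-t) g²)` with `g, g¹, g²` independent standard
Gaussian, for `0 ≤ t ≤ 1`. -/
noncomputable def gaussCorrelation (f : ℝ → ℝ) (t : ℝ) : ℝ :=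
  ∫ p : ℝ × ℝ × ℝ, f (√t * p.1 + √(1 - t) * p.2.1) * f (√t * p.1 + √(1 - t) * p.2.2)
    ∂((gaussianReal 0 1).prod ((gaussianReal 0 1).prod (gaussianReal 0 1)))

/-! Write the disorder as `h = f(g)` and let `V(t)` be the covariance of the free energies of two
systems whose generating Gaussian variables have correlation `t` entrywise
(`freeEnergyCorrelation`). Then `V(0) = 0` and `V(1)` is the variance. The bound comes from
splitting `V(1) = (V(1) - V(r)) + V(r)` at a correlation `r = r_N` close to 1.

The first term is a Lipschitz estimate. Identifying the two copies of one entry costs at most `b² (1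
- w(r))` with `b = β / √N`, and there are `N²` entries (`freeEnergyCorrelation_one_sub_le`).

For the second term, Cauchy–Schwarz gives `V(t)² ≤ V(t²) V(1)`, since two copies that are
conditionally independent given a third one, each with correlation `t` to it, have correlation `t²`
(`sq_noiseCorrelation_le`). Hence a gain of `N^{-1/2}` over the trivial order `N` at small `t`
propagates towards 1, and at `r` a factor `1 / log N` is left (`decay_le_div_log`).

The gain at small `t` is the estimate `V(t) = O(√N)` (`freeEnergyCorrelation_le_sqrt`). A Bessel
inequality makes the entry covariance `w` small when `t` is small. Replacing independent entry pairs
by correlated ones, one entry at a time, bounds `V(t)` by `b² w` times an average of the overlap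
`∑_k ⟨χ_k⟩ ⟨χ_k⟩'`, where `χ_k = σ_i σ_j`, plus third order errors `N² b³ = O(√N)`. It remains to
see that the expected overlap is `O(N^{3/2})` (`PairMoments.mul_integral_pairOverlap_le`). For this,
couple the two systems by an energy `ℓ ∑_k χ_k(σ) χ_k(τ)` with `ℓ` of order `1/N`. When an
independent pair of random signs is replaced by a correlated pair, lower the coupling at that entry
by `b² w`: the leading terms cancel up to `-b² w ⟨χ_k(σ)⟩ ⟨χ_k(τ)⟩`, and the sum over `k` of these
products is an averaged squared spin overlap, so the total has a favourable sign. The gain in free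
energy is thus controlled by the case of independent signs. There gauge symmetry turns the overlap
into the square of a sum of `N` uniform spins, whose exponential moment is bounded
(`integral_overlapExpMoment_le`).

Superconcentration follows because every law is that of a measurable `f(g)`, `w(t) → 1` as `t → 1`
for such `f`, and `r_N → 1`. -/

/-! ### Gibbs averages over a finite set and Taylor expansions of the log-partition function. -/

section Gibbs

variable {A : Type*} [Fintype A]

/-- The logarithm of the partition function of the weights `exp (E a)`. -/
noncomputable def logSumExp (E : A → ℝ) : ℝ := Real.log (∑ a, Real.exp (E a))

/-- The average of `Y` under the probability proportional to `exp (E a)`. -/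
noncomputable def gibbsAvg (E Y : A → ℝ) : ℝ :=
  (∑ a, Real.exp (E a) * Y a) / ∑ a, Real.exp (E a)

lemma gibbsAvg_add (E Y Z : A → ℝ) :
    gibbsAvg E (fun a => Y a + Z a) = gibbsAvg E Y + gibbsAvg E Z := by
  simp only [gibbsAvg, mul_add, Finset.sum_add_distrib, add_div]

lemma gibbsAvg_const_mul (E Y : A → ℝ) (c : ℝ) :
    gibbsAvg E (fun a => c * Y a) = c * gibbsAvg E Y := by
  simp only [gibbsAvg, mul_left_comm _ c, ← Finset.mul_sum, mul_div_assoc]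

lemma gibbsAvg_sub (E Y Z : A → ℝ) :
    gibbsAvg E (fun a => Y a - Z a) = gibbsAvg E Y - gibbsAvg E Z := by
  simp only [gibbsAvg, mul_sub, Finset.sum_sub_distrib, sub_div]

lemma gibbsAvg_sum {ι : Type*} (s : Finset ι) (E : A → ℝ) (Y : ι → A → ℝ) :
    gibbsAvg E (fun a => ∑ i ∈ s, Y i a) = ∑ i ∈ s, gibbsAvg E (Y i) := by
  simp only [gibbsAvg, Finset.mul_sum, ← Finset.sum_div]
  rw [Finset.sum_comm]

lemma gibbsAvg_nonneg (E : A → ℝ) {Y : A → ℝ} (h : ∀ a, 0 ≤ Y a) : 0 ≤ gibbsAvg E Y :=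
  div_nonneg (Finset.sum_nonneg fun a _ => mul_nonneg (Real.exp_pos _).le (h a))
    (Finset.sum_nonneg fun _ _ => (Real.exp_pos _).le)

lemma gibbsAvg_mono (E : A → ℝ) {Y Z : A → ℝ} (h : ∀ a, Y a ≤ Z a) :
    gibbsAvg E Y ≤ gibbsAvg E Z := by
  have := gibbsAvg_nonneg E (Y := fun a => Z a - Y a) (fun a => sub_nonneg.2 (h a))
  rw [gibbsAvg_sub] at this
  linarith

variable [Nonempty A]

lemma sum_exp_pos (E : A → ℝ) : 0 < ∑ a, Real.exp (E a) :=
  Finset.sum_pos (fun _ _ => Real.exp_pos _) Finset.univ_nonempty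

lemma gibbsAvg_const (E : A → ℝ) (c : ℝ) : gibbsAvg E (fun _ => c) = c := by
  rw [gibbsAvg, ← Finset.sum_mul, mul_div_cancel_left₀ _ (sum_exp_pos E).ne']

lemma gibbsAvg_pos (E : A → ℝ) {Y : A → ℝ} (h : ∀ a, 0 < Y a) : 0 < gibbsAvg E Y :=
  div_pos (Finset.sum_pos (fun a _ => mul_pos (Real.exp_pos _) (h a)) Finset.univ_nonempty)
    (sum_exp_pos E)

lemma gibbsAvg_le (E : A → ℝ) {Y : A → ℝ} {c : ℝ} (h : ∀ a, Y a ≤ c) : gibbsAvg E Y ≤ c :=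
  (gibbsAvg_mono E h).trans_eq (gibbsAvg_const E c)

lemma le_gibbsAvg (E : A → ℝ) {Y : A → ℝ} {c : ℝ} (h : ∀ a, c ≤ Y a) : c ≤ gibbsAvg E Y :=
  (gibbsAvg_const E c).symm.trans_le (gibbsAvg_mono E h)

lemma abs_gibbsAvg_le (E : A → ℝ) {Y : A → ℝ} {c : ℝ} (h : ∀ a, |Y a| ≤ c) :
    |gibbsAvg E Y| ≤ c :=
  abs_le.2 ⟨le_gibbsAvg E fun a => (abs_le.1 (h a)).1, gibbsAvg_le E fun a => (abs_le.1 (h a)).2⟩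

lemma logSumExp_add (E X : A → ℝ) :
    logSumExp (fun a => E a + X a) =
      logSumExp E + Real.log (gibbsAvg E (fun a => Real.exp (X a))) := by
  have h := sum_exp_pos E
  have h' : gibbsAvg E (fun a => Real.exp (X a)) ≠ 0 :=
    (gibbsAvg_pos E fun a => Real.exp_pos _).ne'
  rw [logSumExp, logSumExp, ← Real.log_mul h.ne' h', gibbsAvg, mul_div_cancel₀ _ h.ne']
  simp only [Real.exp_add]

/-- Jensen's inequality. -/
lemma gibbsAvg_le_log (E X : A → ℝ) :
    gibbsAvg E X ≤ Real.log (gibbsAvg E (fun a => Real.exp (X a))) := by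
  rw [Real.le_log_iff_exp_le (gibbsAvg_pos E fun a => Real.exp_pos _)]
  set m := gibbsAvg E X
  have h1 : ∀ a, Real.exp m * (X a - m) + Real.exp m ≤ Real.exp (X a) := fun a => by
    have := Real.add_one_le_exp (X a - m)
    have h2 : Real.exp (X a) = Real.exp m * Real.exp (X a - m) := by
      rw [← Real.exp_add]; congr 1; ring
    rw [h2]
    nlinarith [Real.exp_pos m]
  have h2 := gibbsAvg_mono E h1
  rw [gibbsAvg_add, gibbsAvg_const_mul, gibbsAvg_sub, gibbsAvg_const, gibbsAvg_const] at h2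
  simpa [m] using h2

lemma abs_log_gibbsAvg_exp_le (E : A → ℝ) {X : A → ℝ} {B : ℝ} (h : ∀ a, |X a| ≤ B) :
    |Real.log (gibbsAvg E (fun a => Real.exp (X a)))| ≤ B := by
  have hp := gibbsAvg_pos E (Y := fun a => Real.exp (X a)) fun a => Real.exp_pos _
  rw [abs_le]
  constructor
  · rw [Real.le_log_iff_exp_le hp]
    exact le_gibbsAvg E fun a => Real.exp_le_exp.2 (abs_le.1 (h a)).1
  · rw [Real.log_le_iff_le_exp hp]
    exact gibbsAvg_le E fun a => Real.exp_le_exp.2 (abs_le.1 (h a)).2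

lemma abs_logSumExp_add_sub_le (E : A → ℝ) {X : A → ℝ} {B : ℝ} (h : ∀ a, |X a| ≤ B) :
    |logSumExp (fun a => E a + X a) - logSumExp E| ≤ B := by
  rw [logSumExp_add, add_sub_cancel_left]
  exact abs_log_gibbsAvg_exp_le E h

/-- The tilt multiplies every weight by a factor in `[e^{-B}, e^B]`, so numerator and denominator
together cost at most `e^{-2B} ≥ 1 - 2B`. -/
lemma gibbsAvg_tilt_ge (E : A → ℝ) {X Y : A → ℝ} {B : ℝ} (hX : ∀ a, |X a| ≤ B)
    (hY : ∀ a, 0 ≤ Y a) :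
    (1 - 2 * B) * gibbsAvg E Y ≤ gibbsAvg (fun a => E a + X a) Y := by
  have h1 : Real.exp (-(2 * B)) * gibbsAvg E Y ≤ gibbsAvg (fun a => E a + X a) Y := by
    unfold gibbsAvg
    rw [← mul_div_assoc, div_le_div_iff₀ (sum_exp_pos E) (sum_exp_pos _)]
    have e1 : ∑ a, Real.exp (E a + X a) ≤ Real.exp B * ∑ a, Real.exp (E a) := by
      rw [Finset.mul_sum]
      refine Finset.sum_le_sum fun a _ => ?_
      rw [← Real.exp_add]
      exact Real.exp_le_exp.2 (by linarith [(abs_le.1 (hX a)).2])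
    have e2 : Real.exp (-B) * ∑ a, Real.exp (E a) * Y a ≤ ∑ a, Real.exp (E a + X a) * Y a := by
      rw [Finset.mul_sum]
      refine Finset.sum_le_sum fun a _ => ?_
      rw [← mul_assoc, ← Real.exp_add]
      exact mul_le_mul_of_nonneg_right
        (Real.exp_le_exp.2 (by linarith [(abs_le.1 (hX a)).1])) (hY a)
    have e3 : 0 ≤ ∑ a, Real.exp (E a) * Y a :=
      Finset.sum_nonneg fun a _ => mul_nonneg (Real.exp_pos _).le (hY a)
    calc Real.exp (-(2 * B)) * (∑ a, Real.exp (E a) * Y a) * ∑ a, Real.exp (E a + X a)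
        ≤ Real.exp (-(2 * B)) * (∑ a, Real.exp (E a) * Y a) *
            (Real.exp B * ∑ a, Real.exp (E a)) := by gcongr
      _ = (Real.exp (-(2 * B)) * Real.exp B) * (∑ a, Real.exp (E a) * Y a) *
            ∑ a, Real.exp (E a) := by ring
      _ = (Real.exp (-B) * (∑ a, Real.exp (E a) * Y a)) * ∑ a, Real.exp (E a) := by
          rw [← Real.exp_add]; congr 3; ring
      _ ≤ _ := by gcongr
  have h2 : 1 - 2 * B ≤ Real.exp (-(2 * B)) := by
    have := Real.add_one_le_exp (-(2 * B)); linarith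
  exact (mul_le_mul_of_nonneg_right h2 (gibbsAvg_nonneg E hY)).trans h1

/-- Apply the one-sided bound to the nonnegative observables `1 + Y` and `1 - Y`, both at most 2. -/
lemma abs_gibbsAvg_tilt_sub_le (E : A → ℝ) {X Y : A → ℝ} {B : ℝ} (hX : ∀ a, |X a| ≤ B)
    (hY : ∀ a, |Y a| ≤ 1) :
    |gibbsAvg (fun a => E a + X a) Y - gibbsAvg E Y| ≤ 4 * B := by
  have hB : 0 ≤ B := (abs_nonneg _).trans (hX (Classical.arbitrary A))
  have h1 := gibbsAvg_tilt_ge E hX (Y := fun a => 1 + Y a)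
    fun a => by linarith [(abs_le.1 (hY a)).1]
  have h2 := gibbsAvg_tilt_ge E hX (Y := fun a => 1 - Y a)
    fun a => by linarith [(abs_le.1 (hY a)).2]
  rw [gibbsAvg_add, gibbsAvg_add, gibbsAvg_const, gibbsAvg_const] at h1
  rw [gibbsAvg_sub, gibbsAvg_sub, gibbsAvg_const, gibbsAvg_const] at h2
  have h3 := abs_le.1 (abs_gibbsAvg_le E hY)
  rw [abs_le]
  constructor <;> nlinarith

lemma log_gibbsAvg_exp_center (E X : A → ℝ) (m : ℝ) :
    Real.log (gibbsAvg E (fun a => Real.exp (X a))) =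
      m + Real.log (gibbsAvg E (fun a => Real.exp (X a - m))) := by
  have h : (fun a => Real.exp (X a)) = fun a => Real.exp m * Real.exp (X a - m) := by
    funext a; rw [← Real.exp_add]; congr 1; ring
  rw [h, gibbsAvg_const_mul, Real.log_mul (Real.exp_pos _).ne'
    (gibbsAvg_pos E fun a => Real.exp_pos _).ne', Real.log_exp]

lemma log_gibbsAvg_exp_sub_le (E : A → ℝ) {X : A → ℝ} {B : ℝ} (h : ∀ a, |X a| ≤ B) :
    |Real.log (gibbsAvg E (fun a => Real.exp (X a))) - gibbsAvg E X| ≤ 4 * B ^ 2 := by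
  have hB : 0 ≤ B := (abs_nonneg _).trans (h (Classical.arbitrary A))
  have hJ := gibbsAvg_le_log E X
  have hm := abs_gibbsAvg_le E h
  rw [abs_of_nonneg (by linarith)]
  -- For small `B`, centre `X` and use the quadratic bound on `exp`. For `B ≥ 1/2` the crude bound
  -- `2 B ≤ 4 B²` is enough.
  rcases le_total B (1 / 2) with h1 | h1
  · set m := gibbsAvg E X with hmdef
    rw [log_gibbsAvg_exp_center E X m]
    have hY : ∀ a, |X a - m| ≤ 2 * B := fun a => (abs_sub _ _).trans (by linarith [h a])
    have h2 := Real.log_le_sub_one_of_pos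
      (gibbsAvg_pos E (Y := fun a => Real.exp (X a - m)) fun a => Real.exp_pos _)
    have h3 : gibbsAvg E (fun a => Real.exp (X a - m)) ≤
        gibbsAvg E (fun a => (X a - m) + (1 + 4 * B ^ 2)) := by
      refine gibbsAvg_mono E fun a => ?_
      have h4 := Real.abs_exp_sub_one_sub_id_le (x := X a - m) ((hY a).trans (by linarith))
      have h5 := (abs_le.1 h4).2
      have h6 := sq_le_sq' (abs_le.1 (hY a)).1 (abs_le.1 (hY a)).2
      nlinarith
    rw [gibbsAvg_add, gibbsAvg_sub, gibbsAvg_const, gibbsAvg_const, ← hmdef] at h3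
    linarith
  · have h2 := abs_le.1 (abs_log_gibbsAvg_exp_le E h)
    have h3 := abs_le.1 hm
    nlinarith

/-- Second cumulant expansion. After centring, the exponential average is `q = 1 + V/2 + O(B³)` with
`V` the variance, and `log q = q - 1 + O((q - 1)²)` with `(q - 1)² ≤ B³`. If `B ≥ 1/4`, each term is
separately `O(B³)`. -/
lemma log_gibbsAvg_exp_second_order (E : A → ℝ) {X : A → ℝ} {B : ℝ} (h : ∀ a, |X a| ≤ B) :
    |Real.log (gibbsAvg E (fun a => Real.exp (X a))) - gibbsAvg E X
      - (gibbsAvg E (fun a => X a ^ 2) - gibbsAvg E X ^ 2) / 2| ≤ 40 * B ^ 3 := by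
  have hB : 0 ≤ B := (abs_nonneg _).trans (h (Classical.arbitrary A))
  have hm := abs_gibbsAvg_le E h
  set m := gibbsAvg E X with hmdef
  have hV : gibbsAvg E (fun a => (X a - m) ^ 2) = gibbsAvg E (fun a => X a ^ 2) - m ^ 2 := by
    have : (fun a => (X a - m) ^ 2) = fun a => X a ^ 2 - 2 * m * X a + m ^ 2 := by
      funext a; ring
    rw [this, gibbsAvg_add, gibbsAvg_sub, gibbsAvg_const_mul, gibbsAvg_const, ← hmdef]; ring
  have hV0 : 0 ≤ gibbsAvg E (fun a => (X a - m) ^ 2) := gibbsAvg_nonneg E fun a => sq_nonneg _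
  have hX2 : gibbsAvg E (fun a => X a ^ 2) ≤ B ^ 2 :=
    gibbsAvg_le E fun a => sq_le_sq' (abs_le.1 (h a)).1 (abs_le.1 (h a)).2
  rw [← hV]
  set V := gibbsAvg E (fun a => (X a - m) ^ 2) with hVdef
  have hVB : V ≤ B ^ 2 := by nlinarith [sq_nonneg m]
  rcases le_total B (1 / 4) with h1 | h1
  · rw [log_gibbsAvg_exp_center E X m]
    have hY : ∀ a, |X a - m| ≤ 2 * B := fun a => (abs_sub _ _).trans (by linarith [h a])
    set q := gibbsAvg E (fun a => Real.exp (X a - m)) with hq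
    have hq1 : 1 ≤ q := by
      have := gibbsAvg_mono E (Y := fun a => (X a - m) + 1) (Z := fun a => Real.exp (X a - m))
        fun a => Real.add_one_le_exp _
      rw [gibbsAvg_add, gibbsAvg_sub, gibbsAvg_const, gibbsAvg_const, ← hmdef] at this
      linarith
    have hr : |q - 1 - V / 2| ≤ 2 * B ^ 3 := by
      have e : q - 1 - V / 2 = gibbsAvg E (fun a => Real.exp (X a - m) -
          (1 + (X a - m) + 2⁻¹ * (X a - m) ^ 2)) := by
        rw [gibbsAvg_sub, gibbsAvg_add, gibbsAvg_add, gibbsAvg_const_mul, gibbsAvg_sub,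
          gibbsAvg_const, gibbsAvg_const, ← hmdef, ← hVdef, ← hq]; ring
      rw [e]
      refine abs_gibbsAvg_le E fun a => ?_
      have h4 := Real.exp_bound (x := X a - m) ((hY a).trans (by linarith)) (n := 3) (by norm_num)
      simp only [Finset.sum_range_succ, Finset.sum_range_zero, Nat.factorial] at h4
      norm_num at h4
      have h5 : |X a - m| ^ 3 ≤ (2 * B) ^ 3 := pow_le_pow_left₀ (abs_nonneg _) (hY a) 3
      have e2 : 1 + (X a - m) + 2⁻¹ * (X a - m) ^ 2 = 1 + (X a - m) + (X a - m) ^ 2 / 2 := by ring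
      rw [e2]
      refine h4.trans ?_
      nlinarith [pow_nonneg hB 3]
    have h5 := Real.log_le_sub_one_of_pos (x := q) (by linarith)
    have h6 := Real.one_sub_inv_le_log_of_pos (x := q) (by linarith)
    have h7 : q - 1 - (q - 1) ^ 2 ≤ 1 - q⁻¹ := by
      have : 1 - q⁻¹ - (q - 1 - (q - 1) ^ 2) = (q - 1) ^ 3 / q := by
        field_simp
        ring
      have h8 : 0 ≤ (q - 1) ^ 3 / q := div_nonneg (pow_nonneg (by linarith) 3) (by linarith)
      nlinarith
    have hB3 : 0 ≤ B ^ 3 := pow_nonneg hB 3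
    have hr' := abs_le.1 hr
    have hqB : q - 1 ≤ B ^ 2 := by nlinarith
    have hq2 : (q - 1) ^ 2 ≤ B ^ 3 := by
      calc (q - 1) ^ 2 ≤ (B ^ 2) ^ 2 := pow_le_pow_left₀ (by linarith) hqB 2
        _ = B ^ 3 * B := by ring
        _ ≤ B ^ 3 * 1 := mul_le_mul_of_nonneg_left (by linarith) hB3
        _ = _ := mul_one _
    rw [abs_le]
    constructor <;> linarith
  · have h2 := abs_le.1 (abs_log_gibbsAvg_exp_le E h)
    have h3 := abs_le.1 hm
    have h4 : B ≤ 16 * B ^ 3 := by nlinarith [mul_nonneg hB (by nlinarith : (0:ℝ) ≤ 16 * B ^ 2 - 1)]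
    have h5 : B ^ 2 ≤ 4 * B ^ 3 := by nlinarith [sq_nonneg B]
    rw [abs_le]
    constructor <;> nlinarith

end Gibbs

/-! ### Interpolation along random subsets (Russo's formula). -/

section Interpolation

variable {ι : Type*} [DecidableEq ι]

/-- Adding or removing `k`. -/
def toggle (k : ι) (S : Finset ι) : Finset ι := if k ∈ S then S.erase k else insert k S

lemma toggle_toggle (k : ι) (S : Finset ι) : toggle k (toggle k S) = S := by
  unfold toggle
  by_cases h : k ∈ S <;> simp [h]

lemma mem_toggle_self (k : ι) (S : Finset ι) : k ∈ toggle k S ↔ k ∉ S := by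
  unfold toggle; by_cases h : k ∈ S <;> simp [h]

lemma mem_toggle_of_ne {j k : ι} (h : j ≠ k) (S : Finset ι) : j ∈ toggle k S ↔ j ∈ S := by
  unfold toggle; by_cases hk : k ∈ S <;> simp [hk, h]

lemma insert_toggle (k : ι) (S : Finset ι) : insert k (toggle k S) = insert k S := by
  unfold toggle; by_cases hk : k ∈ S <;> simp [hk]

lemma erase_toggle (k : ι) (S : Finset ι) : (toggle k S).erase k = S.erase k := by
  unfold toggle; by_cases hk : k ∈ S <;> simp [hk]

variable [Fintype ι]

/-- The probability that the random subset of `ι` containing each point independently with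
probability `p` equals `S`. -/
def subsetWeight (p : ℝ) (S : Finset ι) : ℝ := ∏ k, if k ∈ S then p else 1 - p

lemma subsetWeight_nonneg {p : ℝ} (h0 : 0 ≤ p) (h1 : p ≤ 1) (S : Finset ι) :
    0 ≤ subsetWeight p S :=
  Finset.prod_nonneg fun k _ => by split_ifs <;> linarith

lemma sum_subsetWeight (p : ℝ) : ∑ S : Finset ι, subsetWeight p S = 1 := by
  have h := Fintype.prod_add (fun _ : ι => p) (fun _ => 1 - p)
  simp only [add_sub_cancel, Finset.prod_const_one] at h
  rw [h]
  refine Finset.sum_congr rfl fun S _ => ?_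
  rw [subsetWeight, Finset.prod_ite]
  congr 1 <;> refine Finset.prod_congr ?_ fun _ _ => rfl <;> ext <;> simp

lemma sum_toggle (k : ι) (g : Finset ι → ℝ) : ∑ S, g (toggle k S) = ∑ S, g S :=
  Fintype.sum_equiv (Function.Involutive.toPerm (toggle k) (toggle_toggle k)) _ _ fun _ => rfl

/-- Group each `S` with `toggle k S`. The factors from the other points agree, and on the right the
two weights at `k` add up to `p + (1 - p) = 1`. -/
lemma sum_subsetWeight_deriv (p : ℝ) (k : ι) (a : Finset ι → ℝ) :
    ∑ S, (∏ j ∈ Finset.univ.erase k, if j ∈ S then p else 1 - p) *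
        (if k ∈ S then 1 else -1) * a S =
      ∑ S, subsetWeight p S * (a (insert k S) - a (S.erase k)) := by
  set r : Finset ι → ℝ := fun S => ∏ j ∈ Finset.univ.erase k, if j ∈ S then p else 1 - p
  have hr : ∀ S, r (toggle k S) = r S := fun S => Finset.prod_congr rfl fun j hj => by
    simp only [mem_toggle_of_ne (Finset.ne_of_mem_erase hj)]
  have hq : ∀ S, subsetWeight p S = r S * (if k ∈ S then p else 1 - p) := fun S =>
    (Finset.prod_erase_mul _ _ (Finset.mem_univ k)).symm
  have key : ∀ g g' : Finset ι → ℝ, (∀ S, g S + g (toggle k S) = g' S + g' (toggle k S)) →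
      ∑ S, g S = ∑ S, g' S := fun g g' h => by
    have := Finset.sum_congr (rfl : (Finset.univ : Finset (Finset ι)) = _) fun S _ => h S
    rw [Finset.sum_add_distrib, Finset.sum_add_distrib, sum_toggle, sum_toggle] at this
    linarith
  refine key _ _ fun S => ?_
  change r S * _ * _ + r (toggle k S) * _ * _ = _
  rw [hq, hq, hr, insert_toggle, erase_toggle]
  simp only [mem_toggle_self]
  by_cases h : k ∈ S
  · have e : toggle k S = S.erase k := by simp [toggle, h]
    rw [e, Finset.insert_eq_of_mem h]
    simp [h]; ring
  · have e : toggle k S = insert k S := by simp [toggle, h]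
    rw [e, Finset.erase_eq_of_notMem h]
    simp [h]; ring

lemma hasDerivAt_subsetWeight (p : ℝ) (S : Finset ι) :
    HasDerivAt (fun q => subsetWeight q S)
      (∑ k, (∏ j ∈ Finset.univ.erase k, if j ∈ S then p else 1 - p) *
        (if k ∈ S then 1 else -1)) p := by
  have h : ∀ k ∈ (Finset.univ : Finset ι), HasDerivAt (fun q : ℝ => if k ∈ S then q else 1 - q)
      (if k ∈ S then 1 else -1) p := fun k _ => by
    by_cases hk : k ∈ S
    · simpa [hk] using hasDerivAt_id' p
    · simpa [hk] using (hasDerivAt_id' p).const_sub 1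
  simpa [subsetWeight, smul_eq_mul] using HasDerivAt.fun_finsetProd h

/-- Interpolation between `a ∅` and `a univ` along random subsets of growing density. -/
lemma sub_le_of_forall_sum_subsetWeight_le (a : Finset ι → ℝ) (B : ℝ)
    (h : ∀ p ∈ Set.Ioo (0 : ℝ) 1,
      ∑ S, subsetWeight p S * ∑ k, (a (insert k S) - a (S.erase k)) ≤ B) :
    a Finset.univ - a ∅ ≤ B := by
  set D : ℝ → ℝ := fun p => ∑ S, subsetWeight p S * a S with hD
  -- Russo's formula: the derivative in the density is the expected sum of the effects of adding and
  -- removing one point.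
  have hd : ∀ p, HasDerivAt D
      (∑ S, subsetWeight p S * ∑ k, (a (insert k S) - a (S.erase k))) p := fun p => by
    have h1 := HasDerivAt.fun_sum (u := Finset.univ)
      fun S _ => (hasDerivAt_subsetWeight p S).mul_const (a S)
    refine h1.congr_deriv (Eq.symm ?_)
    simp only [Finset.mul_sum, Finset.sum_mul]
    rw [Finset.sum_comm]
    conv_rhs => rw [Finset.sum_comm]
    exact Finset.sum_congr rfl fun k _ => (sum_subsetWeight_deriv p k a).symm
  have h0 : D 0 = a ∅ := by
    simp only [hD]
    rw [Finset.sum_eq_single ∅]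
    · simp [subsetWeight]
    · intro S _ hS
      obtain ⟨k, hk⟩ := Finset.nonempty_iff_ne_empty.2 hS
      rw [subsetWeight, Finset.prod_eq_zero (Finset.mem_univ k) (by simp [hk]), zero_mul]
    · simp
  have h1 : D 1 = a Finset.univ := by
    simp only [hD]
    rw [Finset.sum_eq_single Finset.univ]
    · simp [subsetWeight]
    · intro S _ hS
      obtain ⟨k, hk⟩ : ∃ k, k ∉ S := by
        by_contra! hc
        exact hS (Finset.eq_univ_iff_forall.2 hc)
      rw [subsetWeight, Finset.prod_eq_zero (Finset.mem_univ k) (by simp [hk]), zero_mul]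
    · simp
  have h2 := (convex_Icc (0 : ℝ) 1).image_sub_le_mul_sub_of_deriv_le (f := D) (C := B)
    (fun p _ => (hd p).continuousAt.continuousWithinAt)
    (fun p _ => (hd p).differentiableAt.differentiableWithinAt)
    (fun p hp => by rw [(hd p).deriv]; exact h p (by simpa using hp))
    0 (by simp) 1 (by simp) (by simp)
  rw [h0, h1] at h2
  simpa using h2

lemma sub_le_of_forall_sum_le (a : Finset ι → ℝ) (B : ℝ)
    (h : ∀ S, ∑ k, (a (insert k S) - a (S.erase k)) ≤ B) : a Finset.univ - a ∅ ≤ B :=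
  sub_le_of_forall_sum_subsetWeight_le a B fun p hp => calc
    _ ≤ ∑ S, subsetWeight p S * B := Finset.sum_le_sum fun S _ =>
        mul_le_mul_of_nonneg_left (h S) (subsetWeight_nonneg hp.1.le hp.2.le S)
    _ = B := by rw [← Finset.sum_mul, sum_subsetWeight, one_mul]

end Interpolation

/-! ### Resampling single coordinates of product measures, and mixtures. -/

lemma ite_mem_insert_eq_update {α ι : Type*} [DecidableEq ι] (S : Finset ι) (k : ι) (a a' : α) :
    (fun j => if j ∈ insert k S then a else a') =
      Function.update (fun j => if j ∈ S then a else a') k a := by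
  funext j
  by_cases h : j = k
  · subst h; simp
  · simp [h]

lemma ite_mem_erase_eq_update {α ι : Type*} [DecidableEq ι] (S : Finset ι) (k : ι) (a a' : α) :
    (fun j => if j ∈ S.erase k then a else a') =
      Function.update (fun j => if j ∈ S then a else a') k a' := by
  funext j
  by_cases h : j = k
  · subst h; simp
  · simp [h]

section Resampling

variable {ι : Type*} [Fintype ι] [DecidableEq ι] {E : Type*} [MeasurableSpace E]

/-- Replacing the coordinate `k` of a random vector with independent coordinates by an
independent variable. -/
lemma measurePreserving_update (m : ι → Measure E) [∀ i, IsProbabilityMeasure (m i)] (k : ι)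
    (μ : Measure E) [IsProbabilityMeasure μ] :
    MeasurePreserving (fun z : (ι → E) × E => Function.update z.1 k z.2)
      ((Measure.pi m).prod μ) (Measure.pi (Function.update m k μ)) := by
  have hmeas : Measurable (fun z : (ι → E) × E => Function.update z.1 k z.2) := by
    refine measurable_pi_lambda _ fun i => ?_
    by_cases h : i = k
    · subst h; simpa using measurable_snd
    · simp only [Function.update_of_ne h]; fun_prop
  have : ∀ i, IsProbabilityMeasure (Function.update m k μ i) := fun i => by
    by_cases h : i = k
    · subst h; simpa
    · rw [Function.update_of_ne h]; infer_instance
  refine ⟨hmeas, (Measure.pi_eq fun s hs => ?_).symm⟩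
  rw [Measure.map_apply hmeas (MeasurableSet.univ_pi hs)]
  have : (fun z : (ι → E) × E => Function.update z.1 k z.2) ⁻¹' Set.univ.pi s =
      (Set.univ.pi (Function.update s k Set.univ)) ×ˢ s k := by
    ext z
    simp only [Set.mem_preimage, Set.mem_pi, Set.mem_univ, true_imp_iff, Set.mem_prod]
    constructor
    · intro h
      refine ⟨fun i => ?_, by simpa using h k⟩
      by_cases hi : i = k
      · subst hi; simp
      · simpa [Function.update_of_ne hi] using h i
    · rintro ⟨h1, h2⟩ i
      by_cases hi : i = k
      · subst hi; simpa using h2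
      · simpa [Function.update_of_ne hi] using h1 i
  rw [this, Measure.prod_prod, Measure.pi_pi, ← Finset.prod_erase_mul _ _ (Finset.mem_univ k),
    ← Finset.prod_erase_mul Finset.univ (fun i => Function.update m k μ i (s i))
      (Finset.mem_univ k)]
  simp only [Function.update_self, measure_univ, mul_one]
  congr 1
  refine Finset.prod_congr rfl fun i hi => ?_
  have hi := Finset.ne_of_mem_erase hi
  simp [Function.update_of_ne hi]

lemma integrable_update_of_integrable {m : ι → Measure E} [∀ i, IsProbabilityMeasure (m i)]
    {k : ι} {μ : Measure E} [IsProbabilityMeasure μ] {Θ : (ι → E) → ℝ}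
    (h : Integrable Θ (Measure.pi (Function.update m k μ))) :
    Integrable (fun z : (ι → E) × E => Θ (Function.update z.1 k z.2)) ((Measure.pi m).prod μ) :=
  (measurePreserving_update m k μ).integrable_comp_of_integrable h

lemma integral_pi_update {m : ι → Measure E} [∀ i, IsProbabilityMeasure (m i)]
    {k : ι} {μ : Measure E} [IsProbabilityMeasure μ] {Θ : (ι → E) → ℝ}
    (h : Integrable Θ (Measure.pi (Function.update m k μ))) :
    ∫ x, Θ x ∂(Measure.pi (Function.update m k μ)) =
      ∫ x, ∫ s, Θ (Function.update x k s) ∂μ ∂(Measure.pi m) := by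
  rw [← integral_prod _ (integrable_update_of_integrable h),
    ← (measurePreserving_update m k μ).map_eq,
    integral_map (measurePreserving_update m k μ).aemeasurable]
  rw [(measurePreserving_update m k μ).map_eq]
  exact h.aestronglyMeasurable

variable (μ μ' : Measure E)

/-- The law of an array whose entries have law `μ` on `S` and law `μ'` off `S`. -/
noncomputable def mixedLaw (S : Finset ι) : Measure (ι → E) :=
  Measure.pi fun k => if k ∈ S then μ else μ'

lemma mixedLaw_univ : mixedLaw μ μ' (Finset.univ : Finset ι) = Measure.pi fun _ => μ := by
  simp [mixedLaw]

lemma mixedLaw_empty : mixedLaw μ μ' (∅ : Finset ι) = Measure.pi fun _ => μ' := by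
  simp [mixedLaw]

/-- The mixture `p μ + (1 - p) μ'`. -/
noncomputable def mixture (p : ℝ) : Measure E :=
  ENNReal.ofReal p • μ + ENNReal.ofReal (1 - p) • μ'

lemma integral_mixture {p : ℝ} (hp0 : 0 ≤ p) (hp1 : p ≤ 1) {g : E → ℝ} (h : Integrable g μ)
    (h' : Integrable g μ') :
    ∫ s, g s ∂(mixture μ μ' p) = p * ∫ s, g s ∂μ + (1 - p) * ∫ s, g s ∂μ' := by
  rw [mixture, integral_add_measure (h.smul_measure ENNReal.ofReal_ne_top)
    (h'.smul_measure ENNReal.ofReal_ne_top), integral_smul_measure, integral_smul_measure,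
    ENNReal.toReal_ofReal hp0, ENNReal.toReal_ofReal (by linarith)]
  simp

lemma integrable_mixture (p : ℝ) {g : E → ℝ} (h : Integrable g μ) (h' : Integrable g μ') :
    Integrable g (mixture μ μ' p) :=
  (h.smul_measure ENNReal.ofReal_ne_top).add_measure (h'.smul_measure ENNReal.ofReal_ne_top)

variable [IsProbabilityMeasure μ] [IsProbabilityMeasure μ']

instance (k : ι) (S : Finset ι) : IsProbabilityMeasure (if k ∈ S then μ else μ') := by
  split_ifs <;> infer_instance

instance (S : Finset ι) : IsProbabilityMeasure (mixedLaw μ μ' S) := by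
  unfold mixedLaw; infer_instance

/-- The old value at `k` is overwritten, so it is irrelevant whether `k ∈ S`. Both `insert k S` and
`S.erase k` are therefore reached from the same base law `mixedLaw μ μ' S`, which makes their
difference a one-coordinate quantity. -/
lemma integral_mixedLaw_insert {S : Finset ι} {k : ι} {Θ : (ι → E) → ℝ}
    (h : Integrable Θ (mixedLaw μ μ' (insert k S))) :
    ∫ x, Θ x ∂(mixedLaw μ μ' (insert k S)) =
      ∫ x, ∫ s, Θ (Function.update x k s) ∂μ ∂(mixedLaw μ μ' S) := by
  unfold mixedLaw at *
  rw [ite_mem_insert_eq_update] at *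
  exact integral_pi_update h

lemma integral_mixedLaw_erase {S : Finset ι} {k : ι} {Θ : (ι → E) → ℝ}
    (h : Integrable Θ (mixedLaw μ μ' (S.erase k))) :
    ∫ x, Θ x ∂(mixedLaw μ μ' (S.erase k)) =
      ∫ x, ∫ s, Θ (Function.update x k s) ∂μ' ∂(mixedLaw μ μ' S) := by
  unfold mixedLaw at *
  rw [ite_mem_erase_eq_update] at *
  exact integral_pi_update h

/-- Bound for the effect of changing the law of the entry `k`, from a bound valid for all values
of the other entries. -/
lemma integral_mixedLaw_insert_sub_erase_le {S : Finset ι} {k : ι} {Θ Θ' g : (ι → E) → ℝ}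
    (h : Integrable Θ (mixedLaw μ μ' (insert k S)))
    (h' : Integrable Θ' (mixedLaw μ μ' (S.erase k)))
    (hg : Integrable g (mixedLaw μ μ' S))
    (hle : ∀ x, ∫ s, Θ (Function.update x k s) ∂μ - ∫ s, Θ' (Function.update x k s) ∂μ' ≤ g x) :
    ∫ x, Θ x ∂(mixedLaw μ μ' (insert k S)) - ∫ x, Θ' x ∂(mixedLaw μ μ' (S.erase k)) ≤
      ∫ x, g x ∂(mixedLaw μ μ' S) := by
  have i1 : Integrable (fun x => ∫ s, Θ (Function.update x k s) ∂μ) (mixedLaw μ μ' S) := by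
    unfold mixedLaw at *
    rw [ite_mem_insert_eq_update] at h
    exact (integrable_update_of_integrable h).integral_prod_left
  have i2 : Integrable (fun x => ∫ s, Θ' (Function.update x k s) ∂μ') (mixedLaw μ μ' S) := by
    unfold mixedLaw at *
    rw [ite_mem_erase_eq_update] at h'
    exact (integrable_update_of_integrable h').integral_prod_left
  rw [integral_mixedLaw_insert _ _ h, integral_mixedLaw_erase _ _ h', ← integral_sub i1 i2]
  exact integral_mono (i1.sub i2) hg hle

lemma isProbabilityMeasure_mixture {p : ℝ} (hp0 : 0 ≤ p) (hp1 : p ≤ 1) :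
    IsProbabilityMeasure (mixture μ μ' p) := ⟨by
  simp only [mixture, Measure.add_apply, Measure.smul_apply, measure_univ, smul_eq_mul, mul_one]
  rw [← ENNReal.ofReal_add hp0 (by linarith)]; simp⟩

/-- Expand the product of two-term sums over the set of coordinates that pick `μ`. Averaging over
the random subset thus gives back an array with i.i.d. entries, to which bounds for such arrays
apply. -/
lemma pi_mixture {p : ℝ} (hp0 : 0 ≤ p) (hp1 : p ≤ 1) :
    Measure.pi (fun _ : ι => mixture μ μ' p) =
      ∑ S : Finset ι, ENNReal.ofReal (subsetWeight p S) • mixedLaw μ μ' S := by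
  have := isProbabilityMeasure_mixture μ μ' hp0 hp1
  refine Measure.pi_eq fun s _ => ?_
  simp only [mixture, Measure.add_apply, Measure.smul_apply, smul_eq_mul]
  rw [Fintype.prod_add]
  simp only [Measure.coe_finsetSum, Finset.sum_apply, Measure.smul_apply, smul_eq_mul]
  refine Finset.sum_congr rfl fun S _ => ?_
  rw [mixedLaw, Measure.pi_pi, subsetWeight,
    ENNReal.ofReal_prod_of_nonneg fun k _ => by split_ifs <;> linarith, ← Finset.prod_mul_distrib,
    ← Finset.prod_mul_prod_compl S]
  congr 1
  · refine Finset.prod_congr rfl fun k hk => by simp [hk]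
  · refine Finset.prod_congr rfl fun k hk => by simp [Finset.mem_compl.1 hk]

lemma sum_subsetWeight_mul_integral {p : ℝ} (hp0 : 0 ≤ p) (hp1 : p ≤ 1) {g : (ι → E) → ℝ}
    (h : ∀ S, Integrable g (mixedLaw μ μ' S)) :
    ∑ S : Finset ι, subsetWeight p S * ∫ x, g x ∂(mixedLaw μ μ' S) =
      ∫ x, g x ∂(Measure.pi (fun _ : ι => mixture μ μ' p)) := by
  rw [pi_mixture μ μ' hp0 hp1, integral_finsetSum_measure
    fun S _ => (h S).smul_measure ENNReal.ofReal_ne_top]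
  refine Finset.sum_congr rfl fun S _ => ?_
  rw [integral_smul_measure, ENNReal.toReal_ofReal (subsetWeight_nonneg hp0 hp1 S), smul_eq_mul]

end Resampling

/-! ### Moments of the law of one pair of disorder entries. -/

/-- The moment conditions on the law `μ` of a pair of centered, normalized random variables with
covariance `w` and third absolute moments at most `m`. -/
structure PairMoments (μ : Measure (ℝ × ℝ)) (w m : ℝ) : Prop where
  isProbabilityMeasure : IsProbabilityMeasure μ
  integrable_fst : Integrable (fun p => |p.1| ^ 3) μ
  integrable_snd : Integrable (fun p => |p.2| ^ 3) μ
  mean_fst : ∫ p, p.1 ∂μ = 0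
  mean_snd : ∫ p, p.2 ∂μ = 0
  sq_fst : ∫ p, p.1 ^ 2 ∂μ = 1
  sq_snd : ∫ p, p.2 ^ 2 ∂μ = 1
  cov : ∫ p, p.1 * p.2 ∂μ = w
  third_fst : ∫ p, |p.1| ^ 3 ∂μ ≤ m
  third_snd : ∫ p, |p.2| ^ 3 ∂μ ≤ m

lemma MeasureTheory.Integrable.fun_sub {X : Type*} [MeasurableSpace X] {P : Measure X}
    {f g : X → ℝ} (hf : Integrable f P) (hg : Integrable g P) :
    Integrable (fun x => f x - g x) P := hf.sub hg

lemma le_one_add_cube {x : ℝ} (hx : 0 ≤ x) : x ≤ 1 + x ^ 3 := by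
  nlinarith [mul_nonneg hx (sq_nonneg (x - 1)), sq_nonneg (x - 1)]

lemma sq_le_one_add_cube {x : ℝ} (hx : 0 ≤ x) : x ^ 2 ≤ 1 + x ^ 3 := by
  nlinarith [mul_nonneg hx (sq_nonneg (x - 1)), sq_nonneg (x - 1)]

lemma mul_sq_le_cube_add_cube {x y : ℝ} (hx : 0 ≤ x) (hy : 0 ≤ y) :
    x * y ^ 2 ≤ x ^ 3 + y ^ 3 := by
  rcases le_total x y with h | h
  · nlinarith [mul_le_mul_of_nonneg_right h (sq_nonneg y), pow_nonneg hx 3]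
  · nlinarith [mul_le_mul_of_nonneg_left (pow_le_pow_left₀ hy h 2) hx, pow_nonneg hy 3]

lemma add_add_cube_le {x y z : ℝ} (hx : 0 ≤ x) (hy : 0 ≤ y) (hz : 0 ≤ z) :
    (x + y + z) ^ 3 ≤ 9 * (x ^ 3 + y ^ 3 + z ^ 3) := by
  nlinarith [mul_nonneg (add_nonneg hx hy) (sq_nonneg (x - y)),
    mul_nonneg (add_nonneg hx hz) (sq_nonneg (x - z)),
    mul_nonneg (add_nonneg hy hz) (sq_nonneg (y - z)),
    mul_nonneg hx (sq_nonneg (y - z)), mul_nonneg hy (sq_nonneg (x - z)),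
    mul_nonneg hz (sq_nonneg (x - y))]

namespace PairMoments

variable {μ μ' : Measure (ℝ × ℝ)} {w w' m : ℝ}

lemma integrable_of_abs_le (h : PairMoments μ w m) {g : ℝ × ℝ → ℝ} (hg : Measurable g) {C : ℝ}
    (hC : ∀ p, |g p| ≤ C * (1 + |p.1| ^ 3 + |p.2| ^ 3)) : Integrable g μ := by
  have := h.isProbabilityMeasure
  refine Integrable.mono' ((((integrable_const 1).add h.integrable_fst).add
    h.integrable_snd).const_mul C) hg.aestronglyMeasurable (Filter.Eventually.of_forall hC)

lemma integrable_abs_fst (h : PairMoments μ w m) : Integrable (fun p => |p.1|) μ :=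
  h.integrable_of_abs_le (by fun_prop) (C := 1) fun p => by
    rw [abs_abs]
    linarith [le_one_add_cube (abs_nonneg p.1), pow_nonneg (abs_nonneg p.2) 3]

lemma integrable_abs_snd (h : PairMoments μ w m) : Integrable (fun p => |p.2|) μ :=
  h.integrable_of_abs_le (by fun_prop) (C := 1) fun p => by
    rw [abs_abs]
    linarith [le_one_add_cube (abs_nonneg p.2), pow_nonneg (abs_nonneg p.1) 3]

lemma integrable_fst' (h : PairMoments μ w m) : Integrable (fun p => p.1) μ :=
  (integrable_norm_iff measurable_fst.aestronglyMeasurable).1 h.integrable_abs_fst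

lemma integrable_snd' (h : PairMoments μ w m) : Integrable (fun p => p.2) μ :=
  (integrable_norm_iff measurable_snd.aestronglyMeasurable).1 h.integrable_abs_snd

lemma integrable_sq_fst (h : PairMoments μ w m) : Integrable (fun p => p.1 ^ 2) μ :=
  h.integrable_of_abs_le (by fun_prop) (C := 1) fun p => by
    rw [abs_pow]
    linarith [sq_le_one_add_cube (abs_nonneg p.1), pow_nonneg (abs_nonneg p.2) 3]

lemma integrable_sq_snd (h : PairMoments μ w m) : Integrable (fun p => p.2 ^ 2) μ :=
  h.integrable_of_abs_le (by fun_prop) (C := 1) fun p => by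
    rw [abs_pow]
    linarith [sq_le_one_add_cube (abs_nonneg p.2), pow_nonneg (abs_nonneg p.1) 3]

lemma integrable_mul (h : PairMoments μ w m) : Integrable (fun p => p.1 * p.2) μ :=
  h.integrable_of_abs_le (by fun_prop) (C := 2) fun p => by
    rw [abs_mul]
    nlinarith [sq_le_one_add_cube (abs_nonneg p.2), sq_le_one_add_cube (abs_nonneg p.1),
      sq_nonneg (|p.1| - |p.2|), pow_nonneg (abs_nonneg p.1) 3, pow_nonneg (abs_nonneg p.2) 3]

lemma integral_abs_fst_le (h : PairMoments μ w m) : ∫ p, |p.1| ∂μ ≤ 1 := by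
  have := h.isProbabilityMeasure
  have h1 : ∫ p, |p.1| ∂μ ≤ ∫ p, (1 / 2 + 1 / 2 * p.1 ^ 2) ∂μ :=
    integral_mono h.integrable_abs_fst
      ((integrable_const _).add (h.integrable_sq_fst.const_mul _)) fun p => by
        simp only [← sq_abs p.1]
        nlinarith [sq_nonneg (|p.1| - 1)]
  rw [integral_add (integrable_const _) (h.integrable_sq_fst.const_mul _), integral_const_mul,
    h.sq_fst] at h1
  simp at h1
  linarith

lemma integral_abs_snd_le (h : PairMoments μ w m) : ∫ p, |p.2| ∂μ ≤ 1 := by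
  have := h.isProbabilityMeasure
  have h1 : ∫ p, |p.2| ∂μ ≤ ∫ p, (1 / 2 + 1 / 2 * p.2 ^ 2) ∂μ :=
    integral_mono h.integrable_abs_snd
      ((integrable_const _).add (h.integrable_sq_snd.const_mul _)) fun p => by
        simp only [← sq_abs p.2]
        nlinarith [sq_nonneg (|p.2| - 1)]
  rw [integral_add (integrable_const _) (h.integrable_sq_snd.const_mul _), integral_const_mul,
    h.sq_snd] at h1
  simp at h1
  linarith

lemma integral_abs_mul_le (h : PairMoments μ w m) : |w| ≤ 1 := by
  rw [← h.cov, abs_le]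
  have h1 : ∫ p, (p.1 ^ 2 + p.2 ^ 2) ∂μ = 2 := by
    rw [integral_add h.integrable_sq_fst h.integrable_sq_snd, h.sq_fst, h.sq_snd]; norm_num
  have i := h.integrable_sq_fst.add h.integrable_sq_snd
  constructor
  · have := integral_mono i.neg (h.integrable_mul.const_mul 2) fun p => by
      simp only [Pi.neg_apply, Pi.add_apply]; nlinarith [sq_nonneg (p.1 + p.2)]
    rw [integral_const_mul] at this
    simp only [Pi.neg_apply, Pi.add_apply, integral_neg, h1] at this
    linarith
  · have := integral_mono (h.integrable_mul.const_mul 2) i fun p => by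
      simp only [Pi.add_apply]; nlinarith [sq_nonneg (p.1 - p.2)]
    rw [integral_const_mul] at this
    simp only [Pi.add_apply, h1] at this
    linarith

/-- All conditions are affine in the law. The third moments enter only through an upper bound, so
that two laws with different third moments may share the same `m`. -/
lemma mixture {p : ℝ} (hp0 : 0 ≤ p) (hp1 : p ≤ 1) (h : PairMoments μ w m)
    (h' : PairMoments μ' w' m) :
    PairMoments (mixture μ μ' p) (p * w + (1 - p) * w') m := by
  have := h.isProbabilityMeasure
  have := h'.isProbabilityMeasure
  refine ⟨isProbabilityMeasure_mixture μ μ' hp0 hp1,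
    integrable_mixture _ _ _ h.integrable_fst h'.integrable_fst,
    integrable_mixture _ _ _ h.integrable_snd h'.integrable_snd, ?_, ?_, ?_, ?_, ?_, ?_, ?_⟩
  · rw [integral_mixture _ _ hp0 hp1 h.integrable_fst' h'.integrable_fst', h.mean_fst, h'.mean_fst]
    ring
  · rw [integral_mixture _ _ hp0 hp1 h.integrable_snd' h'.integrable_snd', h.mean_snd, h'.mean_snd]
    ring
  · rw [integral_mixture _ _ hp0 hp1 h.integrable_sq_fst h'.integrable_sq_fst, h.sq_fst, h'.sq_fst]
    ring
  · rw [integral_mixture _ _ hp0 hp1 h.integrable_sq_snd h'.integrable_sq_snd, h.sq_snd, h'.sq_snd]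
    ring
  · rw [integral_mixture _ _ hp0 hp1 h.integrable_mul h'.integrable_mul, h.cov, h'.cov]
  · rw [integral_mixture _ _ hp0 hp1 h.integrable_fst h'.integrable_fst]
    nlinarith [h.third_fst, h'.third_fst]
  · rw [integral_mixture _ _ hp0 hp1 h.integrable_snd h'.integrable_snd]
    nlinarith [h.third_snd, h'.third_snd]

lemma nonneg (h : PairMoments μ w m) : 0 ≤ m :=
  (integral_nonneg fun p => pow_nonneg (abs_nonneg p.1) 3).trans h.third_fst

/-- A functional of linear growth of an array with independent entries is integrable. -/
lemma integrable_mixedLaw {ι : Type*} [Fintype ι] [DecidableEq ι] (h : PairMoments μ w m)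
    (h' : PairMoments μ' w' m) (S : Finset ι) (k : ι) :
    Integrable (fun x : ι → ℝ × ℝ => |(x k).1|) (mixedLaw μ μ' S) ∧
    Integrable (fun x : ι → ℝ × ℝ => |(x k).2|) (mixedLaw μ μ' S) ∧
    ∫ x : ι → ℝ × ℝ, |(x k).1| ∂(mixedLaw μ μ' S) ≤ 1 ∧
    ∫ x : ι → ℝ × ℝ, |(x k).2| ∂(mixedLaw μ μ' S) ≤ 1 ∧
    Integrable (fun x : ι → ℝ × ℝ => (x k).1 ^ 2) (mixedLaw μ μ' S) ∧
    Integrable (fun x : ι → ℝ × ℝ => (x k).2 ^ 2) (mixedLaw μ μ' S) := by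
  have := h.isProbabilityMeasure
  have := h'.isProbabilityMeasure
  have key : ∀ g : ℝ × ℝ → ℝ, Integrable g μ → Integrable g μ' →
      Integrable (fun x : ι → ℝ × ℝ => g (x k)) (mixedLaw μ μ' S) ∧
      ∫ x : ι → ℝ × ℝ, g (x k) ∂(mixedLaw μ μ' S) =
        ∫ p, g p ∂(if k ∈ S then μ else μ') := fun g hg hg' => by
    have i : Integrable g (if k ∈ S then μ else μ') := by split_ifs <;> assumption
    exact ⟨integrable_comp_eval (μ := fun j => if j ∈ S then μ else μ') (i := k) i,
      integral_comp_eval (μ := fun j => if j ∈ S then μ else μ') (i := k) i.aestronglyMeasurable⟩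
  have k1 := key _ h.integrable_abs_fst h'.integrable_abs_fst
  have k2 := key _ h.integrable_abs_snd h'.integrable_abs_snd
  refine ⟨k1.1, k2.1, ?_, ?_, (key _ h.integrable_sq_fst h'.integrable_sq_fst).1,
    (key _ h.integrable_sq_snd h'.integrable_sq_snd).1⟩
  · rw [k1.2]
    split_ifs
    exacts [h.integral_abs_fst_le, h'.integral_abs_fst_le]
  · rw [k2.2]
    split_ifs
    exacts [h.integral_abs_snd_le, h'.integral_abs_snd_le]

end PairMoments

/-! ### Energies linear in the disorder and their dependence on one coupling. -/

lemma abs_mul_spin_le {A ι : Type*} {b : ℝ} {χ : ι → A → ℝ} (hb : 0 ≤ b) (hχ : ∀ k a, |χ k a| ≤ 1) (k : ι) (s : ℝ) (a : A) :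
    |b * s * χ k a| ≤ b * |s| := by
  rw [abs_mul, abs_mul, abs_of_nonneg hb]
  exact mul_le_of_le_one_right (mul_nonneg hb (abs_nonneg s)) (hχ k a)

section LinearEnergy

variable {A : Type*} {ι : Type*} [Fintype ι]

/-- The energy `b ∑ x_k χ_k(a)`. -/
def linEnergy (b : ℝ) (χ : ι → A → ℝ) (x : ι → ℝ) (a : A) : ℝ := b * ∑ k, x k * χ k a

lemma linEnergy_update [DecidableEq ι] (b : ℝ) (χ : ι → A → ℝ) (x : ι → ℝ) (k : ι) (s t : ℝ) :
    linEnergy b χ (Function.update x k s) =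
      fun a => linEnergy b χ (Function.update x k t) a + b * (s - t) * χ k a := by
  funext a
  simp only [linEnergy]
  rw [← Finset.add_sum_erase _ _ (Finset.mem_univ k),
    ← Finset.add_sum_erase Finset.univ (fun j => Function.update x k t j * χ j a)
      (Finset.mem_univ k)]
  have : ∀ r, ∑ j ∈ Finset.univ.erase k, Function.update x k r j * χ j a =
      ∑ j ∈ Finset.univ.erase k, x j * χ j a := fun r =>
    Finset.sum_congr rfl fun j hj => by rw [Function.update_of_ne (Finset.ne_of_mem_erase hj)]
  simp only [this, Function.update_self]
  ring

lemma measurable_linEnergy (b : ℝ) (χ : ι → A → ℝ) (a : A) :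
    Measurable fun x => linEnergy b χ x a := by
  unfold linEnergy
  fun_prop

variable [Fintype A]

/-- The logarithm of the partition function of the energy `b ∑ x_k χ_k(a)`. -/
noncomputable def logPartition (b : ℝ) (χ : ι → A → ℝ) (x : ι → ℝ) : ℝ :=
  logSumExp (linEnergy b χ x)

/-- The average of `χ_k` under the Gibbs measure with energy `b ∑ x_k χ_k(a)`. -/
noncomputable def spinAvg (b : ℝ) (χ : ι → A → ℝ) (x : ι → ℝ) (k : ι) : ℝ :=
  gibbsAvg (linEnergy b χ x) (χ k)

lemma measurable_logSumExp {X : Type*} [MeasurableSpace X] {E : X → A → ℝ}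
    (h : ∀ a, Measurable fun x => E x a) : Measurable fun x => logSumExp (E x) := by
  unfold logSumExp
  fun_prop

lemma measurable_gibbsAvg {X : Type*} [MeasurableSpace X] {E : X → A → ℝ} (Y : A → ℝ)
    (h : ∀ a, Measurable fun x => E x a) : Measurable fun x => gibbsAvg (E x) Y := by
  unfold gibbsAvg
  fun_prop

lemma measurable_logPartition (b : ℝ) (χ : ι → A → ℝ) : Measurable (logPartition b χ) :=
  measurable_logSumExp (measurable_linEnergy b χ)

lemma measurable_spinAvg (b : ℝ) (χ : ι → A → ℝ) (k : ι) :
    Measurable fun x => spinAvg b χ x k :=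
  measurable_gibbsAvg _ (measurable_linEnergy b χ)

variable [Nonempty A] {b : ℝ} {χ : ι → A → ℝ}

lemma abs_spinAvg_le (hχ : ∀ k a, |χ k a| ≤ 1) (x : ι → ℝ) (k : ι) : |spinAvg b χ x k| ≤ 1 :=
  abs_gibbsAvg_le _ (hχ k)

lemma abs_logPartition_sub_le (hb : 0 ≤ b) (hχ : ∀ k a, |χ k a| ≤ 1) (x : ι → ℝ) :
    |logPartition b χ x - Real.log (Fintype.card A)| ≤ b * ∑ k, |x k| := by
  have h := abs_logSumExp_add_sub_le (fun _ : A => 0) (X := linEnergy b χ x)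
    (B := b * ∑ k, |x k|) fun a => by
      rw [linEnergy, abs_mul, abs_of_nonneg hb]
      gcongr
      refine (Finset.abs_sum_le_sum_abs _ _).trans (Finset.sum_le_sum fun k _ => ?_)
      rw [abs_mul]
      exact mul_le_of_le_one_right (abs_nonneg _) (hχ k a)
  simpa [logSumExp, logPartition] using h

variable [DecidableEq ι]

lemma abs_logPartition_update_sub_le (hb : 0 ≤ b) (hχ : ∀ k a, |χ k a| ≤ 1) (x : ι → ℝ) (k : ι)
    (s t : ℝ) :
    |logPartition b χ (Function.update x k s) - logPartition b χ (Function.update x k t)| ≤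
      b * |s - t| := by
  rw [logPartition, logPartition, linEnergy_update b χ x k s t]
  exact abs_logSumExp_add_sub_le _ (abs_mul_spin_le hb hχ k _)

/-- Cavity expansion: the slope in the coupling `k` is the Gibbs average of `χ_k` with that coupling
set to 0, which does not involve the value being resampled. -/
lemma abs_logPartition_update_expansion (hb : 0 ≤ b) (hχ : ∀ k a, |χ k a| ≤ 1) (x : ι → ℝ)
    (k : ι) (s : ℝ) :
    |logPartition b χ (Function.update x k s) - logPartition b χ (Function.update x k 0)
      - b * s * spinAvg b χ (Function.update x k 0) k| ≤ 4 * (b * |s|) ^ 2 := by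
  rw [logPartition, logPartition, linEnergy_update b χ x k s 0, logSumExp_add, sub_zero,
    add_sub_cancel_left, spinAvg, ← gibbsAvg_const_mul]
  exact log_gibbsAvg_exp_sub_le _ (abs_mul_spin_le hb hχ k _)

/-- Used to pass back from the cavity system to the full one: the two differ by a tilt of size `b |x
k|`. -/
lemma abs_spinAvg_update_zero_sub_le (hb : 0 ≤ b) (hχ : ∀ k a, |χ k a| ≤ 1) (x : ι → ℝ)
    (k : ι) :
    |spinAvg b χ (Function.update x k 0) k - spinAvg b χ x k| ≤ 4 * (b * |x k|) := by
  have h := linEnergy_update b χ x k (x k) 0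
  rw [Function.update_eq_self, sub_zero] at h
  rw [abs_sub_comm, spinAvg, spinAvg, h]
  exact abs_gibbsAvg_tilt_sub_le _ (abs_mul_spin_le hb hχ k _) (hχ k)

end LinearEnergy

/-! ### The covariance of two free energies under changes of the law of the entries. -/

section PairFunctional

/-- The product of a function of the first and a function of the second coordinate. -/
lemma PairMoments.integrable_mul_of_lipschitz {μ : Measure (ℝ × ℝ)} {w m b : ℝ}
    (h : PairMoments μ w m) {G₁ G₂ : ℝ → ℝ} (hG₁ : Measurable G₁) (hG₂ : Measurable G₂)
    (h₁ : ∀ s, |G₁ s - G₁ 0| ≤ b * |s|) (h₂ : ∀ s, |G₂ s - G₂ 0| ≤ b * |s|) :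
    Integrable (fun p => G₁ p.1 * G₂ p.2) μ := by
  set c := |G₁ 0| + |G₂ 0| + |b| with hc
  have hc0 : 0 ≤ c := by positivity
  refine h.integrable_of_abs_le (by fun_prop) (C := c ^ 2 * 4) fun p => ?_
  have e₁ : |G₁ p.1| ≤ c * (1 + |p.1|) := by
    have := abs_add_le (G₁ p.1 - G₁ 0) (G₁ 0)
    rw [sub_add_cancel] at this
    nlinarith [h₁ p.1, abs_nonneg (G₂ 0), abs_nonneg (G₁ 0), abs_nonneg b, le_abs_self b,
      abs_nonneg p.1, mul_nonneg (sub_nonneg.2 (le_abs_self b)) (abs_nonneg p.1),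
      mul_nonneg (abs_nonneg (G₂ 0)) (abs_nonneg p.1), mul_nonneg (abs_nonneg (G₁ 0)) (abs_nonneg p.1)]
  have e₂ : |G₂ p.2| ≤ c * (1 + |p.2|) := by
    have := abs_add_le (G₂ p.2 - G₂ 0) (G₂ 0)
    rw [sub_add_cancel] at this
    nlinarith [h₂ p.2, abs_nonneg (G₂ 0), abs_nonneg (G₁ 0), abs_nonneg b, le_abs_self b,
      abs_nonneg p.2, mul_nonneg (sub_nonneg.2 (le_abs_self b)) (abs_nonneg p.2),
      mul_nonneg (abs_nonneg (G₂ 0)) (abs_nonneg p.2), mul_nonneg (abs_nonneg (G₁ 0)) (abs_nonneg p.2)]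
  have e₃ : (1 + |p.1|) * (1 + |p.2|) ≤ 4 * (1 + |p.1| ^ 3 + |p.2| ^ 3) := by
    nlinarith [sq_nonneg (|p.1| - |p.2|), sq_le_one_add_cube (abs_nonneg p.1),
      sq_le_one_add_cube (abs_nonneg p.2), pow_nonneg (abs_nonneg p.1) 3,
      pow_nonneg (abs_nonneg p.2) 3, sq_nonneg (|p.1| - 1), sq_nonneg (|p.2| - 1)]
  rw [abs_mul]
  calc |G₁ p.1| * |G₂ p.2| ≤ (c * (1 + |p.1|)) * (c * (1 + |p.2|)) := by gcongr
    _ = c ^ 2 * ((1 + |p.1|) * (1 + |p.2|)) := by ring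
    _ ≤ c ^ 2 * (4 * (1 + |p.1| ^ 3 + |p.2| ^ 3)) := by gcongr
    _ = _ := by ring

/-- The law of `(X, X)` when `(X, Y)` has law `μ`. -/
noncomputable def diagLaw (μ : Measure (ℝ × ℝ)) : Measure (ℝ × ℝ) := μ.map fun p => (p.1, p.1)

lemma integral_diagLaw (μ : Measure (ℝ × ℝ)) {g : ℝ × ℝ → ℝ} (hg : Measurable g) :
    ∫ p, g p ∂(diagLaw μ) = ∫ p, g (p.1, p.1) ∂μ :=
  integral_map (by fun_prop) hg.aestronglyMeasurable

lemma integrable_diagLaw {μ : Measure (ℝ × ℝ)} {g : ℝ × ℝ → ℝ} (hg : Measurable g)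
    (h : Integrable (fun p => g (p.1, p.1)) μ) : Integrable g (diagLaw μ) :=
  (integrable_map_measure hg.aestronglyMeasurable (by fun_prop)).2 h

namespace PairMoments

variable {μ μ' : Measure (ℝ × ℝ)} {w w' m : ℝ}

lemma diagLaw (h : PairMoments μ w m) : PairMoments (diagLaw μ) 1 m := by
  have := h.isProbabilityMeasure
  refine ⟨Measure.isProbabilityMeasure_map (by fun_prop),
    integrable_diagLaw (by fun_prop) h.integrable_fst,
    integrable_diagLaw (by fun_prop) h.integrable_fst, ?_, ?_, ?_, ?_, ?_, ?_, ?_⟩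
  · rw [integral_diagLaw _ (by fun_prop)]; exact h.mean_fst
  · rw [integral_diagLaw _ (by fun_prop)]; exact h.mean_fst
  · rw [integral_diagLaw _ (by fun_prop)]; exact h.sq_fst
  · rw [integral_diagLaw _ (by fun_prop)]; exact h.sq_fst
  · rw [integral_diagLaw _ (by fun_prop), ← h.sq_fst]; simp only [sq]
  · rw [integral_diagLaw _ (by fun_prop)]; exact h.third_fst
  · rw [integral_diagLaw _ (by fun_prop)]; exact h.third_fst

lemma integral_swap (hs : μ.map Prod.swap = μ) {g : ℝ × ℝ → ℝ} (hg : Measurable g) :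
    ∫ p, g p.swap ∂μ = ∫ p, g p ∂μ := by
  conv_rhs => rw [← hs]
  rw [integral_map (by fun_prop) hg.aestronglyMeasurable]

/-- By exchangeability the left side is half the mean of `(G₁(X) - G₁(Y)) (G₂(X) - G₂(Y))`. The
Lipschitz bounds give at most `b²/2` times the mean of `(X - Y)²`, which is `2 (1 - w)`. -/
lemma integral_diagLaw_sub_le (h : PairMoments μ w m) (hs : μ.map Prod.swap = μ) {b : ℝ}
    {G₁ G₂ : ℝ → ℝ} (hG₁ : Measurable G₁) (hG₂ : Measurable G₂)
    (h₁ : ∀ s t, |G₁ s - G₁ t| ≤ b * |s - t|) (h₂ : ∀ s t, |G₂ s - G₂ t| ≤ b * |s - t|) :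
    ∫ p, G₁ p.1 * G₂ p.2 ∂(_root_.diagLaw μ) - ∫ p, G₁ p.1 * G₂ p.2 ∂μ ≤ b ^ 2 * (1 - w) := by
  have hb₁ : ∀ s, |G₁ s - G₁ 0| ≤ b * |s| := fun s => by simpa using h₁ s 0
  have hb₂ : ∀ s, |G₂ s - G₂ 0| ≤ b * |s| := fun s => by simpa using h₂ s 0
  have id' := h.diagLaw.integrable_mul_of_lipschitz hG₁ hG₂ hb₁ hb₂
  have i₁ : Integrable (fun p : ℝ × ℝ => G₁ p.1 * G₂ p.1) μ :=
    (integrable_map_measure (f := fun p : ℝ × ℝ => (p.1, p.1))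
      (by fun_prop : Measurable fun p : ℝ × ℝ => G₁ p.1 * G₂ p.2).aestronglyMeasurable
      (by fun_prop)).1 id'
  have i₀ := h.integrable_mul_of_lipschitz hG₁ hG₂ hb₁ hb₂
  have mp : MeasurePreserving Prod.swap μ μ := ⟨measurable_swap, hs⟩
  have i₂ : Integrable (fun p : ℝ × ℝ => G₁ p.2 * G₂ p.2) μ := mp.integrable_comp_of_integrable i₁
  have i₃ : Integrable (fun p : ℝ × ℝ => G₁ p.2 * G₂ p.1) μ := mp.integrable_comp_of_integrable i₀
  have e₂ : ∫ p, G₁ p.2 * G₂ p.2 ∂μ = ∫ p, G₁ p.1 * G₂ p.1 ∂μ :=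
    integral_swap hs (g := fun p => G₁ p.1 * G₂ p.1) (by fun_prop)
  have e₃ : ∫ p, G₁ p.2 * G₂ p.1 ∂μ = ∫ p, G₁ p.1 * G₂ p.2 ∂μ :=
    integral_swap hs (g := fun p => G₁ p.1 * G₂ p.2) (by fun_prop)
  rw [integral_diagLaw _ (by fun_prop)]
  simp only
  have hle : ∫ p, (G₁ p.1 * G₂ p.1 + G₁ p.2 * G₂ p.2 - (G₁ p.1 * G₂ p.2 + G₁ p.2 * G₂ p.1)) ∂μ ≤
      ∫ p, b ^ 2 * (p.1 ^ 2 + p.2 ^ 2 - 2 * (p.1 * p.2)) ∂μ := by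
    refine integral_mono ((i₁.fun_add i₂).fun_sub (i₀.fun_add i₃))
      (((h.integrable_sq_fst.fun_add h.integrable_sq_snd).fun_sub
        (h.integrable_mul.const_mul 2)).const_mul _) fun p => ?_
    have h3 : (G₁ p.1 - G₁ p.2) * (G₂ p.1 - G₂ p.2) ≤ (b * |p.1 - p.2|) * (b * |p.1 - p.2|) := by
      refine (le_abs_self _).trans ?_
      rw [abs_mul]
      exact mul_le_mul (h₁ _ _) (h₂ _ _) (abs_nonneg _) ((abs_nonneg _).trans (h₁ p.1 p.2))
    have h4 := sq_abs (p.1 - p.2)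
    simp only
    nlinarith
  rw [integral_sub (i₁.fun_add i₂) (i₀.fun_add i₃), integral_add i₁ i₂, integral_add i₀ i₃, e₂, e₃,
    integral_const_mul, integral_sub (h.integrable_sq_fst.fun_add h.integrable_sq_snd)
      (h.integrable_mul.const_mul 2), integral_add h.integrable_sq_fst h.integrable_sq_snd,
    integral_const_mul, h.sq_fst, h.sq_snd, h.cov] at hle
  linarith

/-- Second order expansion of the covariance of two functions with a Taylor expansion at `0`. -/
lemma abs_integral_mul_sub_le (h : PairMoments μ w m) {b a₁ a₂ c₁ c₂ : ℝ} (hb : 0 ≤ b)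
    (ha₁ : |a₁| ≤ 1)
    {G₁ G₂ : ℝ → ℝ} (hG₁ : Measurable G₁) (hG₂ : Measurable G₂)
    (h₁ : ∀ s, |G₁ s - c₁| ≤ b * |s|) (h₂ : ∀ s, |G₂ s - c₂| ≤ b * |s|)
    (t₁ : ∀ s, |G₁ s - c₁ - b * s * a₁| ≤ 4 * (b * |s|) ^ 2)
    (t₂ : ∀ s, |G₂ s - c₂ - b * s * a₂| ≤ 4 * (b * |s|) ^ 2) :
    |∫ p, (G₁ p.1 - c₁) * (G₂ p.2 - c₂) ∂μ - b ^ 2 * w * (a₁ * a₂)| ≤ 24 * b ^ 3 * m := by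
  have i₀ := h.integrable_mul_of_lipschitz (b := b) (G₁ := fun s => G₁ s - c₁)
    (G₂ := fun s => G₂ s - c₂) (by fun_prop) (by fun_prop)
    (fun s => by
      have := h₁ 0; simp at this; rw [sub_eq_zero] at this; simpa [this] using h₁ s)
    (fun s => by
      have := h₂ 0; simp at this; rw [sub_eq_zero] at this; simpa [this] using h₂ s)
  have e : b ^ 2 * w * (a₁ * a₂) = ∫ p, b ^ 2 * (a₁ * a₂) * (p.1 * p.2) ∂μ := by
    rw [integral_const_mul, h.cov]; ring
  rw [e, ← integral_sub i₀ (h.integrable_mul.const_mul _)]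
  refine abs_integral_le_integral_abs.trans ?_
  have hm : ∫ p, 12 * b ^ 3 * (|p.1| ^ 3 + |p.2| ^ 3) ∂μ ≤ 24 * b ^ 3 * m := by
    rw [integral_const_mul, integral_add h.integrable_fst h.integrable_snd]
    have := h.third_fst
    have := h.third_snd
    have : 0 ≤ b ^ 3 := by positivity
    nlinarith
  refine le_trans ?_ hm
  refine integral_mono (i₀.fun_sub (h.integrable_mul.const_mul _)).abs
    ((h.integrable_fst.fun_add h.integrable_snd).const_mul _) fun p => ?_
  simp only
  set A := G₁ p.1 - c₁
  set B := G₂ p.2 - c₂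
  -- Linearize one factor at a time: each error is quadratic in one variable and linear in the
  -- other, hence bounded by third moments.
  have e2 : A * B - b ^ 2 * (a₁ * a₂) * (p.1 * p.2) =
      (A - b * p.1 * a₁) * B + b * p.1 * a₁ * (B - b * p.2 * a₂) := by ring
  rw [e2]
  have f₁ : |(A - b * p.1 * a₁) * B| ≤ 4 * (b * |p.1|) ^ 2 * (b * |p.2|) := by
    rw [abs_mul]
    exact mul_le_mul (t₁ _) (h₂ _) (abs_nonneg _) (by positivity)
  have f₂ : |b * p.1 * a₁ * (B - b * p.2 * a₂)| ≤ (b * |p.1|) * (4 * (b * |p.2|) ^ 2) := by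
    rw [abs_mul]
    refine mul_le_mul ?_ (t₂ _) (abs_nonneg _) (by positivity)
    rw [abs_mul, abs_mul, abs_of_nonneg hb]
    exact mul_le_of_le_one_right (by positivity) ha₁
  have g₁ := mul_sq_le_cube_add_cube (abs_nonneg p.1) (abs_nonneg p.2)
  have g₂ := mul_sq_le_cube_add_cube (abs_nonneg p.2) (abs_nonneg p.1)
  have hb3 : 0 ≤ b ^ 3 := by positivity
  calc _ ≤ _ := abs_add_le _ _
    _ ≤ 4 * (b * |p.1|) ^ 2 * (b * |p.2|) + (b * |p.1|) * (4 * (b * |p.2|) ^ 2) := add_le_add f₁ f₂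
    _ = 4 * b ^ 3 * (|p.2| * |p.1| ^ 2 + |p.1| * |p.2| ^ 2) := by ring
    _ ≤ 4 * b ^ 3 * (3 * (|p.1| ^ 3 + |p.2| ^ 3)) := by
        gcongr
        linarith [pow_nonneg (abs_nonneg p.1) 3, pow_nonneg (abs_nonneg p.2) 3]
    _ = _ := by ring

/-- The two laws have the same marginals, so centring `G₁` and `G₂` at 0 does not change the
difference of the integrals. The centred products are then expanded to second order, and `μ'`
contributes no main term because its covariance vanishes. -/
lemma integral_mul_sub_integral_mul_le (h : PairMoments μ w m) (h' : PairMoments μ' 0 m)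
    (hm₁ : μ.map Prod.fst = μ'.map Prod.fst) (hm₂ : μ.map Prod.snd = μ'.map Prod.snd)
    {b a₁ a₂ : ℝ} (hb : 0 ≤ b) (ha₁ : |a₁| ≤ 1)
    {G₁ G₂ : ℝ → ℝ} (hG₁ : Measurable G₁) (hG₂ : Measurable G₂)
    (h₁ : ∀ s, |G₁ s - G₁ 0| ≤ b * |s|) (h₂ : ∀ s, |G₂ s - G₂ 0| ≤ b * |s|)
    (t₁ : ∀ s, |G₁ s - G₁ 0 - b * s * a₁| ≤ 4 * (b * |s|) ^ 2)
    (t₂ : ∀ s, |G₂ s - G₂ 0 - b * s * a₂| ≤ 4 * (b * |s|) ^ 2) :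
    ∫ p, G₁ p.1 * G₂ p.2 ∂μ - ∫ p, G₁ p.1 * G₂ p.2 ∂μ' ≤
      b ^ 2 * w * (a₁ * a₂) + 48 * b ^ 3 * m := by
  have := h.isProbabilityMeasure
  have := h'.isProbabilityMeasure
  have k := abs_le.1 (h.abs_integral_mul_sub_le hb ha₁ hG₁ hG₂ h₁ h₂ t₁ t₂)
  have k' := abs_le.1 (h'.abs_integral_mul_sub_le hb ha₁ hG₁ hG₂ h₁ h₂ t₁ t₂)
  have key : ∀ {ρ : Measure (ℝ × ℝ)} {v : ℝ}, PairMoments ρ v m →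
      ∫ p, (G₁ p.1 - G₁ 0) * (G₂ p.2 - G₂ 0) ∂ρ = ∫ p, G₁ p.1 * G₂ p.2 ∂ρ -
        G₁ 0 * ∫ t, G₂ t ∂(ρ.map Prod.snd) - G₂ 0 * ∫ t, G₁ t ∂(ρ.map Prod.fst) +
        G₁ 0 * G₂ 0 := fun {ρ v} hρ => by
    have := hρ.isProbabilityMeasure
    have j := hρ.integrable_mul_of_lipschitz hG₁ hG₂ h₁ h₂
    have hb' : ∀ s : ℝ, |(1 : ℝ) - 1| ≤ b * |s| := fun s => by simp; positivity
    have j₁ : Integrable (fun p : ℝ × ℝ => G₁ p.1) ρ := by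
      simpa using hρ.integrable_mul_of_lipschitz (b := b) hG₁ (G₂ := fun _ => 1) (by fun_prop) h₁ hb'
    have j₂ : Integrable (fun p : ℝ × ℝ => G₂ p.2) ρ := by
      simpa using hρ.integrable_mul_of_lipschitz (b := b) (G₁ := fun _ => 1) (by fun_prop) hG₂ hb' h₂
    rw [integral_map (by fun_prop) hG₁.aestronglyMeasurable,
      integral_map (by fun_prop) hG₂.aestronglyMeasurable]
    have : (fun p : ℝ × ℝ => (G₁ p.1 - G₁ 0) * (G₂ p.2 - G₂ 0)) = fun p =>
        G₁ p.1 * G₂ p.2 - G₁ 0 * G₂ p.2 - G₂ 0 * G₁ p.1 + G₁ 0 * G₂ 0 := by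
      funext p; ring
    rw [this, integral_add ((j.fun_sub (j₂.const_mul _)).fun_sub (j₁.const_mul _)) (integrable_const _),
      integral_sub (j.fun_sub (j₂.const_mul _)) (j₁.const_mul _), integral_sub j (j₂.const_mul _),
      integral_const_mul, integral_const_mul]
    simp
  rw [key h, hm₁, hm₂] at k
  rw [key h'] at k'
  linarith [k.2, k'.1]

end PairMoments

variable {A : Type*} [Fintype A] {ι : Type*} [Fintype ι]

/-- The product of the free energies of the two components of an array of pairs. -/
noncomputable def pairLog (b : ℝ) (χ : ι → A → ℝ) (x : ι → ℝ × ℝ) : ℝ :=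
  logPartition b χ (fun k => (x k).1) * logPartition b χ (fun k => (x k).2)

lemma update_fst {ι : Type*} [DecidableEq ι] (x : ι → ℝ × ℝ) (k : ι) (p : ℝ × ℝ) :
    (fun j => (Function.update x k p j).1) = Function.update (fun j => (x j).1) k p.1 := by
  funext j; by_cases h : j = k
  · subst h; simp
  · simp [h]

lemma update_snd {ι : Type*} [DecidableEq ι] (x : ι → ℝ × ℝ) (k : ι) (p : ℝ × ℝ) :
    (fun j => (Function.update x k p j).2) = Function.update (fun j => (x j).2) k p.2 := by
  funext j; by_cases h : j = k
  · subst h; simp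
  · simp [h]

/-- The overlap `∑ ⟨χ_k⟩ ⟨χ_k⟩'` of the two components of an array of pairs. -/
noncomputable def pairOverlap (b : ℝ) (χ : ι → A → ℝ) (x : ι → ℝ × ℝ) : ℝ :=
  ∑ k, spinAvg b χ (fun j => (x j).1) k * spinAvg b χ (fun j => (x j).2) k

lemma measurable_pairSpin (b : ℝ) (χ : ι → A → ℝ) (k : ι) : Measurable fun x : ι → ℝ × ℝ =>
    spinAvg b χ (fun j => (x j).1) k * spinAvg b χ (fun j => (x j).2) k :=
  ((measurable_spinAvg b χ k).comp (by fun_prop)).mul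
    ((measurable_spinAvg b χ k).comp (by fun_prop))

lemma measurable_logPartition_update [DecidableEq ι] (b : ℝ) (χ : ι → A → ℝ) (x : ι → ℝ) (k : ι) :
    Measurable fun s => logPartition b χ (Function.update x k s) :=
  (measurable_logPartition b χ).comp (measurable_update x)

variable [Nonempty A]

lemma memLp_logPartition {X : Type*} [MeasurableSpace X] {P : Measure X} [IsProbabilityMeasure P]
    {b : ℝ} {χ : ι → A → ℝ} (hb : 0 ≤ b) (hχ : ∀ k a, |χ k a| ≤ 1) {Y : X → ι → ℝ}
    (hY : Measurable Y) (h : ∀ k, Integrable (fun x => Y x k ^ 2) P) :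
    MemLp (fun x => logPartition b χ (Y x)) 2 P := by
  have hm : ∀ k, Measurable fun x => Y x k := fun k => (measurable_pi_apply k).comp hY
  have h1 : ∀ k, MemLp (fun x => |Y x k|) 2 P := fun k => by
    refine (memLp_two_iff_integrable_sq (hm k).abs.aestronglyMeasurable).2 ?_
    simpa using h k
  have hs : MemLp (fun x => ∑ k, |Y x k|) 2 P := memLp_finsetSum Finset.univ fun k _ => h1 k
  have h2 : MemLp (fun x => |Real.log (Fintype.card A)| + b * ∑ k, |Y x k|) 2 P :=
    (memLp_const |Real.log (Fintype.card A)|).add (hs.const_mul b)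
  refine h2.mono' ((measurable_logPartition b χ).comp hY).aestronglyMeasurable
    (Filter.Eventually.of_forall fun x => ?_)
  have h3 := abs_logPartition_sub_le hb hχ (Y x)
  have h4 := abs_add_le (logPartition b χ (Y x) - Real.log (Fintype.card A))
    (Real.log (Fintype.card A))
  rw [sub_add_cancel] at h4
  rw [Real.norm_eq_abs]
  linarith

lemma integrable_pairSpin {b : ℝ} {χ : ι → A → ℝ} (hχ : ∀ k a, |χ k a| ≤ 1) (k : ι) (P : Measure (ι → ℝ × ℝ))
    [IsProbabilityMeasure P] :
    Integrable (fun x : ι → ℝ × ℝ =>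
      spinAvg b χ (fun j => (x j).1) k * spinAvg b χ (fun j => (x j).2) k) P := by
  refine Integrable.of_bound (measurable_pairSpin b χ k).aestronglyMeasurable 1
    (Filter.Eventually.of_forall fun x => ?_)
  rw [Real.norm_eq_abs, abs_mul]
  exact mul_le_one₀ (abs_spinAvg_le hχ _ _) (abs_nonneg _) (abs_spinAvg_le hχ _ _)

variable [DecidableEq ι] {b : ℝ} {χ : ι → A → ℝ} {μ μ' : Measure (ℝ × ℝ)} {w w' m : ℝ}

lemma PairMoments.integrable_pairLog (h : PairMoments μ w m) (h' : PairMoments μ' w' m)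
    (hb : 0 ≤ b) (hχ : ∀ k a, |χ k a| ≤ 1) (S : Finset ι) :
    Integrable (pairLog b χ) (mixedLaw μ μ' S) := by
  have := h.isProbabilityMeasure
  have := h'.isProbabilityMeasure
  have h₁ := memLp_logPartition (P := mixedLaw μ μ' S) hb hχ (Y := fun x k => (x k).1)
    (by fun_prop) fun k => (h.integrable_mixedLaw h' S k).2.2.2.2.1
  have h₂ := memLp_logPartition (P := mixedLaw μ μ' S) hb hχ (Y := fun x k => (x k).2)
    (by fun_prop) fun k => (h.integrable_mixedLaw h' S k).2.2.2.2.2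
  exact h₁.integrable_mul h₂

/-- The functional changes by at most `|ι| b² (1 - w)` if the two components are identified. -/
lemma PairMoments.integral_pairLog_diagLaw_sub_le (h : PairMoments μ w m)
    (hs : μ.map Prod.swap = μ) (hb : 0 ≤ b) (hχ : ∀ k a, |χ k a| ≤ 1) :
    ∫ x, pairLog b χ x ∂(Measure.pi fun _ : ι => _root_.diagLaw μ) -
      ∫ x, pairLog b χ x ∂(Measure.pi fun _ : ι => μ) ≤ Fintype.card ι * (b ^ 2 * (1 - w)) := by
  have := h.isProbabilityMeasure
  have := h.diagLaw.isProbabilityMeasure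
  rw [← mixedLaw_univ (_root_.diagLaw μ) μ, ← mixedLaw_empty (_root_.diagLaw μ) μ]
  refine sub_le_of_forall_sum_le (fun S => ∫ x, pairLog b χ x ∂(mixedLaw (_root_.diagLaw μ) μ S))
    _ fun S => ?_
  rw [← nsmul_eq_mul]
  refine Finset.sum_le_card_nsmul _ _ _ fun k _ => ?_
  refine (integral_mixedLaw_insert_sub_erase_le _ _ (h.diagLaw.integrable_pairLog h hb hχ _)
    (h.diagLaw.integrable_pairLog h hb hχ _) (integrable_const (b ^ 2 * (1 - w)))
    fun x => ?_).trans_eq (by simp)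
  simp only [pairLog, update_fst, update_snd]
  exact h.integral_diagLaw_sub_le hs (measurable_logPartition_update b χ _ k)
    (measurable_logPartition_update b χ _ k)
    (abs_logPartition_update_sub_le hb hχ _ k) (abs_logPartition_update_sub_le hb hχ _ k)

lemma abs_mul_sub_mul_le {a₁ a₂ c₁ c₂ : ℝ} (h₁ : |a₁| ≤ 1) (h₂ : |c₂| ≤ 1) :
    |a₁ * a₂ - c₁ * c₂| ≤ |a₁ - c₁| + |a₂ - c₂| := by
  have : a₁ * a₂ - c₁ * c₂ = a₁ * (a₂ - c₂) + (a₁ - c₁) * c₂ := by ring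
  rw [this]
  refine (abs_add_le _ _).trans ?_
  rw [abs_mul, abs_mul]
  nlinarith [abs_nonneg (a₁ - c₁), abs_nonneg (a₂ - c₂)]

/-- The covariance of the free energies of two correlated arrays is controlled by the overlap. -/
lemma PairMoments.integral_pairLog_sub_le (h : PairMoments μ w m) (h' : PairMoments μ' 0 m)
    (hm₁ : μ.map Prod.fst = μ'.map Prod.fst) (hm₂ : μ.map Prod.snd = μ'.map Prod.snd)
    (hw : 0 ≤ w) (hb : 0 ≤ b) (hχ : ∀ k a, |χ k a| ≤ 1) {R : ℝ}
    (hR : ∀ p ∈ Set.Ioo (0 : ℝ) 1,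
      ∫ x, pairOverlap b χ x ∂(Measure.pi fun _ : ι => _root_.mixture μ μ' p) ≤ R) :
    ∫ x, pairLog b χ x ∂(Measure.pi fun _ : ι => μ) -
      ∫ x, pairLog b χ x ∂(Measure.pi fun _ : ι => μ') ≤
        b ^ 2 * w * R + Fintype.card ι * (48 * b ^ 3 * (m + 1)) := by
  have := h.isProbabilityMeasure
  have := h'.isProbabilityMeasure
  have hw1 : w ≤ 1 := (le_abs_self w).trans h.integral_abs_mul_le
  set g : ι → (ι → ℝ × ℝ) → ℝ := fun k x =>
    b ^ 2 * w * (spinAvg b χ (fun j => (x j).1) k * spinAvg b χ (fun j => (x j).2) k) +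
      (48 * b ^ 3 * m + 4 * b ^ 3 * (|(x k).1| + |(x k).2|)) with hg
  have ig : ∀ k S, Integrable (g k) (mixedLaw μ μ' S) := fun k S =>
    ((integrable_pairSpin hχ k _).const_mul _).fun_add ((integrable_const _).fun_add
      (((h.integrable_mixedLaw h' S k).1.fun_add (h.integrable_mixedLaw h' S k).2.1).const_mul _))
  -- Effect of one entry: the cavity expansion gives `b² w` times the product of the cavity
  -- averages. Returning to the full averages costs `4 b³ (|x| + |x'|)`, whose mean is at most `8
  -- b³`.
  have hinc : ∀ k S, ∫ x, pairLog b χ x ∂(mixedLaw μ μ' (insert k S)) -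
      ∫ x, pairLog b χ x ∂(mixedLaw μ μ' (S.erase k)) ≤
        b ^ 2 * w * ∫ x, spinAvg b χ (fun j => (x j).1) k * spinAvg b χ (fun j => (x j).2) k
          ∂(mixedLaw μ μ' S) + 48 * b ^ 3 * (m + 1) := fun k S => by
    refine (integral_mixedLaw_insert_sub_erase_le _ _ (h.integrable_pairLog h' hb hχ _)
      (h.integrable_pairLog h' hb hχ _) (ig k S) fun x => ?_).trans ?_
    · simp only [pairLog, update_fst, update_snd]
      refine (h.integral_mul_sub_integral_mul_le h' hm₁ hm₂ hb (abs_spinAvg_le hχ _ k)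
        (measurable_logPartition_update b χ _ k)
        (measurable_logPartition_update b χ _ k)
        (fun s => by simpa using abs_logPartition_update_sub_le hb hχ (fun j => (x j).1) k s 0)
        (fun s => by simpa using abs_logPartition_update_sub_le hb hχ (fun j => (x j).2) k s 0)
        (abs_logPartition_update_expansion hb hχ _ k)
        (abs_logPartition_update_expansion hb hχ _ k)).trans ?_
      have e := abs_mul_sub_mul_le (a₂ := spinAvg b χ (Function.update (fun j => (x j).2) k 0) k)
        (c₁ := spinAvg b χ (fun j => (x j).1) k)
        (abs_spinAvg_le (b := b) hχ (Function.update (fun j => (x j).1) k 0) k)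
        (abs_spinAvg_le (b := b) hχ (fun j => (x j).2) k)
      have e1 := abs_spinAvg_update_zero_sub_le hb hχ (fun j => (x j).1) k
      have e2 := abs_spinAvg_update_zero_sub_le hb hχ (fun j => (x j).2) k
      have e3 := (le_abs_self _).trans (e.trans (add_le_add e1 e2))
      have hbw : 0 ≤ b ^ 2 * w := by positivity
      have e4 := mul_le_mul_of_nonneg_left e3 hbw
      have e5 : b ^ 2 * w * (4 * (b * |(x k).1|) + 4 * (b * |(x k).2|)) ≤
          4 * b ^ 3 * (|(x k).1| + |(x k).2|) := by
        have : 0 ≤ 4 * b ^ 3 * (|(x k).1| + |(x k).2|) := by positivity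
        nlinarith
      simp only [hg]
      linarith
    · have i := h.integrable_mixedLaw h' S k
      simp only [hg]
      rw [integral_add ((integrable_pairSpin hχ k _).const_mul _) ((integrable_const _).fun_add
        ((i.1.fun_add i.2.1).const_mul _)), integral_add (integrable_const _)
        ((i.1.fun_add i.2.1).const_mul _), integral_const_mul, integral_const_mul,
        integral_const_mul, integral_add i.1 i.2.1]
      simp only [integral_const, probReal_univ, one_smul]
      have : 0 ≤ b ^ 3 := by positivity
      nlinarith [i.2.2.1, i.2.2.2.1]
  rw [← mixedLaw_univ μ μ', ← mixedLaw_empty μ μ']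
  refine sub_le_of_forall_sum_subsetWeight_le (fun S => ∫ x, pairLog b χ x ∂(mixedLaw μ μ' S))
    _ fun p hp => ?_
  have iO : ∀ S, Integrable (pairOverlap b χ) (mixedLaw μ μ' S) := fun S =>
    integrable_finsetSum _ fun k _ => integrable_pairSpin hχ k _
  have hS : ∀ S : Finset ι, ∑ k, (∫ x, pairLog b χ x ∂(mixedLaw μ μ' (insert k S)) -
      ∫ x, pairLog b χ x ∂(mixedLaw μ μ' (S.erase k))) ≤
      b ^ 2 * w * ∫ x, pairOverlap b χ x ∂(mixedLaw μ μ' S) +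
        Fintype.card ι * (48 * b ^ 3 * (m + 1)) := fun S => by
    refine (Finset.sum_le_sum fun k _ => hinc k S).trans_eq ?_
    simp only [pairOverlap]
    rw [Finset.sum_add_distrib, ← Finset.mul_sum,
      integral_finsetSum _ fun k _ => integrable_pairSpin hχ k _]
    simp
  -- The overlap need not be small for each fixed `S`. Its average over the random subset is an
  -- overlap for i.i.d. entries with the mixed law, where `hR` applies.
  calc _ ≤ ∑ S : Finset ι, subsetWeight p S * (b ^ 2 * w * ∫ x, pairOverlap b χ x
          ∂(mixedLaw μ μ' S) + Fintype.card ι * (48 * b ^ 3 * (m + 1))) :=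
        Finset.sum_le_sum fun S _ =>
          mul_le_mul_of_nonneg_left (hS S) (subsetWeight_nonneg hp.1.le hp.2.le S)
    _ = b ^ 2 * w * (∑ S : Finset ι, subsetWeight p S * ∫ x, pairOverlap b χ x
          ∂(mixedLaw μ μ' S)) + Fintype.card ι * (48 * b ^ 3 * (m + 1)) := by
        generalize Fintype.card ι * (48 * b ^ 3 * (m + 1)) = D
        simp only [mul_add, Finset.sum_add_distrib]
        rw [← Finset.sum_mul, sum_subsetWeight, one_mul, Finset.mul_sum]
        congr 1
        exact Finset.sum_congr rfl fun S _ => by ring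
    _ ≤ _ := by
        rw [sum_subsetWeight_mul_integral μ μ' hp.1.le hp.2.le iO]
        have := hR p hp
        gcongr

end PairFunctional

/-! ### Averaged second order expansion of the free energy of a coupled pair in one entry. -/

section QuadraticExpansion

variable {μ : Measure (ℝ × ℝ)} {w m : ℝ}

lemma PairMoments.integral_quadratic (h : PairMoments μ w m) (c₀ c₁ c₂ c₃ c₄ c₅ : ℝ) :
    Integrable (fun p => c₀ + c₁ * p.1 + c₂ * p.2 + c₃ * p.1 ^ 2 + c₄ * p.2 ^ 2 +
      c₅ * (p.1 * p.2)) μ ∧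
    ∫ p, (c₀ + c₁ * p.1 + c₂ * p.2 + c₃ * p.1 ^ 2 + c₄ * p.2 ^ 2 + c₅ * (p.1 * p.2)) ∂μ =
      c₀ + c₃ + c₄ + c₅ * w := by
  have := h.isProbabilityMeasure
  have i₀ : Integrable (fun _ : ℝ × ℝ => c₀) μ := integrable_const _
  have i₁ := i₀.fun_add (h.integrable_fst'.const_mul c₁)
  have i₂ := i₁.fun_add (h.integrable_snd'.const_mul c₂)
  have i₃ := i₂.fun_add (h.integrable_sq_fst.const_mul c₃)
  have i₄ := i₃.fun_add (h.integrable_sq_snd.const_mul c₄)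
  refine ⟨i₄.fun_add (h.integrable_mul.const_mul c₅), ?_⟩
  rw [integral_add i₄ (h.integrable_mul.const_mul c₅),
    integral_add i₃ (h.integrable_sq_snd.const_mul c₄),
    integral_add i₂ (h.integrable_sq_fst.const_mul c₃),
    integral_add i₁ (h.integrable_snd'.const_mul c₂),
    integral_add i₀ (h.integrable_fst'.const_mul c₁)]
  simp only [integral_const_mul, h.mean_fst, h.mean_snd, h.sq_fst, h.sq_snd, h.cov]
  simp

lemma abs_tilt_le {C : Type*} {u v : C → ℝ} {b ℓ : ℝ} (hb : 0 ≤ b) (hu : ∀ q, |u q| ≤ 1) (hv : ∀ q, |v q| ≤ 1) (hℓ : 0 ≤ ℓ) (s t : ℝ)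
    (q : C) : |b * s * u q + b * t * v q + ℓ * (u q * v q)| ≤ b * |s| + b * |t| + ℓ := by
  refine (abs_add_le _ _).trans (add_le_add ((abs_add_le _ _).trans (add_le_add ?_ ?_)) ?_)
  · rw [abs_mul, abs_mul, abs_of_nonneg hb]
    exact mul_le_of_le_one_right (by positivity) (hu q)
  · rw [abs_mul, abs_mul, abs_of_nonneg hb]
    exact mul_le_of_le_one_right (by positivity) (hv q)
  · rw [abs_mul, abs_mul, abs_of_nonneg hℓ]
    exact mul_le_of_le_one_right hℓ (mul_le_one₀ (hu q) (abs_nonneg _) (hv q))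

variable {C : Type*} [Fintype C]

lemma measurable_log_gibbsAvg_exp (E u v : C → ℝ) (b ℓ : ℝ) :
    Measurable fun p : ℝ × ℝ => Real.log (gibbsAvg E fun q =>
      Real.exp (b * p.1 * u q + b * p.2 * v q + ℓ * (u q * v q))) := by
  unfold gibbsAvg
  fun_prop

variable [Nonempty C] {u v : C → ℝ} {b ℓ : ℝ}

lemma PairMoments.integrable_log_gibbsAvg_exp (h : PairMoments μ w m) (E : C → ℝ) (hb : 0 ≤ b)
    (hu : ∀ q, |u q| ≤ 1) (hv : ∀ q, |v q| ≤ 1) (hℓ : 0 ≤ ℓ) :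
    Integrable (fun p : ℝ × ℝ => Real.log (gibbsAvg E fun q =>
      Real.exp (b * p.1 * u q + b * p.2 * v q + ℓ * (u q * v q)))) μ := by
  have := h.isProbabilityMeasure
  refine Integrable.mono' (((h.integrable_abs_fst.const_mul b).fun_add
    (h.integrable_abs_snd.const_mul b)).fun_add (integrable_const ℓ))
    (measurable_log_gibbsAvg_exp E u v b ℓ).aestronglyMeasurable
    (Filter.Eventually.of_forall fun p => ?_)
  exact abs_log_gibbsAvg_exp_le E (abs_tilt_le hb hu hv hℓ p.1 p.2)

/-- Integrate the second cumulant expansion. Since `u² = v² = 1`, the second moment of the tilt is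
explicit. The terms linear in the disorder vanish, including those multiplied by `ℓ`, and the
covariance enters only through `b² w` times the Gibbs covariance of `u` and `v`. The remaining `ℓ²`
term is absorbed in the error. -/
lemma PairMoments.abs_integral_log_gibbsAvg_exp_sub_le (h : PairMoments μ w m) (E : C → ℝ)
    (hb : 0 ≤ b) (hu : ∀ q, u q ^ 2 = 1) (hv : ∀ q, v q ^ 2 = 1) (hℓ : 0 ≤ ℓ) :
    |∫ p, Real.log (gibbsAvg E fun q =>
        Real.exp (b * p.1 * u q + b * p.2 * v q + ℓ * (u q * v q))) ∂μ -
      (ℓ * gibbsAvg E (fun q => u q * v q) +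
        b ^ 2 * (2 - gibbsAvg E u ^ 2 - gibbsAvg E v ^ 2) / 2 +
        b ^ 2 * w * (gibbsAvg E (fun q => u q * v q) - gibbsAvg E u * gibbsAvg E v))| ≤
      ℓ ^ 2 / 2 + 360 * (2 * b ^ 3 * m + ℓ ^ 3) := by
  have := h.isProbabilityMeasure
  have hu1 : ∀ q, |u q| ≤ 1 := fun q => (sq_le_one_iff_abs_le_one _).1 (hu q).le
  have hv1 : ∀ q, |v q| ≤ 1 := fun q => (sq_le_one_iff_abs_le_one _).1 (hv q).le
  have hc1 : |gibbsAvg E (fun q => u q * v q)| ≤ 1 := abs_gibbsAvg_le E fun q => by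
    rw [abs_mul]; exact mul_le_one₀ (hu1 q) (abs_nonneg _) (hv1 q)
  set a := gibbsAvg E u
  set a' := gibbsAvg E v
  set c := gibbsAvg E (fun q => u q * v q)
  set Q : ℝ × ℝ → ℝ := fun p => (ℓ * c + ℓ ^ 2 * (1 - c ^ 2) / 2) +
    (b * a + b * ℓ * (a' - a * c)) * p.1 + (b * a' + b * ℓ * (a - a' * c)) * p.2 +
    (b ^ 2 * (1 - a ^ 2) / 2) * p.1 ^ 2 + (b ^ 2 * (1 - a' ^ 2) / 2) * p.2 ^ 2 +
    (b ^ 2 * (c - a * a')) * (p.1 * p.2) with hQ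
  obtain ⟨iQ, eQ⟩ := h.integral_quadratic (ℓ * c + ℓ ^ 2 * (1 - c ^ 2) / 2)
    (b * a + b * ℓ * (a' - a * c)) (b * a' + b * ℓ * (a - a' * c))
    (b ^ 2 * (1 - a ^ 2) / 2) (b ^ 2 * (1 - a' ^ 2) / 2) (b ^ 2 * (c - a * a'))
  have iL := h.integrable_log_gibbsAvg_exp E hb hu1 hv1 hℓ
  set G : ℝ × ℝ → ℝ := fun p => Real.log (gibbsAvg E fun q =>
    Real.exp (b * p.1 * u q + b * p.2 * v q + ℓ * (u q * v q))) with hG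
  have hpt : ∀ p, |G p - Q p| ≤ 360 * (b ^ 3 * |p.1| ^ 3 + b ^ 3 * |p.2| ^ 3 + ℓ ^ 3) := fun p => by
    have k := log_gibbsAvg_exp_second_order E (abs_tilt_le hb hu1 hv1 hℓ p.1 p.2)
    have e1 : gibbsAvg E (fun q => b * p.1 * u q + b * p.2 * v q + ℓ * (u q * v q)) =
        b * p.1 * a + b * p.2 * a' + ℓ * c := by
      rw [gibbsAvg_add, gibbsAvg_add, gibbsAvg_const_mul, gibbsAvg_const_mul, gibbsAvg_const_mul]
    have e2 : gibbsAvg E (fun q => (b * p.1 * u q + b * p.2 * v q + ℓ * (u q * v q)) ^ 2) =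
        b ^ 2 * p.1 ^ 2 + b ^ 2 * p.2 ^ 2 + ℓ ^ 2 + 2 * b ^ 2 * (p.1 * p.2) * c +
          2 * b * ℓ * p.1 * a' + 2 * b * ℓ * p.2 * a := by
      have : (fun q => (b * p.1 * u q + b * p.2 * v q + ℓ * (u q * v q)) ^ 2) = fun q =>
          (b ^ 2 * p.1 ^ 2 + b ^ 2 * p.2 ^ 2 + ℓ ^ 2) + 2 * b ^ 2 * (p.1 * p.2) * (u q * v q) +
          2 * b * ℓ * p.1 * v q + 2 * b * ℓ * p.2 * u q := by
        funext q
        linear_combination (b ^ 2 * p.1 ^ 2 + ℓ ^ 2 * v q ^ 2 + 2 * b * ℓ * p.1 * v q) * hu q +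
          (b ^ 2 * p.2 ^ 2 + ℓ ^ 2 + 2 * b * ℓ * p.2 * u q) * hv q
      rw [this, gibbsAvg_add, gibbsAvg_add, gibbsAvg_add, gibbsAvg_const_mul, gibbsAvg_const_mul,
        gibbsAvg_const_mul, gibbsAvg_const]
    rw [e1, e2] at k
    have e3 : G p - Q p = Real.log (gibbsAvg E fun q =>
        Real.exp (b * p.1 * u q + b * p.2 * v q + ℓ * (u q * v q))) -
        (b * p.1 * a + b * p.2 * a' + ℓ * c) -
        (b ^ 2 * p.1 ^ 2 + b ^ 2 * p.2 ^ 2 + ℓ ^ 2 + 2 * b ^ 2 * (p.1 * p.2) * c +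
          2 * b * ℓ * p.1 * a' + 2 * b * ℓ * p.2 * a -
          (b * p.1 * a + b * p.2 * a' + ℓ * c) ^ 2) / 2 := by
      simp only [hG, hQ]; ring
    rw [e3]
    refine k.trans ?_
    have := add_add_cube_le (mul_nonneg hb (abs_nonneg p.1)) (mul_nonneg hb (abs_nonneg p.2)) hℓ
    -- The constant is `360 = 40 · 9`: the cubic remainder times the cost of splitting the cube of a
    -- sum of three terms.
    calc _ ≤ 40 * (9 * ((b * |p.1|) ^ 3 + (b * |p.2|) ^ 3 + ℓ ^ 3)) := by gcongr
      _ = _ := by ring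
  have iB : Integrable (fun p : ℝ × ℝ => 360 * (b ^ 3 * |p.1| ^ 3 + b ^ 3 * |p.2| ^ 3 + ℓ ^ 3)) μ :=
    (((h.integrable_fst.const_mul _).fun_add (h.integrable_snd.const_mul _)).fun_add
      (integrable_const _)).const_mul _
  have hint : |∫ p, (G p - Q p) ∂μ| ≤ 360 * (2 * b ^ 3 * m + ℓ ^ 3) := by
    refine abs_integral_le_integral_abs.trans ((integral_mono (iL.sub iQ).abs iB hpt).trans ?_)
    rw [integral_const_mul, integral_add ((h.integrable_fst.const_mul _).fun_add
      (h.integrable_snd.const_mul _)) (integrable_const _),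
      integral_add (h.integrable_fst.const_mul _) (h.integrable_snd.const_mul _),
      integral_const_mul, integral_const_mul]
    simp only [integral_const, probReal_univ, one_smul]
    have : 0 ≤ b ^ 3 := by positivity
    nlinarith [h.third_fst, h.third_snd]
  rw [integral_sub iL iQ, eQ] at hint
  have h1 : c ^ 2 ≤ 1 := (sq_le_one_iff_abs_le_one _).2 hc1
  have h2 : 0 ≤ ℓ ^ 2 * (1 - c ^ 2) / 2 := by
    have := mul_nonneg (sq_nonneg ℓ) (sub_nonneg.2 h1); linarith
  have h3 : ℓ ^ 2 * (1 - c ^ 2) / 2 ≤ ℓ ^ 2 / 2 := by nlinarith [sq_nonneg ℓ, sq_nonneg c]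
  have h4 := abs_le.1 hint
  rw [abs_le]
  constructor <;> nlinarith

end QuadraticExpansion

/-! ### Two systems coupled through their overlap. -/

section CoupledSystem

variable {A ι : Type*} [Fintype ι]

/-- The overlap feature `χ_k(σ) χ_k(τ)` of a pair of configurations. -/
def overlapFeature (χ : ι → A → ℝ) (k : ι) (q : A × A) : ℝ := χ k q.1 * χ k q.2

/-- The energy of a pair of configurations coupled through their overlaps, with strengths `L`. -/
def pairEnergy (b : ℝ) (χ : ι → A → ℝ) (L : ι → ℝ) (x : ι → ℝ × ℝ) (q : A × A) : ℝ :=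
  linEnergy b χ (fun k => (x k).1) q.1 + linEnergy b χ (fun k => (x k).2) q.2 +
    linEnergy 1 (overlapFeature χ) L q

lemma pairEnergy_update [DecidableEq ι] (b : ℝ) (χ : ι → A → ℝ) (L : ι → ℝ) (x : ι → ℝ × ℝ)
    (k : ι) (ℓ : ℝ) (p : ℝ × ℝ) :
    pairEnergy b χ (Function.update L k ℓ) (Function.update x k p) = fun q =>
      pairEnergy b χ (Function.update L k 0) (Function.update x k 0) q +
        (b * p.1 * χ k q.1 + b * p.2 * χ k q.2 + ℓ * (χ k q.1 * χ k q.2)) := by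
  funext q
  simp only [pairEnergy, update_fst, update_snd]
  rw [linEnergy_update b χ _ k p.1 0, linEnergy_update b χ _ k p.2 0,
    linEnergy_update 1 (overlapFeature χ) L k ℓ 0]
  simp only [overlapFeature, Prod.fst_zero, Prod.snd_zero]
  ring

lemma pairEnergy_zero (b : ℝ) (χ : ι → A → ℝ) (x : ι → ℝ × ℝ) :
    pairEnergy b χ 0 x = fun q =>
      linEnergy b χ (fun k => (x k).1) q.1 + linEnergy b χ (fun k => (x k).2) q.2 := by
  funext q; simp [pairEnergy, linEnergy]

lemma pairEnergy_eq_add (b : ℝ) (χ : ι → A → ℝ) (L : ι → ℝ) (x : ι → ℝ × ℝ) :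
    pairEnergy b χ L x = fun q => pairEnergy b χ 0 x q + linEnergy 1 (overlapFeature χ) L q := by
  rw [pairEnergy_zero]; rfl

lemma measurable_pairEnergy (b : ℝ) (χ : ι → A → ℝ) (L : ι → ℝ) (q : A × A) :
    Measurable fun x => pairEnergy b χ L x q := by
  unfold pairEnergy linEnergy
  fun_prop

variable [Fintype A]

lemma gibbsAvg_prod (E₁ E₂ f g : A → ℝ) :
    gibbsAvg (fun q : A × A => E₁ q.1 + E₂ q.2) (fun q => f q.1 * g q.2) =
      gibbsAvg E₁ f * gibbsAvg E₂ g := by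
  simp only [gibbsAvg, Fintype.sum_prod_type, Real.exp_add]
  rw [div_mul_div_comm, Finset.sum_mul_sum, Finset.sum_mul_sum]
  congr 1
  exact Finset.sum_congr rfl fun a _ => Finset.sum_congr rfl fun c _ => by ring

/-- The increase of the free energy due to the coupling. -/
noncomputable def couplingGain (b : ℝ) (χ : ι → A → ℝ) (L : ι → ℝ) (x : ι → ℝ × ℝ) : ℝ :=
  logSumExp (pairEnergy b χ L x) - logSumExp (pairEnergy b χ 0 x)

lemma measurable_couplingGain (b : ℝ) (χ : ι → A → ℝ) (L : ι → ℝ) :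
    Measurable (couplingGain b χ L) :=
  (measurable_logSumExp (measurable_pairEnergy b χ L)).sub
    (measurable_logSumExp (measurable_pairEnergy b χ 0))

/-- The product of the averages of `χ_k` for the two components of the coupled system. -/
noncomputable def coupledSpin (b : ℝ) (χ : ι → A → ℝ) (L : ι → ℝ) (x : ι → ℝ × ℝ) (k : ι) : ℝ :=
  gibbsAvg (pairEnergy b χ L x) (fun q => χ k q.1) * gibbsAvg (pairEnergy b χ L x) (fun q => χ k q.2)

lemma measurable_coupledSpin (b : ℝ) (χ : ι → A → ℝ) (L : ι → ℝ) (k : ι) :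
    Measurable fun x => coupledSpin b χ L x k :=
  (measurable_gibbsAvg _ (measurable_pairEnergy b χ L)).mul
    (measurable_gibbsAvg _ (measurable_pairEnergy b χ L))

/-- Draw two independent pairs from the coupled Gibbs measure. The sum is the mean overlap of the
first configuration of one pair with the second configuration of the other, and overlaps are
nonnegative by `hpos`. -/
lemma sum_coupledSpin_nonneg (b : ℝ) {χ : ι → A → ℝ} (hpos : ∀ σ τ, 0 ≤ ∑ k, χ k σ * χ k τ)
    (L : ι → ℝ) (x : ι → ℝ × ℝ) : 0 ≤ ∑ k, coupledSpin b χ L x k := by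
  set E := pairEnergy b χ L x with hE
  have : ∑ k, coupledSpin b χ L x k =
      gibbsAvg E fun q => gibbsAvg E fun q' => ∑ k, χ k q.1 * χ k q'.2 := by
    have e : ∀ q : A × A, (gibbsAvg E fun q' => ∑ k, χ k q.1 * χ k q'.2) =
        ∑ k, gibbsAvg E (fun q' => χ k q'.2) * χ k q.1 := fun q => by
      rw [gibbsAvg_sum]
      exact Finset.sum_congr rfl fun k _ => by rw [gibbsAvg_const_mul, mul_comm]
    simp only [e]
    rw [gibbsAvg_sum]
    exact Finset.sum_congr rfl fun k _ => by rw [gibbsAvg_const_mul, mul_comm]; rfl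
  rw [this]
  exact gibbsAvg_nonneg E fun q => gibbsAvg_nonneg E fun q' => hpos _ _

lemma gibbsAvg_pairEnergy_zero_overlap (b : ℝ) (χ : ι → A → ℝ) (x : ι → ℝ × ℝ) (k : ι) :
    gibbsAvg (pairEnergy b χ 0 x) (fun q => χ k q.1 * χ k q.2) =
      spinAvg b χ (fun j => (x j).1) k * spinAvg b χ (fun j => (x j).2) k := by
  rw [pairEnergy_zero, gibbsAvg_prod]; rfl

/-- The exponential moment of the overlap of two independent configurations. -/
noncomputable def overlapExpMoment (b : ℝ) (χ : ι → A → ℝ) (ℓ : ℝ) (x : ι → ℝ × ℝ) : ℝ :=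
  gibbsAvg (pairEnergy b χ 0 x) fun q => Real.exp (ℓ * ∑ k, χ k q.1 * χ k q.2)

lemma measurable_overlapExpMoment (b : ℝ) (χ : ι → A → ℝ) (ℓ : ℝ) :
    Measurable (overlapExpMoment b χ ℓ) :=
  measurable_gibbsAvg _ (measurable_pairEnergy b χ 0)

variable [Nonempty A] {b : ℝ} {χ : ι → A → ℝ}

lemma abs_couplingGain_le (hχ : ∀ k a, |χ k a| ≤ 1) (L : ι → ℝ) (x : ι → ℝ × ℝ) :
    |couplingGain b χ L x| ≤ ∑ k, |L k| := by
  rw [couplingGain, pairEnergy_eq_add b χ L]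
  refine abs_logSumExp_add_sub_le _ fun q => ?_
  rw [linEnergy, one_mul]
  refine (Finset.abs_sum_le_sum_abs _ _).trans (Finset.sum_le_sum fun k _ => ?_)
  rw [abs_mul]
  refine mul_le_of_le_one_right (abs_nonneg _) ?_
  rw [overlapFeature, abs_mul]
  exact mul_le_one₀ (hχ k _) (abs_nonneg _) (hχ k _)

lemma integrable_couplingGain (hχ : ∀ k a, |χ k a| ≤ 1) (L : ι → ℝ) (P : Measure (ι → ℝ × ℝ))
    [IsProbabilityMeasure P] : Integrable (couplingGain b χ L) P :=
  Integrable.of_bound (measurable_couplingGain b χ L).aestronglyMeasurable _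
    (Filter.Eventually.of_forall fun x => abs_couplingGain_le hχ L x)

lemma abs_coupledSpin_le (hχ : ∀ k a, |χ k a| ≤ 1) (L : ι → ℝ) (x : ι → ℝ × ℝ) (k : ι) :
    |coupledSpin b χ L x k| ≤ 1 := by
  rw [coupledSpin, abs_mul]
  exact mul_le_one₀ (abs_gibbsAvg_le _ fun q => hχ k _) (abs_nonneg _)
    (abs_gibbsAvg_le _ fun q => hχ k _)

lemma integrable_coupledSpin (hχ : ∀ k a, |χ k a| ≤ 1) (L : ι → ℝ) (k : ι)
    (P : Measure (ι → ℝ × ℝ)) [IsProbabilityMeasure P] :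
    Integrable (fun x => coupledSpin b χ L x k) P :=
  Integrable.of_bound (measurable_coupledSpin b χ L k).aestronglyMeasurable 1
    (Filter.Eventually.of_forall fun x => abs_coupledSpin_le hχ L x k)

lemma gibbsAvg_pairEnergy_zero_fst (x : ι → ℝ × ℝ) (k : ι) :
    gibbsAvg (pairEnergy b χ 0 x) (fun q => χ k q.1) = spinAvg b χ (fun j => (x j).1) k := by
  have := gibbsAvg_prod (linEnergy b χ (fun k => (x k).1)) (linEnergy b χ (fun k => (x k).2))
    (χ k) (fun _ => 1)
  rw [gibbsAvg_const] at this
  simpa [pairEnergy_zero, spinAvg] using this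

lemma gibbsAvg_pairEnergy_zero_snd (x : ι → ℝ × ℝ) (k : ι) :
    gibbsAvg (pairEnergy b χ 0 x) (fun q => χ k q.2) = spinAvg b χ (fun j => (x j).2) k := by
  have := gibbsAvg_prod (linEnergy b χ (fun k => (x k).1)) (linEnergy b χ (fun k => (x k).2))
    (fun _ => 1) (χ k)
  rw [gibbsAvg_const] at this
  simpa [pairEnergy_zero, spinAvg] using this

/-- Jensen's inequality under the uncoupled product Gibbs measure, where the mean of the coupling
energy is `ℓ` times the overlap. -/
lemma mul_pairOverlap_le_couplingGain (ℓ : ℝ) (x : ι → ℝ × ℝ) :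
    ℓ * pairOverlap b χ x ≤ couplingGain b χ (fun _ => ℓ) x := by
  rw [couplingGain, pairEnergy_eq_add b χ (fun _ => ℓ), logSumExp_add, add_sub_cancel_left]
  refine le_trans (le_of_eq ?_) (gibbsAvg_le_log _ _)
  have : linEnergy 1 (overlapFeature χ) (fun _ => ℓ) =
      fun q => ℓ * ∑ k, χ k q.1 * χ k q.2 := by
    funext q; simp [linEnergy, overlapFeature, Finset.mul_sum]
  rw [this, gibbsAvg_const_mul, gibbsAvg_sum, pairOverlap]
  congr 1
  exact Finset.sum_congr rfl fun k _ => (gibbsAvg_pairEnergy_zero_overlap b χ x k).symm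

lemma couplingGain_le_overlapExpMoment (ℓ : ℝ) (x : ι → ℝ × ℝ) :
    couplingGain b χ (fun _ => ℓ) x ≤ overlapExpMoment b χ ℓ x := by
  rw [couplingGain, pairEnergy_eq_add b χ (fun _ => ℓ), logSumExp_add, add_sub_cancel_left]
  have : linEnergy 1 (overlapFeature χ) (fun _ => ℓ) =
      fun q => ℓ * ∑ k, χ k q.1 * χ k q.2 := by
    funext q; simp [linEnergy, overlapFeature, Finset.mul_sum]
  rw [this]
  have h := Real.log_le_sub_one_of_pos (gibbsAvg_pos (pairEnergy b χ 0 x)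
    (Y := fun q => Real.exp (ℓ * ∑ k, χ k q.1 * χ k q.2)) fun q => Real.exp_pos _)
  rw [overlapExpMoment]
  linarith

lemma abs_overlapExpMoment_le (ℓ : ℝ) (x : ι → ℝ × ℝ) :
    |overlapExpMoment b χ ℓ x| ≤ ∑ q : A × A, Real.exp (ℓ * ∑ k, χ k q.1 * χ k q.2) :=
  abs_gibbsAvg_le _ fun q => by
    rw [abs_of_pos (Real.exp_pos _)]
    exact Finset.single_le_sum (f := fun q : A × A => Real.exp (ℓ * ∑ k, χ k q.1 * χ k q.2))
      (fun q _ => (Real.exp_pos _).le) (Finset.mem_univ q)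

lemma integrable_overlapExpMoment (ℓ : ℝ) (P : Measure (ι → ℝ × ℝ)) [IsProbabilityMeasure P] :
    Integrable (overlapExpMoment b χ ℓ) P :=
  Integrable.of_bound (measurable_overlapExpMoment b χ ℓ).aestronglyMeasurable _
    (Filter.Eventually.of_forall fun x => abs_overlapExpMoment_le ℓ x)

variable [DecidableEq ι] {μ μ' : Measure (ℝ × ℝ)} {w m : ℝ}

/-- The average coupling gain under resampling of the entry `k`. -/
lemma PairMoments.integral_couplingGain_update (h : PairMoments μ w m) (hb : 0 ≤ b)
    (hχ : ∀ k a, χ k a ^ 2 = 1) (L : ι → ℝ) (x : ι → ℝ × ℝ) (k : ι) {ℓ : ℝ} (hℓ : 0 ≤ ℓ)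
    {a a' c s s' : ℝ}
    (ha : a = gibbsAvg (pairEnergy b χ (Function.update L k 0) (Function.update x k 0))
      (fun q => χ k q.1))
    (ha' : a' = gibbsAvg (pairEnergy b χ (Function.update L k 0) (Function.update x k 0))
      (fun q => χ k q.2))
    (hc : c = gibbsAvg (pairEnergy b χ (Function.update L k 0) (Function.update x k 0))
      (fun q => χ k q.1 * χ k q.2))
    (hs : s = spinAvg b χ (fun j => (Function.update x k 0 j).1) k)
    (hs' : s' = spinAvg b χ (fun j => (Function.update x k 0 j).2) k) :
    |∫ p, couplingGain b χ (Function.update L k ℓ) (Function.update x k p) ∂μ -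
      (couplingGain b χ (Function.update L k 0) (Function.update x k 0) + ℓ * c +
        b ^ 2 * (s ^ 2 + s' ^ 2 - a ^ 2 - a' ^ 2) / 2 + b ^ 2 * w * (c - a * a'))| ≤
      ℓ ^ 2 / 2 + 360 * (4 * b ^ 3 * m + ℓ ^ 3) := by
  have := h.isProbabilityMeasure
  have hχ1 : ∀ k a, |χ k a| ≤ 1 := fun k a => (sq_le_one_iff_abs_le_one _).1 (hχ k a).le
  set E₀ := pairEnergy b χ (Function.update L k 0) (Function.update x k 0)
  set E₁ := pairEnergy b χ 0 (Function.update x k 0) with hE₁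
  -- Measure both free energies from the cavity at `k`: the subtracted uncoupled system gives an
  -- expansion of the same form with `ℓ = 0`.
  have e : ∀ p, couplingGain b χ (Function.update L k ℓ) (Function.update x k p) =
      couplingGain b χ (Function.update L k 0) (Function.update x k 0) +
      Real.log (gibbsAvg E₀ fun q =>
        Real.exp (b * p.1 * χ k q.1 + b * p.2 * χ k q.2 + ℓ * (χ k q.1 * χ k q.2))) -
      Real.log (gibbsAvg E₁ fun q =>
        Real.exp (b * p.1 * χ k q.1 + b * p.2 * χ k q.2 + 0 * (χ k q.1 * χ k q.2))) := fun p => by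
    have e0 := pairEnergy_update b χ 0 x k 0 p
    rw [show Function.update (0 : ι → ℝ) k 0 = 0 from Function.update_eq_self k (0 : ι → ℝ)] at e0
    rw [couplingGain, pairEnergy_update, e0, logSumExp_add, logSumExp_add, couplingGain]
    ring
  have i₀ := h.integrable_log_gibbsAvg_exp E₀ hb (u := fun q => χ k q.1) (v := fun q => χ k q.2)
    (fun q => hχ1 k _) (fun q => hχ1 k _) hℓ
  have i₁ := h.integrable_log_gibbsAvg_exp E₁ hb (u := fun q => χ k q.1) (v := fun q => χ k q.2)
    (fun q => hχ1 k _) (fun q => hχ1 k _) le_rfl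
  have k₀ := h.abs_integral_log_gibbsAvg_exp_sub_le E₀ hb (u := fun q => χ k q.1)
    (v := fun q => χ k q.2) (fun q => hχ k _) (fun q => hχ k _) hℓ
  have k₁ := h.abs_integral_log_gibbsAvg_exp_sub_le E₁ hb (u := fun q => χ k q.1)
    (v := fun q => χ k q.2) (fun q => hχ k _) (fun q => hχ k _) le_rfl
  rw [hE₁, gibbsAvg_pairEnergy_zero_overlap, gibbsAvg_pairEnergy_zero_fst,
    gibbsAvg_pairEnergy_zero_snd, ← hs, ← hs', ← hE₁] at k₁
  rw [← ha, ← ha', ← hc] at k₀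
  simp only [e]
  rw [integral_sub ((integrable_const _).fun_add i₀) i₁, integral_add (integrable_const _) i₀]
  simp only [integral_const, probReal_univ, one_smul]
  have k₀' := abs_le.1 k₀
  have k₁' := abs_le.1 k₁
  rw [abs_le]
  constructor <;> linarith

lemma abs_coupledSpin_update_sub_le (hb : 0 ≤ b) (hχ : ∀ k a, |χ k a| ≤ 1) {L : ι → ℝ}
    (hL : ∀ k, 0 ≤ L k) (x : ι → ℝ × ℝ) (k : ι) :
    |coupledSpin b χ (Function.update L k 0) (Function.update x k 0) k - coupledSpin b χ L x k| ≤
      8 * (b * |(x k).1| + b * |(x k).2| + L k) := by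
  have e := pairEnergy_update b χ L x k (L k) (x k)
  rw [Function.update_eq_self, Function.update_eq_self] at e
  have ht := abs_tilt_le (C := A × A) hb (u := fun q => χ k q.1) (v := fun q => χ k q.2)
    (fun q => hχ k _) (fun q => hχ k _) (hL k) (x k).1 (x k).2
  have h₁ := abs_gibbsAvg_tilt_sub_le
    (pairEnergy b χ (Function.update L k 0) (Function.update x k 0)) ht
    (Y := fun q => χ k q.1) fun q => hχ k _
  have h₂ := abs_gibbsAvg_tilt_sub_le
    (pairEnergy b χ (Function.update L k 0) (Function.update x k 0)) ht
    (Y := fun q => χ k q.2) fun q => hχ k _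
  rw [← e, abs_sub_comm] at h₁ h₂
  have h₃ := abs_mul_sub_mul_le
    (a₂ := gibbsAvg (pairEnergy b χ (Function.update L k 0) (Function.update x k 0))
      (fun q => χ k q.2))
    (c₁ := gibbsAvg (pairEnergy b χ L x) (fun q => χ k q.1))
    (abs_gibbsAvg_le (pairEnergy b χ (Function.update L k 0) (Function.update x k 0))
      (Y := fun q => χ k q.1) (c := 1) fun q => hχ k _)
    (abs_gibbsAvg_le (pairEnergy b χ L x) (Y := fun q => χ k q.2) (c := 1) fun q => hχ k _)
  rw [coupledSpin, coupledSpin]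
  linarith

/-- The average overlap of two correlated systems with small correlation is small, provided that
its exponential moments are bounded for some independent disorder with the same variance. -/
theorem PairMoments.mul_integral_pairOverlap_le (h : PairMoments μ w m) (h' : PairMoments μ' 0 m)
    (hw : 0 ≤ w) (hb : 0 ≤ b) (hχ : ∀ k a, χ k a ^ 2 = 1)
    (hpos : ∀ σ τ, 0 ≤ ∑ k, χ k σ * χ k τ) {ℓ ℓ' D : ℝ} (hℓ : 0 ≤ ℓ) (hℓ' : ℓ' = ℓ + b ^ 2 * w)
    (hℓ1 : ℓ' ≤ 1)
    (hD : ∫ x, overlapExpMoment b χ ℓ' x ∂(Measure.pi fun _ : ι => μ') ≤ D) :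
    ℓ * ∫ x, pairOverlap b χ x ∂(Measure.pi fun _ : ι => μ) ≤
      D + Fintype.card ι * (3000 * (b ^ 3 * (m + 1) + ℓ' ^ 2)) := by
  have := h.isProbabilityMeasure
  have := h'.isProbabilityMeasure
  have hw1 : w ≤ 1 := (le_abs_self w).trans h.integral_abs_mul_le
  have hχ1 : ∀ k a, |χ k a| ≤ 1 := fun k a => (sq_le_one_iff_abs_le_one _).1 (hχ k a).le
  have hbw : 0 ≤ b ^ 2 * w := by positivity
  have hℓ'0 : 0 ≤ ℓ' := by linarith
  have hb3 : 0 ≤ b ^ 3 := by positivity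
  have hm := h.nonneg
  -- Entries with correlated disorder carry the coupling `ℓ`, those with independent disorder the
  -- larger `ℓ' = ℓ + b² w`. The loss of coupling is chosen to compensate the correlation to leading
  -- order.
  set L : Finset ι → ι → ℝ := fun S j => if j ∈ S then ℓ else ℓ' with hL
  have hL0 : ∀ S k, 0 ≤ L S k := fun S k => by simp only [hL]; split_ifs <;> assumption
  have hL1 : ∀ S k, L S k ≤ ℓ' := fun S k => by simp only [hL]; split_ifs <;> linarith
  set K := ℓ ^ 2 / 2 + ℓ' ^ 2 / 2 + 360 * (8 * b ^ 3 * m + ℓ ^ 3 + ℓ' ^ 3) + 8 * b ^ 2 * w * ℓ'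
  set g : Finset ι → ι → (ι → ℝ × ℝ) → ℝ := fun S k x =>
    -(b ^ 2 * w) * coupledSpin b χ (L S) x k + (K + 8 * b ^ 3 * (|(x k).1| + |(x k).2|)) with hg
  have hint := fun S k => h.integrable_mixedLaw h' (ι := ι) S k
  have ig : ∀ S k, Integrable (g S k) (mixedLaw μ μ' S) := fun S k =>
    ((integrable_coupledSpin hχ1 _ k _).const_mul _).fun_add ((integrable_const _).fun_add
      (((hint S k).1.fun_add (hint S k).2.1).const_mul _))
  have hinc : ∀ S k, ∫ x, couplingGain b χ (L (insert k S)) x ∂(mixedLaw μ μ' (insert k S)) -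
      ∫ x, couplingGain b χ (L (S.erase k)) x ∂(mixedLaw μ μ' (S.erase k)) ≤
        -(b ^ 2 * w) * ∫ x, coupledSpin b χ (L S) x k ∂(mixedLaw μ μ' S) +
          3000 * (b ^ 3 * (m + 1) + ℓ' ^ 2) := fun S k => by
    refine (integral_mixedLaw_insert_sub_erase_le _ _ (integrable_couplingGain hχ1 _ _)
      (integrable_couplingGain hχ1 _ _) (ig S k) fun x => ?_).trans ?_
    · have e₁ : L (insert k S) = Function.update (L S) k ℓ := ite_mem_insert_eq_update S k ℓ ℓ'
      have e₂ : L (S.erase k) = Function.update (L S) k ℓ' := ite_mem_erase_eq_update S k ℓ ℓ'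
      rw [e₁, e₂]
      -- Both expansions start from the same cavity, so all common terms drop out. The correlation
      -- contributes `b² w (c - a a')` and the change of coupling `(ℓ - ℓ') c = -b² w c`, which
      -- leaves `-b² w a a'`.
      have k₁ := (abs_le.1 (h.integral_couplingGain_update hb hχ (L S) x k hℓ rfl rfl rfl rfl rfl)).2
      have k₂ := (abs_le.1
        (h'.integral_couplingGain_update hb hχ (L S) x k hℓ'0 rfl rfl rfl rfl rfl)).1
      have k₃ := (abs_le.1 (abs_coupledSpin_update_sub_le hb hχ1 (hL0 S) x k)).1
      have k₄ := mul_le_mul_of_nonneg_left k₃ hbw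
      have k₅ := mul_le_mul_of_nonneg_left (hL1 S k) hbw
      have k₆ : b ^ 2 * w * (b * |(x k).1| + b * |(x k).2|) ≤ b ^ 3 * (|(x k).1| + |(x k).2|) := by
        have : 0 ≤ b ^ 3 * (|(x k).1| + |(x k).2|) := by positivity
        nlinarith
      rw [coupledSpin] at k₄
      simp only [hg]
      rw [hℓ'] at k₂
      set c := gibbsAvg (pairEnergy b χ (Function.update (L S) k 0) (Function.update x k 0))
        (fun q => χ k q.1 * χ k q.2)
      simp only [K]
      rw [hℓ'] at k₅ ⊢
      linarith
    · simp only [hg]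
      have i := hint S k
      rw [integral_add ((integrable_coupledSpin hχ1 _ k _).const_mul _) ((integrable_const _).fun_add
        ((i.1.fun_add i.2.1).const_mul _)), integral_add (integrable_const _)
        ((i.1.fun_add i.2.1).const_mul _), integral_const_mul, integral_const_mul,
        integral_add i.1 i.2.1]
      simp only [integral_const, probReal_univ, one_smul]
      have f₁ : 8 * b ^ 3 * (∫ x : ι → ℝ × ℝ, |(x k).1| ∂(mixedLaw μ μ' S) +
          ∫ x : ι → ℝ × ℝ, |(x k).2| ∂(mixedLaw μ μ' S)) ≤ 8 * b ^ 3 * 2 := by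
        gcongr; linarith [i.2.2.1, i.2.2.2.1]
      have hℓle : ℓ ≤ ℓ' := by linarith
      have f₂ : ℓ ^ 2 ≤ ℓ' ^ 2 := pow_le_pow_left₀ hℓ hℓle 2
      have f₃ : ℓ ^ 3 ≤ ℓ' ^ 3 := pow_le_pow_left₀ hℓ hℓle 3
      have f₄ : ℓ' ^ 3 ≤ ℓ' ^ 2 := pow_le_pow_of_le_one hℓ'0 hℓ1 (by norm_num)
      have f₅ : b ^ 2 * w * ℓ' ≤ ℓ' ^ 2 := by nlinarith
      have f₆ : 0 ≤ b ^ 3 * m := by positivity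
      simp only [K]
      nlinarith [sq_nonneg ℓ']
  have hS : ∀ S : Finset ι,
      ∑ k, (∫ x, couplingGain b χ (L (insert k S)) x ∂(mixedLaw μ μ' (insert k S)) -
        ∫ x, couplingGain b χ (L (S.erase k)) x ∂(mixedLaw μ μ' (S.erase k))) ≤
        Fintype.card ι * (3000 * (b ^ 3 * (m + 1) + ℓ' ^ 2)) := fun S => by
    refine (Finset.sum_le_sum fun k _ => hinc S k).trans ?_
    rw [Finset.sum_add_distrib, ← Finset.mul_sum,
      ← integral_finsetSum _ fun k _ => integrable_coupledSpin hχ1 _ k _]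
    -- The terms left after the cancellation sum to something nonpositive and are discarded.
    have : 0 ≤ ∫ x, ∑ k, coupledSpin b χ (L S) x k ∂(mixedLaw μ μ' S) :=
      integral_nonneg fun x => sum_coupledSpin_nonneg b hpos _ x
    have h2 := mul_nonneg hbw this
    simp only [Finset.sum_const, Finset.card_univ, nsmul_eq_mul]
    linarith
  have hfin := sub_le_of_forall_sum_le
    (fun S => ∫ x, couplingGain b χ (L S) x ∂(mixedLaw μ μ' S)) _ hS
  simp only [mixedLaw_univ, mixedLaw_empty] at hfin
  have eU : L Finset.univ = fun _ => ℓ := by funext j; simp [hL]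
  have eE : L ∅ = fun _ => ℓ' := by funext j; simp [hL]
  rw [eU, eE] at hfin
  have iO : Integrable (pairOverlap b χ) (Measure.pi fun _ : ι => μ) :=
    integrable_finsetSum _ fun k _ => integrable_pairSpin hχ1 k _
  -- At the correlated end the gain dominates `ℓ` times the overlap; at the independent end it is at
  -- most the exponential moment, since `log y ≤ y - 1`.
  have l₁ : ℓ * ∫ x, pairOverlap b χ x ∂(Measure.pi fun _ : ι => μ) ≤
      ∫ x, couplingGain b χ (fun _ => ℓ) x ∂(Measure.pi fun _ : ι => μ) := by
    rw [← integral_const_mul]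
    exact integral_mono (iO.const_mul _) (integrable_couplingGain hχ1 _ _)
      fun x => mul_pairOverlap_le_couplingGain ℓ x
  have l₂ : ∫ x, couplingGain b χ (fun _ => ℓ') x ∂(Measure.pi fun _ : ι => μ') ≤
      ∫ x, overlapExpMoment b χ ℓ' x ∂(Measure.pi fun _ : ι => μ') :=
    integral_mono (integrable_couplingGain hχ1 _ _) (integrable_overlapExpMoment _ _)
      fun x => couplingGain_le_overlapExpMoment ℓ' x
  linarith

end CoupledSystem

/-! ### Products of two spins, and an exponential moment for sums of uniform spins. -/

section Spins

/-- The product `σ_i σ_j` of two spins. -/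
def spinPair {N : ℕ} (k : Fin N × Fin N) (σ : Fin N → ℤˣ) : ℝ :=
  ((σ k.1 : ℤ) : ℝ) * ((σ k.2 : ℤ) : ℝ)

lemma sq_unit (u : ℤˣ) : ((u : ℤ) : ℝ) ^ 2 = 1 := by
  rcases Int.units_eq_one_or u with h | h <;> simp [h]

variable {N : ℕ}

lemma spinPair_sq (k : Fin N × Fin N) (σ : Fin N → ℤˣ) : spinPair k σ ^ 2 = 1 := by
  rw [spinPair, mul_pow, sq_unit, sq_unit, one_mul]

lemma abs_spinPair_le (k : Fin N × Fin N) (σ : Fin N → ℤˣ) : |spinPair k σ| ≤ 1 :=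
  (sq_le_one_iff_abs_le_one _).1 (spinPair_sq k σ).le

lemma spinPair_mul (k : Fin N × Fin N) (ε σ : Fin N → ℤˣ) :
    spinPair k (ε * σ) = spinPair k ε * spinPair k σ := by
  simp only [spinPair, Pi.mul_apply, Units.val_mul, Int.cast_mul]; ring

lemma sum_spinPair (σ : Fin N → ℤˣ) : ∑ k, spinPair k σ = (∑ i, ((σ i : ℤ) : ℝ)) ^ 2 := by
  rw [Fintype.sum_prod_type, sq, Finset.sum_mul_sum]; rfl

lemma sum_spinPair_mul (σ τ : Fin N → ℤˣ) :
    ∑ k, spinPair k σ * spinPair k τ = (∑ i, (((σ * τ) i : ℤ) : ℝ)) ^ 2 := by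
  rw [← sum_spinPair]; simp only [spinPair_mul]

lemma sum_spinPair_mul_nonneg (σ τ : Fin N → ℤˣ) : 0 ≤ ∑ k, spinPair k σ * spinPair k τ := by
  rw [sum_spinPair_mul]; exact sq_nonneg _

lemma freeEnergy_eq_logPartition (β : ℝ) (x : Fin N → Fin N → ℝ) :
    freeEnergy β x = logPartition (β / √(N : ℝ)) spinPair (fun k => x k.1 k.2) := by
  simp only [freeEnergy, logPartition, logSumExp, negHamiltonian, linEnergy, spinPair,
    Fintype.sum_prod_type, mul_assoc]

/-- Sum out one spin at a time: by `cosh y ≤ exp (y²/2)` this costs a factor `2 e^a` and raises the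
coefficient `a` to `a + 2 a²`. The hypothesis on `b` keeps the coefficient below `b` throughout, so
each factor is at most `2 e^b`. -/
lemma sum_exp_sq_sum_le (n : ℕ) : ∀ a b : ℝ, 0 ≤ a → a + 2 * n * b ^ 2 ≤ b →
    ∑ ε : Fin n → ℤˣ, Real.exp (a * (∑ i, ((ε i : ℤ) : ℝ)) ^ 2) ≤ 2 ^ n * Real.exp (n * b) := by
  induction n with
  | zero => intro a b _ _; simp
  | succ n ih =>
    intro a b ha hab
    push_cast at hab
    have hn : (0 : ℝ) ≤ n := n.cast_nonneg
    have hab' : a ≤ b := by nlinarith [mul_nonneg hn (sq_nonneg b), sq_nonneg b]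
    have ha2 : a ^ 2 ≤ b ^ 2 := pow_le_pow_left₀ ha hab' 2
    have h := ih (a + 2 * a ^ 2) b (by positivity) (by nlinarith)
    rw [← (Fin.consEquiv fun _ => ℤˣ).sum_comp, Fintype.sum_prod_type_right]
    have key : ∀ ε : Fin n → ℤˣ, ∑ e : ℤˣ, Real.exp (a * (∑ i,
        (((Fin.consEquiv (fun _ : Fin (n + 1) => ℤˣ)) (e, ε) i : ℤ) : ℝ)) ^ 2) ≤
        2 * Real.exp b * Real.exp ((a + 2 * a ^ 2) * (∑ i, ((ε i : ℤ) : ℝ)) ^ 2) := fun ε => by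
      simp only [Fin.consEquiv_apply, Fin.sum_univ_succ, Fin.cons_zero, Fin.cons_succ]
      set s := ∑ i, ((ε i : ℤ) : ℝ)
      rw [UnitsInt.univ, Finset.sum_pair (by decide)]
      push_cast
      have e1 : Real.exp (a * (1 + s) ^ 2) + Real.exp (a * (-1 + s) ^ 2) =
          2 * Real.exp a * (Real.exp (a * s ^ 2) * Real.cosh (2 * a * s)) := by
        rw [Real.cosh_eq]
        have : 2 * Real.exp a * (Real.exp (a * s ^ 2) *
            ((Real.exp (2 * a * s) + Real.exp (-(2 * a * s))) / 2)) =
            Real.exp a * Real.exp (a * s ^ 2) * Real.exp (2 * a * s) +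
            Real.exp a * Real.exp (a * s ^ 2) * Real.exp (-(2 * a * s)) := by ring
        rw [this]
        simp only [← Real.exp_add]
        congr 2 <;> ring
      have e2 : Real.exp ((a + 2 * a ^ 2) * s ^ 2) =
          Real.exp (a * s ^ 2) * Real.exp ((2 * a * s) ^ 2 / 2) := by
        rw [← Real.exp_add]; congr 1; ring
      rw [e1, e2]
      gcongr
      exact Real.cosh_le_exp_half_sq _
    calc _ ≤ ∑ ε : Fin n → ℤˣ, 2 * Real.exp b *
          Real.exp ((a + 2 * a ^ 2) * (∑ i, ((ε i : ℤ) : ℝ)) ^ 2) :=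
          Finset.sum_le_sum fun ε _ => key ε
      _ = 2 * Real.exp b * ∑ ε : Fin n → ℤˣ,
          Real.exp ((a + 2 * a ^ 2) * (∑ i, ((ε i : ℤ) : ℝ)) ^ 2) := by rw [Finset.mul_sum]
      _ ≤ 2 * Real.exp b * (2 ^ n * Real.exp (n * b)) := by gcongr
      _ = _ := by
          push_cast
          rw [add_mul, Real.exp_add, one_mul]; ring

end Spins

/-! ### Independent random signs as reference disorder, and their gauge symmetry. -/

section Rademacher

/-- The law of a pair of independent random signs. -/
noncomputable def signPairLaw : Measure (ℝ × ℝ) :=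
  ENNReal.ofReal (1 / 4) • (Measure.dirac (1, 1) + Measure.dirac (-1, 1) +
    (Measure.dirac (1, -1) + Measure.dirac (-1, -1)))

lemma integrable_signPairLaw (g : ℝ × ℝ → ℝ) : Integrable g signPairLaw := by
  have h : ∀ a : ℝ × ℝ, Integrable g (Measure.dirac a) := fun a => integrable_dirac (by simp)
  exact ((((h _).add_measure (h _)).add_measure ((h _).add_measure (h _)))).smul_measure
    ENNReal.ofReal_ne_top

lemma integral_signPairLaw (g : ℝ × ℝ → ℝ) :
    ∫ p, g p ∂signPairLaw = (g (1, 1) + g (-1, 1) + (g (1, -1) + g (-1, -1))) / 4 := by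
  have h : ∀ a : ℝ × ℝ, Integrable g (Measure.dirac a) := fun a => integrable_dirac (by simp)
  rw [signPairLaw, integral_smul_measure, integral_add_measure ((h _).add_measure (h _))
    ((h _).add_measure (h _)), integral_add_measure (h _) (h _), integral_add_measure (h _) (h _)]
  simp only [integral_dirac]
  rw [ENNReal.toReal_ofReal (by norm_num), smul_eq_mul]
  ring

instance : IsProbabilityMeasure signPairLaw := ⟨by
  simp only [signPairLaw, Measure.smul_apply, Measure.add_apply, measure_univ, smul_eq_mul]
  rw [show (1 : ENNReal) + 1 + (1 + 1) = ENNReal.ofReal 4 by norm_num,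
    ← ENNReal.ofReal_mul (by norm_num)]
  norm_num⟩

lemma pairMoments_signPairLaw {m : ℝ} (hm : 1 ≤ m) : PairMoments signPairLaw 0 m := by
  refine ⟨inferInstance, integrable_signPairLaw _, integrable_signPairLaw _, ?_, ?_, ?_, ?_, ?_,
    ?_, ?_⟩ <;> rw [integral_signPairLaw] <;> norm_num [hm]

lemma measurePreserving_mul_signPairLaw (u : ℝ) (hu : u = 1 ∨ u = -1) :
    MeasurePreserving (fun p : ℝ × ℝ => (u * p.1, p.2)) signPairLaw signPairLaw := by
  refine ⟨by fun_prop, ?_⟩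
  rcases hu with rfl | rfl
  · simp
  · rw [signPairLaw, Measure.map_smul, Measure.map_add _ _ (by fun_prop),
      Measure.map_add _ _ (by fun_prop), Measure.map_add _ _ (by fun_prop)]
    simp only [Measure.map_dirac' (by fun_prop : Measurable fun p : ℝ × ℝ => (-1 * p.1, p.2))]
    norm_num
    congr 1 <;> exact add_comm _ _

variable {N : ℕ}

/-- Flipping the signs of the first components of an array of pairs along a spin configuration. -/
def signFlip (ε : Fin N → ℤˣ) (x : Fin N × Fin N → ℝ × ℝ) (k : Fin N × Fin N) : ℝ × ℝ :=
  (spinPair k ε * (x k).1, (x k).2)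

lemma measurePreserving_signFlip (ε : Fin N → ℤˣ) :
    MeasurePreserving (signFlip ε) (Measure.pi fun _ => signPairLaw)
      (Measure.pi fun _ => signPairLaw) :=
  measurePreserving_pi _ _ fun k => measurePreserving_mul_signPairLaw _
    (sq_eq_one_iff.1 (spinPair_sq k ε))

/-- Gauge transformation: multiplying the couplings by `ε_i ε_j` amounts to replacing `σ` by `ε σ`.
-/
lemma linEnergy_signFlip (b : ℝ) (ε σ : Fin N → ℤˣ) (x : Fin N × Fin N → ℝ × ℝ) :
    linEnergy b spinPair (fun k => (signFlip ε x k).1) σ =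
      linEnergy b spinPair (fun k => (x k).1) (ε * σ) := by
  simp only [linEnergy, signFlip, spinPair_mul]
  congr 1
  exact Finset.sum_congr rfl fun k _ => by ring

/-- Only the first system is gauged. Substituting `ε σ` for `σ` in its Gibbs sum moves `ε` out of
the weights and into the overlap. -/
lemma overlapExpMoment_signFlip (b ℓ : ℝ) (ε : Fin N → ℤˣ) (x : Fin N × Fin N → ℝ × ℝ) :
    overlapExpMoment b spinPair ℓ (signFlip ε x) =
      gibbsAvg (pairEnergy b spinPair 0 x) fun q =>
        Real.exp (ℓ * (∑ i, ((ε i : ℤ) : ℝ) * (((q.1 * q.2) i : ℤ) : ℝ)) ^ 2) := by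
  have hE : ∀ q : (Fin N → ℤˣ) × (Fin N → ℤˣ), pairEnergy b spinPair 0 (signFlip ε x) q =
      pairEnergy b spinPair 0 x (ε * q.1, q.2) := fun q => by
    rw [pairEnergy_zero, pairEnergy_zero]
    simp only [linEnergy_signFlip]
    rfl
  have hεε : ε * ε = 1 := by
    funext i; simp
  let e : (Fin N → ℤˣ) × (Fin N → ℤˣ) ≃ (Fin N → ℤˣ) × (Fin N → ℤˣ) :=
    (Equiv.mulLeft ε).prodCongr (Equiv.refl _)
  have he : ∀ q, e q = (ε * q.1, q.2) := fun q => rfl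
  simp only [overlapExpMoment, gibbsAvg, hE]
  congr 1
  · refine Fintype.sum_equiv e _ _ fun q => ?_
    rw [he, sum_spinPair_mul]
    have : ∀ i, ((ε i : ℤ) : ℝ) * (((ε * q.1 * q.2) i : ℤ) : ℝ) = (((q.1 * q.2) i : ℤ) : ℝ) :=
      fun i => by
        have h := congrFun hεε i
        rw [← Int.cast_mul, ← Units.val_mul]
        congr 2
        simp only [Pi.mul_apply, Pi.one_apply] at h ⊢
        rw [← mul_assoc, ← mul_assoc, h, one_mul]
    simp only [this]
  · exact Fintype.sum_equiv e _ _ fun q => by rw [he]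

/-- The law of the signs is invariant under every gauge `ε`, so one may average over all `ε`. For
any fixed configurations the overlap then becomes the square of a sum of `N` independent uniform
spins, whatever the Gibbs weights are. -/
lemma integral_overlapExpMoment_le (b : ℝ) {ℓ : ℝ} (hℓ : 0 ≤ ℓ) (hN : 1 ≤ N)
    (hℓN : ℓ ≤ 1 / (8 * N)) :
    ∫ x, overlapExpMoment b (spinPair (N := N)) ℓ x ∂(Measure.pi fun _ => signPairLaw) ≤ 2 := by
  have hNpos : (0 : ℝ) < N := by exact_mod_cast hN
  set P : Measure (Fin N × Fin N → ℝ × ℝ) := Measure.pi fun _ => signPairLaw with hP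
  set M := overlapExpMoment b (spinPair (N := N)) ℓ with hM
  have hinv : ∀ ε : Fin N → ℤˣ, ∫ x, M (signFlip ε x) ∂P = ∫ x, M x ∂P := fun ε => by
    have h := measurePreserving_signFlip ε
    conv_rhs => rw [hP, ← h.map_eq]
    rw [integral_map h.aemeasurable
      (measurable_overlapExpMoment b _ ℓ).aestronglyMeasurable]
  have hZ : ∀ x, ∑ ε : Fin N → ℤˣ, M (signFlip ε x) ≤ 2 ^ N * 2 := fun x => by
    simp only [hM, overlapExpMoment_signFlip]
    rw [← gibbsAvg_sum]
    refine gibbsAvg_le _ fun q => ?_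
    have e : ∑ ε : Fin N → ℤˣ,
        Real.exp (ℓ * (∑ i, ((ε i : ℤ) : ℝ) * (((q.1 * q.2) i : ℤ) : ℝ)) ^ 2) =
        ∑ ε : Fin N → ℤˣ, Real.exp (ℓ * (∑ i, ((ε i : ℤ) : ℝ)) ^ 2) := by
      refine Fintype.sum_equiv (Equiv.mulRight (q.1 * q.2)) _ _ fun ε => ?_
      simp only [Equiv.coe_mulRight, Pi.mul_apply, Units.val_mul, Int.cast_mul]
    rw [e]
    -- With ceiling `1/(4N)` the coefficient may grow by `2 N (1/(4N))² = 1/(8N)`, and the total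
    -- factor is `e^{1/4} ≤ 2`.
    refine (sum_exp_sq_sum_le N ℓ (1 / (4 * N)) hℓ ?_).trans ?_
    · have : 2 * (N : ℝ) * (1 / (4 * N)) ^ 2 = 1 / (8 * N) := by field_simp; norm_num
      rw [this]
      have : 1 / (4 * (N : ℝ)) = 1 / (8 * N) + 1 / (8 * N) := by field_simp; norm_num
      linarith
    · have : (N : ℝ) * (1 / (4 * N)) = 1 / 4 := by field_simp
      rw [this]
      gcongr
      have h := Real.exp_bound' (x := 1 / 4) (by norm_num) (by norm_num) (n := 1) (by norm_num)
      norm_num at h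
      norm_num
      linarith
  have hint : ∀ ε : Fin N → ℤˣ, Integrable (fun x => M (signFlip ε x)) P := fun ε =>
    (measurePreserving_signFlip ε).integrable_comp_of_integrable (integrable_overlapExpMoment ℓ P)
  have hsum : ∫ x, ∑ ε : Fin N → ℤˣ, M (signFlip ε x) ∂P = 2 ^ N * ∫ x, M x ∂P := by
    rw [integral_finsetSum _ fun ε _ => hint ε]
    simp [hinv]
  have hle : ∫ x, ∑ ε : Fin N → ℤˣ, M (signFlip ε x) ∂P ≤ ∫ _, 2 ^ N * 2 ∂P :=
    integral_mono (integrable_finsetSum _ fun ε _ => hint ε) (integrable_const _) hZ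
  rw [hsum] at hle
  simp only [integral_const, probReal_univ, one_smul] at hle
  exact le_of_mul_le_mul_left hle (by positivity)

end Rademacher

/-! ### Overlap and free energy covariance for weakly correlated disorder. -/

section WeakCorrelation

variable {N : ℕ} {μ μ' : Measure (ℝ × ℝ)} {w m β : ℝ}

lemma sq_mul_cube_div_sqrt (hN : 1 ≤ N) (β : ℝ) :
    (N : ℝ) ^ 2 * (β / √(N : ℝ)) ^ 3 = β ^ 3 * √(N : ℝ) := by
  have hNpos : (0 : ℝ) < N := by exact_mod_cast hN
  have h0 : √(N : ℝ) ≠ 0 := (Real.sqrt_pos.2 hNpos).ne'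
  calc (N : ℝ) ^ 2 * (β / √(N : ℝ)) ^ 3
      = (√(N : ℝ) ^ 2) ^ 2 * (β / √(N : ℝ)) ^ 3 := by rw [Real.sq_sqrt hNpos.le]
    _ = β ^ 3 * √(N : ℝ) := by field_simp

lemma PairMoments.one_le (h : PairMoments μ w m) : 1 ≤ m := by
  have := h.isProbabilityMeasure
  have h1 : ∫ p, p.1 ^ 2 ∂μ ≤ ∫ p, (1 / 3 + 2 / 3 * |p.1| ^ 3) ∂μ :=
    integral_mono h.integrable_sq_fst ((integrable_const _).fun_add (h.integrable_fst.const_mul _))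
      fun p => by
        simp only [← sq_abs p.1]
        nlinarith [mul_nonneg (abs_nonneg p.1) (sq_nonneg (|p.1| - 1)), sq_nonneg (|p.1| - 1),
          abs_nonneg p.1]
  rw [h.sq_fst, integral_add (integrable_const _) (h.integrable_fst.const_mul _),
    integral_const_mul] at h1
  simp only [integral_const, probReal_univ, one_smul] at h1
  linarith [h.third_fst]

lemma PairMoments.integral_pairOverlap_le (h : PairMoments μ w m) (hN : 1 ≤ N) (hβ : 0 ≤ β)
    (hw : 0 ≤ w) (hβw : β ^ 2 * w ≤ 1 / 16) :
    ∫ x, pairOverlap (β / √(N : ℝ)) (spinPair (N := N)) x ∂(Measure.pi fun _ => μ) ≤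
      16 * N * ((3000 * β ^ 3 + 50) * (m + 1) * √(N : ℝ)) := by
  have hNpos : (0 : ℝ) < N := by exact_mod_cast hN
  have hN1 : (1 : ℝ) ≤ N := by exact_mod_cast hN
  set b := β / √(N : ℝ) with hb
  have hb0 : 0 ≤ b := by positivity
  have hb2 : b ^ 2 = β ^ 2 / N := by rw [hb, div_pow, Real.sq_sqrt hNpos.le]
  have hbw : b ^ 2 * w ≤ 1 / (16 * N) := by
    rw [hb2, div_mul_eq_mul_div, div_le_div_iff₀ hNpos (by positivity)]
    nlinarith
  -- Taking `ℓ = 1/(16N)` and using `b² w ≤ 1/(16N)` keeps `ℓ'` below the threshold `1/(8N)` for the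
  -- exponential moment. The errors sum to `O(√N)`, and dividing by `ℓ` gives an overlap of order
  -- `N^{3/2}`.
  set ℓ' := 1 / (16 * (N : ℝ)) + b ^ 2 * w with hℓ'
  have hbw0 : 0 ≤ b ^ 2 * w := by positivity
  have hℓ'0 : 0 ≤ ℓ' := by positivity
  have hℓ'N : ℓ' ≤ 1 / (8 * N) := by
    have : 1 / (8 * (N : ℝ)) = 1 / (16 * N) + 1 / (16 * N) := by field_simp; norm_num
    linarith
  have h8 : 1 / (8 * (N : ℝ)) ≤ 1 := by
    rw [div_le_one (by positivity)]; linarith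
  have key := h.mul_integral_pairOverlap_le (pairMoments_signPairLaw h.one_le) hw hb0 spinPair_sq
    sum_spinPair_mul_nonneg (ℓ := 1 / (16 * (N : ℝ))) (by positivity) hℓ' (hℓ'N.trans h8)
    (integral_overlapExpMoment_le b hℓ'0 hN hℓ'N)
  have hcard : (Fintype.card (Fin N × Fin N) : ℝ) = N ^ 2 := by
    simp [Fintype.card_prod, sq]
  rw [hcard] at key
  have e1 := sq_mul_cube_div_sqrt hN β
  rw [← hb] at e1
  have e2 : (N : ℝ) ^ 2 * ℓ' ^ 2 ≤ 1 / 64 := by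
    calc (N : ℝ) ^ 2 * ℓ' ^ 2 ≤ N ^ 2 * (1 / (8 * N)) ^ 2 := by gcongr
      _ = 1 / 64 := by field_simp; norm_num
  have hm := h.one_le
  have hs : 1 ≤ √(N : ℝ) := Real.one_le_sqrt.2 hN1
  set R := ∫ x, pairOverlap b (spinPair (N := N)) x ∂(Measure.pi fun _ => μ)
  have e3 : 1 / (16 * (N : ℝ)) * R ≤ (3000 * β ^ 3 + 50) * (m + 1) * √(N : ℝ) := by
    refine key.trans ?_
    have e4 : (N : ℝ) ^ 2 * (3000 * (b ^ 3 * (m + 1) + ℓ' ^ 2)) =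
        3000 * (((N : ℝ) ^ 2 * b ^ 3) * (m + 1)) + 3000 * ((N : ℝ) ^ 2 * ℓ' ^ 2) := by ring
    rw [e4, e1]
    nlinarith [mul_le_mul (by linarith : (1 : ℝ) ≤ m + 1) hs (by norm_num) (by linarith)]
  have e5 : R = 16 * N * (1 / (16 * (N : ℝ)) * R) := by field_simp
  rw [e5]
  gcongr

/-- The covariance of the free energies of two weakly correlated systems is of order `√N`. -/
theorem PairMoments.integral_pairLog_sub_le_sqrt (h : PairMoments μ w m)
    (h' : PairMoments μ' 0 m) (hm₁ : μ.map Prod.fst = μ'.map Prod.fst)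
    (hm₂ : μ.map Prod.snd = μ'.map Prod.snd) (hN : 1 ≤ N) (hβ : 0 ≤ β) (hw : 0 ≤ w)
    (hβw : β ^ 2 * w ≤ 1 / 16) :
    ∫ x, pairLog (β / √(N : ℝ)) (spinPair (N := N)) x ∂(Measure.pi fun _ => μ) -
      ∫ x, pairLog (β / √(N : ℝ)) (spinPair (N := N)) x ∂(Measure.pi fun _ => μ') ≤
        (4000 * β ^ 3 + 50) * (m + 1) * √(N : ℝ) := by
  have hNpos : (0 : ℝ) < N := by exact_mod_cast hN
  have hb0 : 0 ≤ β / √(N : ℝ) := by positivity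
  have hm := h.nonneg
  refine (h.integral_pairLog_sub_le (R := 16 * N * ((3000 * β ^ 3 + 50) * (m + 1) * √(N : ℝ)))
    h' hm₁ hm₂ hw hb0 abs_spinPair_le fun p hp => ?_).trans ?_
  · have hp0 : 0 ≤ p := hp.1.le
    -- Mixing with uncorrelated entries only lowers the covariance, so the overlap bound holds
    -- uniformly along the interpolation.
    have hpw : p * w + (1 - p) * 0 ≤ w := by nlinarith [hp.2]
    exact (PairMoments.mixture hp.1.le hp.2.le h h').integral_pairOverlap_le hN hβ (by
      rw [mul_zero, add_zero]; positivity)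
      ((mul_le_mul_of_nonneg_left hpw (sq_nonneg β)).trans hβw)
  · have e1 := sq_mul_cube_div_sqrt hN β
    have hcard : (Fintype.card (Fin N × Fin N) : ℝ) = N ^ 2 := by
      simp [Fintype.card_prod, sq]
    have hb2 : (β / √(N : ℝ)) ^ 2 * w * (16 * N) = 16 * (β ^ 2 * w) := by
      rw [div_pow, Real.sq_sqrt hNpos.le]; field_simp
    rw [hcard]
    calc _ = ((β / √(N : ℝ)) ^ 2 * w * (16 * N)) * ((3000 * β ^ 3 + 50) * (m + 1) * √(N : ℝ)) +
          48 * ((N : ℝ) ^ 2 * (β / √(N : ℝ)) ^ 3) * (m + 1) := by ring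
      _ ≤ 1 * ((3000 * β ^ 3 + 50) * (m + 1) * √(N : ℝ)) + 48 * (β ^ 3 * √(N : ℝ)) * (m + 1) := by
          rw [hb2, e1]
          gcongr
          linarith
      _ ≤ _ := by
          have : 0 ≤ β ^ 3 * (m + 1) * √(N : ℝ) := by positivity
          nlinarith

end WeakCorrelation

/-! ### Cauchy–Schwarz and conditionally independent copies. -/

section CauchySchwarz

variable {α α' : Type*} [MeasurableSpace α] [MeasurableSpace α'] {P : Measure α} {Q : Measure α'}

/-- The Cauchy–Schwarz inequality. -/
lemma sq_integral_mul_le {f g : α → ℝ} (hf : MemLp f 2 P) (hg : MemLp g 2 P) :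
    (∫ x, f x * g x ∂P) ^ 2 ≤ (∫ x, f x ^ 2 ∂P) * ∫ x, g x ^ 2 ∂P := by
  have hfg : Integrable (fun x => f x * g x) P := hf.integrable_mul hg
  have h : ∀ s : ℝ, 0 ≤ (∫ x, f x ^ 2 ∂P) * (s * s) + (2 * ∫ x, f x * g x ∂P) * s +
      ∫ x, g x ^ 2 ∂P := fun s => by
    have e : ∫ x, (s * f x + g x) ^ 2 ∂P = (∫ x, f x ^ 2 ∂P) * (s * s) +
        (2 * ∫ x, f x * g x ∂P) * s + ∫ x, g x ^ 2 ∂P := by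
      have e1 : ∀ x, (s * f x + g x) ^ 2 = s * s * f x ^ 2 + 2 * s * (f x * g x) + g x ^ 2 :=
        fun x => by ring
      simp only [e1]
      rw [integral_add ((hf.integrable_sq.const_mul _).fun_add (hfg.const_mul _)) hg.integrable_sq,
        integral_add (hf.integrable_sq.const_mul _) (hfg.const_mul _), integral_const_mul,
        integral_const_mul]
      ring
    rw [← e]
    exact integral_nonneg fun x => sq_nonneg _
  have := discrim_le_zero h
  rw [discrim] at this
  nlinarith

variable [IsProbabilityMeasure P] [IsProbabilityMeasure Q]

lemma measurePreserving_fst_snd_fst :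
    MeasurePreserving (fun p : α × α' × α' => (p.1, p.2.1)) (P.prod (Q.prod Q)) (P.prod Q) :=
  (MeasurePreserving.id P).prod measurePreserving_fst

lemma measurePreserving_fst_snd_snd :
    MeasurePreserving (fun p : α × α' × α' => (p.1, p.2.2)) (P.prod (Q.prod Q)) (P.prod Q) :=
  (MeasurePreserving.id P).prod measurePreserving_snd

lemma integrable_mul_fibers {K : α × α' → ℝ} (hK : MemLp K 2 (P.prod Q)) :
    Integrable (fun p : α × α' × α' => K (p.1, p.2.1) * K (p.1, p.2.2)) (P.prod (Q.prod Q)) :=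
  (hK.comp_measurePreserving measurePreserving_fst_snd_fst).integrable_mul
    (hK.comp_measurePreserving measurePreserving_fst_snd_snd)

lemma integral_mul_fibers {K : α × α' → ℝ} (hK : MemLp K 2 (P.prod Q)) :
    ∫ p : α × α' × α', K (p.1, p.2.1) * K (p.1, p.2.2) ∂(P.prod (Q.prod Q)) =
      ∫ x, (∫ y, K (x, y) ∂Q) ^ 2 ∂P := by
  rw [integral_prod _ (integrable_mul_fibers hK)]
  refine integral_congr_ae (.of_forall fun x => ?_)
  simp only
  rw [integral_prod_mul (fun y => K (x, y)) fun y => K (x, y), sq]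

lemma memLp_integral_fiber {K : α × α' → ℝ} (hKm : Measurable K) (hK : MemLp K 2 (P.prod Q)) :
    MemLp (fun x => ∫ y, K (x, y) ∂Q) 2 P := by
  have hm : StronglyMeasurable fun x => ∫ y, K (x, y) ∂Q :=
    hKm.stronglyMeasurable.integral_prod_right'
  refine (memLp_two_iff_integrable_sq hm.aestronglyMeasurable).2 ?_
  refine (integrable_mul_fibers hK).integral_prod_left.congr (.of_forall fun x => ?_)
  simp only
  rw [integral_prod_mul (fun y => K (x, y)) fun y => K (x, y), sq]

/-- Two copies of `K (x, y)` with a common first argument `x` dominate the correlation of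
`K (x, y)` with a function of `x`. -/
lemma sq_integral_mul_fiber_le {H : α → ℝ} {K : α × α' → ℝ} (hHm : Measurable H)
    (hH : MemLp H 2 P) (hKm : Measurable K) (hK : MemLp K 2 (P.prod Q)) :
    (∫ p : α × α' × α', H p.1 * K (p.1, p.2.1) ∂(P.prod (Q.prod Q))) ^ 2 ≤
      (∫ p : α × α' × α', K (p.1, p.2.1) * K (p.1, p.2.2) ∂(P.prod (Q.prod Q))) *
        ∫ x, H x ^ 2 ∂P := by
  have hH' : MemLp (fun z : α × α' => H z.1) 2 (P.prod Q) :=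
    hH.comp_measurePreserving measurePreserving_fst
  have e1 : ∫ p : α × α' × α', H p.1 * K (p.1, p.2.1) ∂(P.prod (Q.prod Q)) =
      ∫ x, (∫ y, K (x, y) ∂Q) * H x ∂P := by
    have h1 : Integrable (fun z : α × α' => H z.1 * K z) (P.prod Q) := hH'.integrable_mul hK
    rw [← integral_map (φ := fun p : α × α' × α' => (p.1, p.2.1)) (f := fun z => H z.1 * K z)
      (by fun_prop) (by fun_prop), measurePreserving_fst_snd_fst.map_eq, integral_prod _ h1]
    refine integral_congr_ae (.of_forall fun x => ?_)
    simp only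
    rw [integral_const_mul, mul_comm]
  rw [e1, integral_mul_fibers hK]
  exact sq_integral_mul_le (memLp_integral_fiber hKm hK) hH

end CauchySchwarz

/-! ### Correlated Gaussian pairs. -/

/-- The law of three independent standard Gaussian variables. -/
noncomputable abbrev gaussTriple : Measure (ℝ × ℝ × ℝ) :=
  (gaussianReal 0 1).prod ((gaussianReal 0 1).prod (gaussianReal 0 1))

/-- The law of `(√t g + √(1-t) g¹, √t g + √(1-t) g²)` with independent standard Gaussian
variables `g, g¹, g²`. -/
noncomputable def gaussPair (t : ℝ) : Measure (ℝ × ℝ) :=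
  gaussTriple.map fun p => (√t * p.1 + √(1 - t) * p.2.1, √t * p.1 + √(1 - t) * p.2.2)

instance (t : ℝ) : IsProbabilityMeasure (gaussPair t) :=
  Measure.isProbabilityMeasure_map (by fun_prop)

lemma charFunDual_stdGaussianReal (L : StrongDual ℝ ℝ) :
    charFunDual (gaussianReal 0 1) L = Complex.exp (((-(L 1) ^ 2 / 2 : ℝ)) : ℂ) := by
  have h : ∀ x, L x = L 1 * x := fun x => by
    conv_lhs => rw [← mul_one x, ← smul_eq_mul, map_smul, smul_eq_mul, mul_comm]
  have h1 := charFun_gaussianReal (μ := 0) (v := 1) (L 1)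
  rw [charFun_apply_real] at h1
  have h2 : ∀ x : ℝ, Complex.exp (L x * Complex.I) = Complex.exp ((L 1 : ℝ) * x * Complex.I) :=
    fun x => by rw [h x, Complex.ofReal_mul]
  rw [charFunDual_apply, integral_congr_ae (.of_forall h2), h1]
  congr 1
  push_cast
  simp
  ring

lemma dual_prod_apply (L : StrongDual ℝ (ℝ × ℝ)) (x y : ℝ) :
    L (x, y) = x * L (1, 0) + y * L (0, 1) := by
  have : (x, y) = x • ((1, 0) : ℝ × ℝ) + y • ((0, 1) : ℝ × ℝ) := by simp
  rw [this, map_add, map_smul, map_smul, smul_eq_mul, smul_eq_mul]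

/-- The characteristic function of two linear forms depends only on their covariance matrix; this is
what identifies different constructions of the same Gaussian pair. -/
lemma charFunDual_gaussTriple_map (a b : ℝ × ℝ × ℝ) (L : StrongDual ℝ (ℝ × ℝ)) :
    charFunDual (gaussTriple.map fun p => (a.1 * p.1 + a.2.1 * p.2.1 + a.2.2 * p.2.2,
      b.1 * p.1 + b.2.1 * p.2.1 + b.2.2 * p.2.2)) L =
    Complex.exp (((-((a.1 ^ 2 + a.2.1 ^ 2 + a.2.2 ^ 2) * L (1, 0) ^ 2 +
      (b.1 ^ 2 + b.2.1 ^ 2 + b.2.2 ^ 2) * L (0, 1) ^ 2 +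
      2 * (a.1 * b.1 + a.2.1 * b.2.1 + a.2.2 * b.2.2) * (L (1, 0) * L (0, 1))) / 2 : ℝ)) : ℂ) := by
  let T : (ℝ × ℝ × ℝ) →L[ℝ] (ℝ × ℝ) := LinearMap.toContinuousLinearMap
    { toFun := fun p => (a.1 * p.1 + a.2.1 * p.2.1 + a.2.2 * p.2.2,
        b.1 * p.1 + b.2.1 * p.2.1 + b.2.2 * p.2.2)
      map_add' := fun p q => by ext <;> simp <;> ring
      map_smul' := fun c p => by ext <;> simp <;> ring }
  have hT : ∀ p, T p = (a.1 * p.1 + a.2.1 * p.2.1 + a.2.2 * p.2.2,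
        b.1 * p.1 + b.2.1 * p.2.1 + b.2.2 * p.2.2) := fun p => rfl
  have e : (fun p : ℝ × ℝ × ℝ => (a.1 * p.1 + a.2.1 * p.2.1 + a.2.2 * p.2.2,
      b.1 * p.1 + b.2.1 * p.2.1 + b.2.2 * p.2.2)) = T := rfl
  rw [e, charFunDual_map, charFunDual_prod, charFunDual_prod, charFunDual_stdGaussianReal,
    charFunDual_stdGaussianReal, charFunDual_stdGaussianReal, ← Complex.exp_add, ← Complex.exp_add,
    ← Complex.ofReal_add, ← Complex.ofReal_add]
  congr 2
  simp only [ContinuousLinearMap.comp_apply, ContinuousLinearMap.inl_apply,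
    ContinuousLinearMap.inr_apply, hT]
  simp only [mul_one, mul_zero, add_zero, zero_add, Prod.fst_zero, Prod.snd_zero]
  rw [dual_prod_apply L a.1, dual_prod_apply L a.2.1, dual_prod_apply L a.2.2]
  ring

lemma charFunDual_gaussPair {t : ℝ} (ht : 0 ≤ t) (ht1 : t ≤ 1) (L : StrongDual ℝ (ℝ × ℝ)) :
    charFunDual (gaussPair t) L = Complex.exp (((-(L (1, 0) ^ 2 + L (0, 1) ^ 2 +
      2 * t * (L (1, 0) * L (0, 1))) / 2 : ℝ)) : ℂ) := by
  have h := charFunDual_gaussTriple_map (√t, √(1 - t), 0) (√t, 0, √(1 - t)) L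
  simp only [zero_mul, add_zero, Real.sq_sqrt ht, Real.sq_sqrt (sub_nonneg.2 ht1), mul_zero,
    Real.mul_self_sqrt ht] at h
  rw [gaussPair, h]
  congr 3
  ring

/-- A Gaussian variable correlated with another one may be written as a linear combination of it
and an independent one. -/
lemma gaussTriple_map_regression {t : ℝ} (ht : 0 ≤ t) (ht1 : t ≤ 1) :
    gaussTriple.map (fun p => (p.1, t * p.1 + √(1 - t ^ 2) * p.2.1)) = gaussPair t := by
  have : IsProbabilityMeasure
      (gaussTriple.map fun p => (p.1, t * p.1 + √(1 - t ^ 2) * p.2.1)) :=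
    Measure.isProbabilityMeasure_map (by fun_prop)
  refine Measure.ext_of_charFunDual (funext fun L => ?_)
  have h := charFunDual_gaussTriple_map (1, 0, 0) (t, √(1 - t ^ 2), 0) L
  have h2 : 0 ≤ 1 - t ^ 2 := by nlinarith
  simp only [one_mul, zero_mul, add_zero, Real.sq_sqrt h2] at h
  rw [charFunDual_gaussPair ht ht1, h]
  congr 3
  ring

lemma gaussPair_sq {t : ℝ} (ht : 0 ≤ t) :
    gaussPair (t ^ 2) = gaussTriple.map fun p =>
      (t * p.1 + √(1 - t ^ 2) * p.2.1, t * p.1 + √(1 - t ^ 2) * p.2.2) := by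
  rw [gaussPair, Real.sqrt_sq ht]

lemma gaussPair_zero : gaussPair 0 = (gaussianReal 0 1).prod (gaussianReal 0 1) := by
  have : (fun p : ℝ × ℝ × ℝ => (√0 * p.1 + √(1 - 0) * p.2.1, √0 * p.1 + √(1 - 0) * p.2.2)) =
      Prod.snd := by
    ext p <;> simp
  rw [gaussPair, this]
  exact measurePreserving_snd.map_eq

lemma gaussPair_one : gaussPair 1 = (gaussianReal 0 1).map fun x => (x, x) := by
  have : (fun p : ℝ × ℝ × ℝ => (√1 * p.1 + √(1 - 1) * p.2.1, √1 * p.1 + √(1 - 1) * p.2.2)) =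
      (fun x => (x, x)) ∘ Prod.fst := by
    ext p <;> simp
  rw [gaussPair, this, ← Measure.map_map (by fun_prop) measurable_fst,
    measurePreserving_fst.map_eq]

lemma gaussPair_map_fst {t : ℝ} (ht : 0 ≤ t) (ht1 : t ≤ 1) :
    (gaussPair t).map Prod.fst = gaussianReal 0 1 := by
  rw [← gaussTriple_map_regression ht ht1, Measure.map_map measurable_fst (by fun_prop)]
  exact measurePreserving_fst.map_eq

lemma gaussPair_map_swap (t : ℝ) : (gaussPair t).map Prod.swap = gaussPair t := by
  have hs : gaussTriple.map (fun p => (p.1, p.2.swap)) = gaussTriple :=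
    ((MeasurePreserving.id _).prod Measure.measurePreserving_swap).map_eq
  conv_rhs => rw [gaussPair, ← hs]
  rw [gaussPair, Measure.map_map measurable_swap (by fun_prop),
    Measure.map_map (by fun_prop) (by fun_prop)]
  rfl

lemma gaussPair_map_snd {t : ℝ} (ht : 0 ≤ t) (ht1 : t ≤ 1) :
    (gaussPair t).map Prod.snd = gaussianReal 0 1 := by
  rw [← gaussPair_map_swap, Measure.map_map measurable_snd measurable_swap]
  exact gaussPair_map_fst ht ht1

/-- Two normalized linear forms in independent standard Gaussian variables. -/
lemma pi_gaussianReal_map_pair {κ : Type*} [Fintype κ] {a b : κ → ℝ} {t : ℝ} (ht : 0 ≤ t)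
    (ht1 : t ≤ 1) (ha : ∑ i, a i ^ 2 = 1) (hb : ∑ i, b i ^ 2 = 1) (hab : ∑ i, a i * b i = t) :
    (Measure.pi fun _ : κ => gaussianReal 0 1).map (fun x => (∑ i, a i * x i, ∑ i, b i * x i)) =
      gaussPair t := by
  classical
  have : IsProbabilityMeasure ((Measure.pi fun _ : κ => gaussianReal 0 1).map
      (fun x => (∑ i, a i * x i, ∑ i, b i * x i))) :=
    Measure.isProbabilityMeasure_map (by fun_prop)
  refine Measure.ext_of_charFunDual (funext fun L => ?_)
  let T : (κ → ℝ) →L[ℝ] (ℝ × ℝ) := LinearMap.toContinuousLinearMap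
    { toFun := fun x => (∑ i, a i * x i, ∑ i, b i * x i)
      map_add' := fun p q => by ext <;> simp [mul_add, Finset.sum_add_distrib]
      map_smul' := fun c p => by ext <;> simp [Finset.mul_sum, mul_left_comm] }
  have hT : ∀ i, T (Pi.single i 1) = (a i, b i) := fun i => by
    change (∑ j, a j * (Pi.single i 1 : κ → ℝ) j, ∑ j, b j * (Pi.single i 1 : κ → ℝ) j) = _
    simp [Pi.single_apply]
  change charFunDual (Measure.map T _) L = _
  rw [charFunDual_map, charFunDual_pi, charFunDual_gaussPair ht ht1]
  simp only [charFunDual_stdGaussianReal, ContinuousLinearMap.comp_apply,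
    ContinuousLinearMap.single_apply, hT]
  rw [← Complex.exp_sum, ← Complex.ofReal_sum]
  congr 2
  have e : ∀ i, -(L (a i, b i)) ^ 2 / 2 = -(a i ^ 2 * L (1, 0) ^ 2 + b i ^ 2 * L (0, 1) ^ 2 +
      a i * b i * (2 * (L (1, 0) * L (0, 1)))) / 2 := fun i => by
    rw [dual_prod_apply]; ring
  simp only [e]
  rw [← Finset.sum_div, Finset.sum_neg_distrib, Finset.sum_add_distrib, Finset.sum_add_distrib,
    ← Finset.sum_mul, ← Finset.sum_mul, ← Finset.sum_mul, ha, hb, hab]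
  ring

/-- The law of `(f U, f V)` for standard Gaussian variables `U` and `V` with covariance `t`. -/
noncomputable def disorderPair (f : ℝ → ℝ) (t : ℝ) : Measure (ℝ × ℝ) :=
  (gaussPair t).map (Prod.map f f)

/-! ### Correlated disorder entries and the correlation function `w`. -/

section DisorderPair

variable {f : ℝ → ℝ} {ν : Measure ℝ} {t : ℝ}

lemma IsNormalizedDisorder.memLp_id (hν : IsNormalizedDisorder ν) :
    MemLp (fun x : ℝ => x) 2 ν := by
  have := hν.isProbabilityMeasure
  refine (memLp_two_iff_integrable_sq (f := fun x : ℝ => x) (by fun_prop)).2 ?_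
  by_contra h
  have := integral_undef h
  rw [hν.second_moment_eq_one] at this
  exact one_ne_zero this

lemma IsNormalizedDisorder.memLp_comp (hν : IsNormalizedDisorder ν) (hf : Measurable f)
    (hfν : (gaussianReal 0 1).map f = ν) : MemLp f 2 (gaussianReal 0 1) := by
  have h := hν.memLp_id
  rw [← hfν] at h
  exact h.comp_of_map hf.aemeasurable

lemma isProbabilityMeasure_disorderPair (hf : Measurable f) (t : ℝ) :
    IsProbabilityMeasure (disorderPair f t) :=
  Measure.isProbabilityMeasure_map (by fun_prop)

lemma disorderPair_map_fst (hf : Measurable f) (hfν : (gaussianReal 0 1).map f = ν) (ht : 0 ≤ t)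
    (ht1 : t ≤ 1) : (disorderPair f t).map Prod.fst = ν := by
  rw [← hfν, ← gaussPair_map_fst ht ht1, disorderPair, Measure.map_map hf measurable_fst,
    Measure.map_map measurable_fst (by fun_prop)]
  rfl

lemma disorderPair_map_swap (hf : Measurable f) (t : ℝ) :
    (disorderPair f t).map Prod.swap = disorderPair f t := by
  conv_rhs => rw [disorderPair, ← gaussPair_map_swap]
  rw [disorderPair, Measure.map_map measurable_swap (by fun_prop),
    Measure.map_map (by fun_prop) measurable_swap]
  rfl

lemma disorderPair_map_snd (hf : Measurable f) (hfν : (gaussianReal 0 1).map f = ν) (ht : 0 ≤ t)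
    (ht1 : t ≤ 1) : (disorderPair f t).map Prod.snd = ν := by
  rw [← disorderPair_map_swap hf, Measure.map_map measurable_snd measurable_swap]
  exact disorderPair_map_fst hf hfν ht ht1

lemma disorderPair_zero (hf : Measurable f) (hfν : (gaussianReal 0 1).map f = ν) :
    disorderPair f 0 = ν.prod ν := by
  rw [disorderPair, gaussPair_zero, ← hfν, Measure.map_prod_map _ _ hf hf]

lemma disorderPair_one (hf : Measurable f) (hfν : (gaussianReal 0 1).map f = ν) :
    disorderPair f 1 = ν.map fun x => (x, x) := by
  rw [disorderPair, gaussPair_one, ← hfν, Measure.map_map (by fun_prop) (by fun_prop),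
    Measure.map_map (by fun_prop) hf]
  rfl

lemma integral_disorderPair_mul (hf : Measurable f) (t : ℝ) :
    ∫ p, p.1 * p.2 ∂(disorderPair f t) = gaussCorrelation f t := by
  rw [disorderPair, integral_map (by fun_prop) (by fun_prop), gaussPair,
    integral_map (by fun_prop) (by fun_prop)]
  rfl

lemma pairMoments_disorderPair (hν : IsNormalizedDisorder ν) (hf : Measurable f)
    (hfν : (gaussianReal 0 1).map f = ν) (ht : 0 ≤ t) (ht1 : t ≤ 1) :
    PairMoments (disorderPair f t) (gaussCorrelation f t) (∫ x, |x| ^ 3 ∂ν) := by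
  have e₁ : ∀ g : ℝ → ℝ, Measurable g → ∫ p, g p.1 ∂(disorderPair f t) = ∫ x, g x ∂ν :=
    fun g hg => by
      rw [← disorderPair_map_fst hf hfν ht ht1,
        integral_map (by fun_prop) hg.aestronglyMeasurable]
  have e₂ : ∀ g : ℝ → ℝ, Measurable g → ∫ p, g p.2 ∂(disorderPair f t) = ∫ x, g x ∂ν :=
    fun g hg => by
      rw [← disorderPair_map_snd hf hfν ht ht1,
        integral_map (by fun_prop) hg.aestronglyMeasurable]
  refine ⟨isProbabilityMeasure_disorderPair hf t, ?_, ?_, ?_, ?_, ?_, ?_,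
    integral_disorderPair_mul hf t, ?_, ?_⟩
  · have h := hν.integrable_third_moment
    rw [← disorderPair_map_fst hf hfν ht ht1] at h
    exact h.comp_measurable measurable_fst
  · have h := hν.integrable_third_moment
    rw [← disorderPair_map_snd hf hfν ht ht1] at h
    exact h.comp_measurable measurable_snd
  · rw [e₁ _ measurable_id', hν.mean_eq_zero]
  · rw [e₂ _ measurable_id', hν.mean_eq_zero]
  · rw [e₁ (fun x => x ^ 2) (by fun_prop), hν.second_moment_eq_one]
  · rw [e₂ (fun x => x ^ 2) (by fun_prop), hν.second_moment_eq_one]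
  · rw [e₁ (fun x => |x| ^ 3) (by fun_prop)]
  · rw [e₂ (fun x => |x| ^ 3) (by fun_prop)]

lemma gaussCorrelation_zero (hν : IsNormalizedDisorder ν) (hf : Measurable f)
    (hfν : (gaussianReal 0 1).map f = ν) : gaussCorrelation f 0 = 0 := by
  have := hν.isProbabilityMeasure
  rw [← integral_disorderPair_mul hf, disorderPair_zero hf hfν,
    integral_prod_mul (fun x => x) fun x => x, hν.mean_eq_zero, mul_zero]

lemma gaussCorrelation_le_one (hν : IsNormalizedDisorder ν) (hf : Measurable f)
    (hfν : (gaussianReal 0 1).map f = ν) (ht : 0 ≤ t) (ht1 : t ≤ 1) : gaussCorrelation f t ≤ 1 :=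
  (le_abs_self _).trans (pairMoments_disorderPair hν hf hfν ht ht1).integral_abs_mul_le

lemma measurePreserving_linearForm {s : ℝ} (hs : 0 ≤ s) (hs1 : s ≤ 1) :
    MeasurePreserving (fun z : ℝ × ℝ => s * z.1 + √(1 - s ^ 2) * z.2)
      ((gaussianReal 0 1).prod (gaussianReal 0 1)) (gaussianReal 0 1) := by
  refine ⟨by fun_prop, ?_⟩
  have h := gaussPair_map_snd hs hs1
  rw [← gaussTriple_map_regression hs hs1, Measure.map_map measurable_snd (by fun_prop)] at h
  rw [← (measurePreserving_fst_snd_fst (P := gaussianReal 0 1) (Q := gaussianReal 0 1)).map_eq,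
    Measure.map_map (by fun_prop) (by fun_prop)]
  exact h

/-- Given the shared variable `g` the two factors are independent copies, so the correlation is the
second moment of a conditional expectation. -/
lemma gaussCorrelation_nonneg (hν : IsNormalizedDisorder ν) (hf : Measurable f)
    (hfν : (gaussianReal 0 1).map f = ν) (ht : 0 ≤ t) (ht1 : t ≤ 1) :
    0 ≤ gaussCorrelation f t := by
  have hs : √t ^ 2 = t := Real.sq_sqrt ht
  have hK := (hν.memLp_comp hf hfν).comp_measurePreserving
    (measurePreserving_linearForm (Real.sqrt_nonneg t) (Real.sqrt_le_one.2 ht1))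
  have h := integral_mul_fibers hK
  simp only [Function.comp_apply, hs] at h
  rw [gaussCorrelation, h]
  exact integral_nonneg fun x => sq_nonneg _

/-- The correlation of `f U` and `f V` is at most `1 / √n` if `U` and `V` have correlation at
most `1 / √n`: the variable `V` may have this correlation with `n` independent copies of `U`. -/
lemma mul_gaussCorrelation_sq_le (hν : IsNormalizedDisorder ν) (hf : Measurable f)
    (hfν : (gaussianReal 0 1).map f = ν) (ht : 0 ≤ t) {n : ℕ} (hn : 1 ≤ n)
    (htn : n * t ^ 2 ≤ 1) : n * gaussCorrelation f t ^ 2 ≤ 1 := by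
  have hn' : (1 : ℝ) ≤ n := by exact_mod_cast hn
  have ht1 : t ≤ 1 := by
    by_contra! h
    nlinarith [mul_self_nonneg (t - 1)]
  set P := Measure.pi fun _ : Option (Fin n) => gaussianReal 0 1 with hP
  -- The coordinate `none` carries the residual noise that makes `Y` a standard Gaussian having
  -- correlation `t` with each of the other `n` coordinates.
  set b : Option (Fin n) → ℝ := fun o => o.elim √(1 - n * t ^ 2) fun _ => t with hb
  have hb1 : ∑ o, b o ^ 2 = 1 := by
    rw [Fintype.sum_option]
    simp only [hb, Option.elim_none, Option.elim_some, Real.sq_sqrt (sub_nonneg.2 htn)]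
    simp
  let Y : (Option (Fin n) → ℝ) → ℝ := fun x => ∑ o, b o * x o
  have hYm : Measurable Y := by fun_prop
  have hpair : ∀ i : Fin n, P.map (fun x => (x (some i), Y x)) = gaussPair t := fun i => by
    have h := pi_gaussianReal_map_pair (a := Pi.single (some i) (1 : ℝ)) (b := b) ht ht1
      (by simp [Pi.single_apply, ite_pow]) hb1 (by simp [Pi.single_apply, hb])
    have e : ∀ x : Option (Fin n) → ℝ,
        ∑ o, (Pi.single (some i) 1 : Option (Fin n) → ℝ) o * x o = x (some i) := fun x => by
      simp [Pi.single_apply]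
    simpa only [e] using h
  have hpair' : ∀ i j : Fin n, i ≠ j →
      P.map (fun x => (x (some i), x (some j))) = gaussPair 0 := fun i j hij => by
    have h := pi_gaussianReal_map_pair (a := Pi.single (some i) (1 : ℝ))
      (b := Pi.single (some j) (1 : ℝ)) (t := 0) le_rfl zero_le_one
      (by simp [Pi.single_apply, ite_pow]) (by simp [Pi.single_apply, ite_pow])
      (by simp [Pi.single_apply, Ne.symm hij])
    simpa [Pi.single_apply] using h
  have hX : ∀ i : Fin n, MeasurePreserving (fun x : Option (Fin n) → ℝ => x (some i)) P
      (gaussianReal 0 1) := fun i => measurePreserving_eval _ _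
  have hY : 1 ≤ n → MeasurePreserving Y P (gaussianReal 0 1) := fun h0 => by
    refine ⟨hYm, ?_⟩
    rw [← gaussPair_map_snd ht ht1, ← hpair ⟨0, h0⟩, Measure.map_map (by fun_prop) (by fun_prop)]
    rfl
  have hfL := hν.memLp_comp hf hfν
  have hfX : ∀ i : Fin n, MemLp (fun x : Option (Fin n) → ℝ => f (x (some i))) 2 P :=
    fun i => hfL.comp_measurePreserving (hX i)
  have hfY : MemLp (fun x => f (Y x)) 2 P := hfL.comp_measurePreserving (hY hn)
  have hXX : ∀ i j : Fin n,
      Integrable (fun x : Option (Fin n) → ℝ => f (x (some i)) * f (x (some j))) P :=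
    fun i j => (hfX i).integrable_mul (hfX j)
  have hXY : ∀ i : Fin n, Integrable (fun x : Option (Fin n) → ℝ => f (x (some i)) * f (Y x)) P :=
    fun i => (hfX i).integrable_mul hfY
  have hf2 : ∫ x, f x ^ 2 ∂(gaussianReal 0 1) = 1 := by
    rw [← hν.second_moment_eq_one, ← hfν, integral_map (by fun_prop) (by fun_prop)]
  have hfm : Measurable fun p : ℝ × ℝ => f p.1 * f p.2 := by fun_prop
  have hw : ∀ s : ℝ, ∫ p, f p.1 * f p.2 ∂(gaussPair s) = gaussCorrelation f s := fun s => by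
    rw [gaussPair, integral_map (by fun_prop) hfm.aestronglyMeasurable]
    rfl
  have e1 : ∫ x, (∑ i : Fin n, f (x (some i))) * f (Y x) ∂P = n * gaussCorrelation f t := by
    simp only [Finset.sum_mul]
    rw [integral_finsetSum _ fun i _ => hXY i]
    have : ∀ i : Fin n, ∫ x, f (x (some i)) * f (Y x) ∂P = gaussCorrelation f t := fun i => by
      rw [← hw, ← hpair i, integral_map (by fun_prop) hfm.aestronglyMeasurable]
    simp [this]
  have e2 : ∫ x, (∑ i : Fin n, f (x (some i))) ^ 2 ∂P = n := by
    simp only [sq, Finset.sum_mul_sum]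
    rw [integral_finsetSum _ fun i _ => integrable_finsetSum _ fun j _ => hXX i j]
    have : ∀ i j : Fin n, ∫ x, f (x (some i)) * f (x (some j)) ∂P = if i = j then 1 else 0 :=
      fun i j => by
        split_ifs with hij
        · subst hij
          rw [← hf2, ← (hX i).map_eq, integral_map (hX i).measurable.aemeasurable (by fun_prop)]
          simp only [sq]
        · rw [← gaussCorrelation_zero hν hf hfν, ← hw, ← hpair' i j hij,
            integral_map (by fun_prop) hfm.aestronglyMeasurable]
    have h2 : ∀ i : Fin n, ∫ x, ∑ j : Fin n, f (x (some i)) * f (x (some j)) ∂P = 1 := fun i => by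
      rw [integral_finsetSum _ fun j _ => hXX i j]
      simp [this]
    simp [h2]
  have e3 : ∫ x, f (Y x) ^ 2 ∂P = 1 := by
    rw [← hf2, ← (hY hn).map_eq, integral_map (by fun_prop) (by fun_prop)]
  -- Bessel's inequality: the `f(X_i)` are orthonormal, so their sum has squared norm `n`, while its
  -- inner product with the unit vector `f(Y)` is `n w`.
  have key := sq_integral_mul_le (memLp_finsetSum Finset.univ fun i _ => hfX i) hfY
  rw [e1, e2, e3, mul_one, mul_pow] at key
  nlinarith

end DisorderPair

/-! ### Noise correlation of functions of Gaussian vectors. -/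

section Noise

variable {ι : Type*} [Fintype ι] {G : (ι → ℝ) → ℝ} {t : ℝ}

/-- The map splitting a family of triples into a triple of families. -/
def splitTriple (x : ι → ℝ × ℝ × ℝ) : (ι → ℝ) × (ι → ℝ) × (ι → ℝ) :=
  (fun k => (x k).1, fun k => (x k).2.1, fun k => (x k).2.2)

lemma measurePreserving_splitTriple :
    MeasurePreserving (splitTriple (ι := ι)) (Measure.pi fun _ => gaussTriple)
      ((Measure.pi fun _ => gaussianReal 0 1).prod ((Measure.pi fun _ => gaussianReal 0 1).prod
        (Measure.pi fun _ => gaussianReal 0 1))) :=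
  ((MeasurePreserving.id _).prod (measurePreserving_arrowProdEquivProdArrow ℝ ℝ ι
    (fun _ => gaussianReal 0 1) fun _ => gaussianReal 0 1)).comp
    (measurePreserving_arrowProdEquivProdArrow ℝ (ℝ × ℝ) ι (fun _ => gaussianReal 0 1)
      fun _ => (gaussianReal 0 1).prod (gaussianReal 0 1))

/-- The correlation of `G U` and `G V` for standard Gaussian vectors `U`, `V` whose coordinates
have correlation `t`. -/
noncomputable def noiseCorrelation (G : (ι → ℝ) → ℝ) (t : ℝ) : ℝ :=
  ∫ x : ι → ℝ × ℝ, G (fun k => (x k).1) * G (fun k => (x k).2) ∂(Measure.pi fun _ => gaussPair t)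

lemma noiseCorrelation_one (hG : Measurable G) :
    noiseCorrelation G 1 = ∫ x, G x ^ 2 ∂(Measure.pi fun _ => gaussianReal 0 1) := by
  have : IsProbabilityMeasure ((gaussianReal 0 1).map fun x => (x, x)) :=
    Measure.isProbabilityMeasure_map (by fun_prop)
  rw [noiseCorrelation, gaussPair_one, ← Measure.pi_map_pi (fun _ => by fun_prop),
    integral_map (by fun_prop) (by fun_prop)]
  simp only [sq]

/-- Write `V = t U + √(1 - t²) W`. Then the correlation at `t` is the inner product of `G(U)` with
the conditional expectation of `G(V)` given `U`. The squared norm of the latter is the correlation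
of two conditionally independent copies of `V`, whose coordinates have correlation `t²`. -/
lemma sq_noiseCorrelation_le (hGm : Measurable G)
    (hG : MemLp G 2 (Measure.pi fun _ => gaussianReal 0 1)) (ht : 0 ≤ t) (ht1 : t ≤ 1) :
    noiseCorrelation G t ^ 2 ≤ noiseCorrelation G (t ^ 2) * noiseCorrelation G 1 := by
  set s := √(1 - t ^ 2) with hs
  let K : (ι → ℝ) × (ι → ℝ) → ℝ := fun z => G fun k => t * z.1 k + s * z.2 k
  have hKm : Measurable K := by fun_prop
  have hK : MemLp K 2 ((Measure.pi fun _ => gaussianReal 0 1).prod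
      (Measure.pi fun _ => gaussianReal 0 1)) := by
    have h1 := measurePreserving_pi (ι := ι) (fun _ => (gaussianReal 0 1).prod (gaussianReal 0 1))
      (fun _ => gaussianReal 0 1) fun _ => measurePreserving_linearForm ht ht1
    exact hG.comp_measurePreserving (h1.comp (measurePreserving_arrowProdEquivProdArrow ℝ ℝ ι
      (fun _ => gaussianReal 0 1) fun _ => gaussianReal 0 1).symm)
  have hHm : Measurable fun p : (ι → ℝ) × (ι → ℝ) × (ι → ℝ) => G p.1 * K (p.1, p.2.1) := by
    fun_prop
  have hKKm : Measurable fun p : (ι → ℝ) × (ι → ℝ) × (ι → ℝ) =>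
      K (p.1, p.2.1) * K (p.1, p.2.2) := by fun_prop
  have hGG : Measurable fun x : ι → ℝ × ℝ => G (fun k => (x k).1) * G (fun k => (x k).2) := by
    fun_prop
  have e1 : noiseCorrelation G t = ∫ p : (ι → ℝ) × (ι → ℝ) × (ι → ℝ), G p.1 * K (p.1, p.2.1)
      ∂((Measure.pi fun _ => gaussianReal 0 1).prod ((Measure.pi fun _ => gaussianReal 0 1).prod
        (Measure.pi fun _ => gaussianReal 0 1))) := by
    have : IsProbabilityMeasure
        (gaussTriple.map (fun p => (p.1, t * p.1 + √(1 - t ^ 2) * p.2.1))) :=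
      Measure.isProbabilityMeasure_map (by fun_prop)
    rw [← measurePreserving_splitTriple.map_eq, integral_map
      measurePreserving_splitTriple.measurable.aemeasurable hHm.aestronglyMeasurable,
      noiseCorrelation, ← gaussTriple_map_regression ht ht1,
      ← Measure.pi_map_pi (fun _ => by fun_prop),
      integral_map (by fun_prop) hGG.aestronglyMeasurable]
    rfl
  have e2 : noiseCorrelation G (t ^ 2) = ∫ p : (ι → ℝ) × (ι → ℝ) × (ι → ℝ),
      K (p.1, p.2.1) * K (p.1, p.2.2)
      ∂((Measure.pi fun _ => gaussianReal 0 1).prod ((Measure.pi fun _ => gaussianReal 0 1).prod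
        (Measure.pi fun _ => gaussianReal 0 1))) := by
    have : IsProbabilityMeasure (gaussTriple.map fun p =>
        (t * p.1 + √(1 - t ^ 2) * p.2.1, t * p.1 + √(1 - t ^ 2) * p.2.2)) :=
      Measure.isProbabilityMeasure_map (by fun_prop)
    rw [← measurePreserving_splitTriple.map_eq, integral_map
      measurePreserving_splitTriple.measurable.aemeasurable hKKm.aestronglyMeasurable,
      noiseCorrelation, gaussPair_sq ht,
      ← Measure.pi_map_pi (fun _ => by fun_prop),
      integral_map (by fun_prop) hGG.aestronglyMeasurable]
    rfl
  rw [e1, e2, noiseCorrelation_one hGm]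
  exact sq_integral_mul_fiber_le hGm hG hKm hK

end Noise

/-! ### The centred free energy as a function of Gaussian variables. -/

section FreeEnergyCorrelation

variable {ι A : Type*} [Fintype ι] [Fintype A]

/-- The free energy as a function of the Gaussian variables generating the disorder, centered. -/
noncomputable def centeredLogPartition (b : ℝ) (χ : ι → A → ℝ) (f : ℝ → ℝ) (ν : Measure ℝ)
    (x : ι → ℝ) : ℝ :=
  logPartition b χ (fun k => f (x k)) - ∫ y, logPartition b χ y ∂(Measure.pi fun _ => ν)

variable {b t : ℝ} {χ : ι → A → ℝ} {f : ℝ → ℝ} {ν : Measure ℝ}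

lemma measurable_centeredLogPartition (hf : Measurable f) :
    Measurable (centeredLogPartition b χ f ν) :=
  ((measurable_logPartition b χ).comp (by fun_prop)).sub_const _

lemma pi_gaussianReal_map (hν : IsNormalizedDisorder ν) (hf : Measurable f)
    (hfν : (gaussianReal 0 1).map f = ν) :
    (Measure.pi fun _ : ι => gaussianReal 0 1).map (fun x k => f (x k)) =
      Measure.pi fun _ => ν := by
  have := hν.isProbabilityMeasure
  subst hfν
  exact Measure.pi_map_pi fun _ => hf.aemeasurable

lemma integral_pairLog_prod (hν : IsNormalizedDisorder ν) :
    ∫ x, pairLog b χ x ∂(Measure.pi fun _ => ν.prod ν) =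
      (∫ y, logPartition b χ y ∂(Measure.pi fun _ => ν)) ^ 2 := by
  have := hν.isProbabilityMeasure
  have hm := measurable_logPartition b χ
  rw [sq, ← integral_prod_mul, ← (measurePreserving_arrowProdEquivProdArrow ℝ ℝ ι
    (fun _ => ν) fun _ => ν).map_eq, integral_map (MeasurableEquiv.measurable _).aemeasurable
    (by fun_prop)]
  rfl

lemma noiseCorrelation_centeredLogPartition_one (hν : IsNormalizedDisorder ν) (hf : Measurable f)
    (hfν : (gaussianReal 0 1).map f = ν) :
    noiseCorrelation (centeredLogPartition b χ f ν) 1 =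
      variance (logPartition b χ) (Measure.pi fun _ => ν) := by
  have hm := measurable_logPartition b χ
  rw [noiseCorrelation_one (measurable_centeredLogPartition hf),
    variance_eq_integral hm.aemeasurable]
  set c := ∫ y, logPartition b χ y ∂(Measure.pi fun _ : ι => ν)
  rw [← pi_gaussianReal_map hν hf hfν, integral_map (by fun_prop : Measurable _).aemeasurable
    (by fun_prop)]
  rfl

variable [Nonempty A]

lemma IsNormalizedDisorder.memLp_logPartition (hν : IsNormalizedDisorder ν) (hb : 0 ≤ b)
    (hχ : ∀ k a, |χ k a| ≤ 1) : MemLp (logPartition b χ) 2 (Measure.pi fun _ => ν) := by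
  have := hν.isProbabilityMeasure
  refine _root_.memLp_logPartition hb hχ measurable_id fun k => ?_
  exact (measurePreserving_eval (fun _ : ι => ν) k).integrable_comp_of_integrable
    hν.memLp_id.integrable_sq

lemma memLp_centeredLogPartition (hν : IsNormalizedDisorder ν) (hf : Measurable f)
    (hfν : (gaussianReal 0 1).map f = ν) (hb : 0 ≤ b) (hχ : ∀ k a, |χ k a| ≤ 1) :
    MemLp (centeredLogPartition b χ f ν) 2 (Measure.pi fun _ => gaussianReal 0 1) := by
  have h := hν.memLp_logPartition (ι := ι) hb hχ
  rw [← pi_gaussianReal_map hν hf hfν] at h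
  exact (h.comp_of_map (by fun_prop : Measurable _).aemeasurable).sub (memLp_const _)

/-- The marginals do not depend on `t`, so centring subtracts the square of the mean, which is the
value of the uncentred product at `t = 0`, where the two arrays are independent. -/
lemma noiseCorrelation_centeredLogPartition (hν : IsNormalizedDisorder ν) (hf : Measurable f)
    (hfν : (gaussianReal 0 1).map f = ν) (hb : 0 ≤ b) (hχ : ∀ k a, |χ k a| ≤ 1) (ht : 0 ≤ t)
    (ht1 : t ≤ 1) :
    noiseCorrelation (centeredLogPartition b χ f ν) t =
      ∫ x, pairLog b χ x ∂(Measure.pi fun _ => disorderPair f t) -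
        ∫ x, pairLog b χ x ∂(Measure.pi fun _ => disorderPair f 0) := by
  have := hν.isProbabilityMeasure
  have := isProbabilityMeasure_disorderPair hf t
  have hm := measurable_logPartition b χ
  set c := ∫ y, logPartition b χ y ∂(Measure.pi fun _ : ι => ν) with hc
  have hL := hν.memLp_logPartition (ι := ι) hb hχ
  have p₁ : MeasurePreserving (fun (x : ι → ℝ × ℝ) k => (x k).1)
      (Measure.pi fun _ => disorderPair f t) (Measure.pi fun _ => ν) :=
    measurePreserving_pi _ _ fun _ => ⟨measurable_fst, disorderPair_map_fst hf hfν ht ht1⟩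
  have p₂ : MeasurePreserving (fun (x : ι → ℝ × ℝ) k => (x k).2)
      (Measure.pi fun _ => disorderPair f t) (Measure.pi fun _ => ν) :=
    measurePreserving_pi _ _ fun _ => ⟨measurable_snd, disorderPair_map_snd hf hfν ht ht1⟩
  have l₁ := hL.comp_measurePreserving p₁
  have l₂ := hL.comp_measurePreserving p₂
  have i₁ : Integrable (fun x : ι → ℝ × ℝ => logPartition b χ (fun k => (x k).1))
      (Measure.pi fun _ => disorderPair f t) := l₁.integrable one_le_two
  have i₂ : Integrable (fun x : ι → ℝ × ℝ => logPartition b χ (fun k => (x k).2))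
      (Measure.pi fun _ => disorderPair f t) := l₂.integrable one_le_two
  have i₃ : Integrable (fun x : ι → ℝ × ℝ => pairLog b χ x)
      (Measure.pi fun _ => disorderPair f t) := l₁.integrable_mul l₂
  have e₁ : ∫ x : ι → ℝ × ℝ, logPartition b χ (fun k => (x k).1)
      ∂(Measure.pi fun _ => disorderPair f t) = c := by
    rw [hc, ← p₁.map_eq, integral_map p₁.measurable.aemeasurable (by fun_prop)]
  have e₂ : ∫ x : ι → ℝ × ℝ, logPartition b χ (fun k => (x k).2)
      ∂(Measure.pi fun _ => disorderPair f t) = c := by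
    rw [hc, ← p₂.map_eq, integral_map p₂.measurable.aemeasurable (by fun_prop)]
  have e : noiseCorrelation (centeredLogPartition b χ f ν) t =
      ∫ x : ι → ℝ × ℝ, (pairLog b χ x - c * logPartition b χ (fun k => (x k).1) -
        c * logPartition b χ (fun k => (x k).2) + c ^ 2)
        ∂(Measure.pi fun _ => disorderPair f t) := by
    have hq : IsProbabilityMeasure ((gaussPair t).map (Prod.map f f)) :=
      isProbabilityMeasure_disorderPair hf t
    have hg : Measurable fun x : ι → ℝ × ℝ => (pairLog b χ x -
        c * logPartition b χ (fun k => (x k).1) -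
        c * logPartition b χ (fun k => (x k).2) + c ^ 2) := by
      unfold pairLog
      fun_prop
    have hfm : Measurable fun (x : ι → ℝ × ℝ) k => Prod.map f f (x k) :=
      measurable_pi_lambda _ fun k => (hf.prodMap hf).comp (measurable_pi_apply k)
    rw [noiseCorrelation, disorderPair, ← Measure.pi_map_pi (fun _ => by fun_prop),
      integral_map hfm.aemeasurable hg.aestronglyMeasurable]
    refine integral_congr_ae (.of_forall fun x => ?_)
    simp only [centeredLogPartition, pairLog, Prod.map_fst, Prod.map_snd]
    ring
  rw [e, integral_add ((i₃.fun_sub (i₁.const_mul c)).fun_sub (i₂.const_mul c))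
    (integrable_const _), integral_sub (i₃.fun_sub (i₁.const_mul c)) (i₂.const_mul c),
    integral_sub i₃ (i₁.const_mul c), integral_const_mul, integral_const_mul, e₁, e₂,
    disorderPair_zero hf hfν, integral_pairLog_prod hν]
  simp only [integral_const, probReal_univ, one_smul]
  ring

lemma diagLaw_disorderPair (hf : Measurable f) (hfν : (gaussianReal 0 1).map f = ν) (ht : 0 ≤ t)
    (ht1 : t ≤ 1) : diagLaw (disorderPair f t) = disorderPair f 1 := by
  rw [disorderPair_one hf hfν, ← disorderPair_map_fst hf hfν ht ht1, diagLaw,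
    Measure.map_map (by fun_prop) measurable_fst]
  rfl

end FreeEnergyCorrelation

/-! ### Properties of the covariance `V(t)` for the Sherrington–Kirkpatrick model. -/

section SpinGlass

variable {N : ℕ} {β t : ℝ} {f : ℝ → ℝ} {ν : Measure ℝ}

/-- The covariance of the free energies of two systems with `t`-correlated Gaussian variables. -/
noncomputable def freeEnergyCorrelation (N : ℕ) (β : ℝ) (f : ℝ → ℝ) (ν : Measure ℝ) (t : ℝ) : ℝ :=
  noiseCorrelation (centeredLogPartition (β / √(N : ℝ)) (spinPair (N := N)) f ν) t

lemma freeEnergyCorrelation_sq_le (hν : IsNormalizedDisorder ν) (hf : Measurable f)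
    (hfν : (gaussianReal 0 1).map f = ν) (hβ : 0 ≤ β) (ht : 0 ≤ t) (ht1 : t ≤ 1) :
    freeEnergyCorrelation N β f ν t ^ 2 ≤
      freeEnergyCorrelation N β f ν (t ^ 2) * freeEnergyCorrelation N β f ν 1 :=
  sq_noiseCorrelation_le (measurable_centeredLogPartition hf)
    (memLp_centeredLogPartition hν hf hfν (by positivity) abs_spinPair_le) ht ht1

lemma freeEnergyCorrelation_one_sub_le (hν : IsNormalizedDisorder ν) (hf : Measurable f)
    (hfν : (gaussianReal 0 1).map f = ν) (hβ : 0 ≤ β) (hN : 1 ≤ N) (ht : 0 ≤ t) (ht1 : t ≤ 1) :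
    freeEnergyCorrelation N β f ν 1 - freeEnergyCorrelation N β f ν t ≤
      β ^ 2 * N * (1 - gaussCorrelation f t) := by
  have hNpos : (0 : ℝ) < N := by exact_mod_cast hN
  have hb : 0 ≤ β / √(N : ℝ) := by positivity
  have h := (pairMoments_disorderPair hν hf hfν ht ht1).integral_pairLog_diagLaw_sub_le
    (χ := spinPair (N := N)) (disorderPair_map_swap hf t) hb abs_spinPair_le
  rw [diagLaw_disorderPair hf hfν ht ht1] at h
  rw [freeEnergyCorrelation, freeEnergyCorrelation, noiseCorrelation_centeredLogPartition hν hf hfν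
    hb abs_spinPair_le zero_le_one le_rfl, noiseCorrelation_centeredLogPartition hν hf hfν
    hb abs_spinPair_le ht ht1, sub_sub_sub_cancel_right]
  refine h.trans_eq ?_
  rw [div_pow, Real.sq_sqrt hNpos.le, Fintype.card_prod, Fintype.card_fin]
  push_cast
  field_simp

lemma freeEnergyCorrelation_zero (hν : IsNormalizedDisorder ν) (hf : Measurable f)
    (hfν : (gaussianReal 0 1).map f = ν) (hβ : 0 ≤ β) : freeEnergyCorrelation N β f ν 0 = 0 := by
  rw [freeEnergyCorrelation, noiseCorrelation_centeredLogPartition hν hf hfν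
    (by positivity) abs_spinPair_le le_rfl zero_le_one, sub_self]

lemma freeEnergyCorrelation_one_le (hν : IsNormalizedDisorder ν) (hf : Measurable f)
    (hfν : (gaussianReal 0 1).map f = ν) (hβ : 0 ≤ β) (hN : 1 ≤ N) :
    freeEnergyCorrelation N β f ν 1 ≤ β ^ 2 * N := by
  have h := freeEnergyCorrelation_one_sub_le hν hf hfν hβ hN le_rfl zero_le_one
  rw [freeEnergyCorrelation_zero hν hf hfν hβ, gaussCorrelation_zero hν hf hfν] at h
  linarith

lemma freeEnergyCorrelation_le_sqrt (hν : IsNormalizedDisorder ν) (hf : Measurable f)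
    (hfν : (gaussianReal 0 1).map f = ν) (hβ : 0 ≤ β) (hN : 1 ≤ N) (ht : 0 ≤ t) (ht1 : t ≤ 1)
    {n : ℕ} (hn : 1 ≤ n) (hβn : 256 * β ^ 4 ≤ n) (htn : n * t ^ 2 ≤ 1) :
    freeEnergyCorrelation N β f ν t ≤
      (4000 * β ^ 3 + 50) * (∫ x, |x| ^ 3 ∂ν + 1) * √(N : ℝ) := by
  have h₀ := pairMoments_disorderPair hν hf hfν le_rfl zero_le_one
  rw [gaussCorrelation_zero hν hf hfν] at h₀
  have hw := gaussCorrelation_nonneg hν hf hfν ht ht1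
  have hwn := mul_gaussCorrelation_sq_le hν hf hfν ht hn htn
  -- Here the size of `n` is used: `n w² ≤ 1` and `256 β⁴ ≤ n` give `(β² w)² ≤ 1/256`.
  have hβw : β ^ 2 * gaussCorrelation f t ≤ 1 / 16 := by
    refine abs_le_of_sq_le_sq' ?_ (by norm_num) |>.2
    have : 256 * β ^ 4 * gaussCorrelation f t ^ 2 ≤ n * gaussCorrelation f t ^ 2 := by gcongr
    nlinarith
  rw [freeEnergyCorrelation, noiseCorrelation_centeredLogPartition hν hf hfν
    (by positivity) abs_spinPair_le ht ht1]
  exact (pairMoments_disorderPair hν hf hfν ht ht1).integral_pairLog_sub_le_sqrt h₀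
    ((disorderPair_map_fst hf hfν ht ht1).trans
      (disorderPair_map_fst hf hfν le_rfl zero_le_one).symm)
    ((disorderPair_map_snd hf hfν ht ht1).trans
      (disorderPair_map_snd hf hfν le_rfl zero_le_one).symm) hN hβ hw hβw

end SpinGlass

/-! ### Propagation of decay from small correlations towards 1. -/

section Decay

/-- If `V (t)² ≤ V (t²) V (1)`, a bound at small correlations propagates to correlations
close to `1`. -/
lemma decay_of_sq_le {V : ℝ → ℝ} {B L : ℝ} {n : ℕ} (hB : 0 ≤ B) (hV1 : V 1 ≤ B)
    (hV0 : 0 ≤ V 1) (hsq : ∀ t, 0 ≤ t → t ≤ 1 → V t ^ 2 ≤ V (t ^ 2) * V 1)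
    (hsmall : ∀ t, 0 ≤ t → t ≤ 1 → (n : ℝ) * t ^ 2 ≤ 1 → V t ≤ B * Real.exp (-(L / 2))) (m : ℕ) :
    ∀ s, 0 ≤ s → Real.log n / 2 ≤ 2 ^ m * s →
      V (Real.exp (-s)) ≤ B * Real.exp (-(L / (2 * 2 ^ m))) := by
  induction m with
  | zero =>
    intro s hs hm
    rw [pow_zero, mul_one]
    refine hsmall _ (Real.exp_pos _).le (Real.exp_le_one_iff.2 (by linarith)) ?_
    rcases Nat.eq_zero_or_pos n with rfl | hn
    · simp
    · have hn' : (0 : ℝ) < n := by exact_mod_cast hn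
      rw [pow_zero, one_mul] at hm
      calc (n : ℝ) * Real.exp (-s) ^ 2 = Real.exp (Real.log n + (2 : ℕ) * -s) := by
            rw [Real.exp_add, Real.exp_log hn', Real.exp_nat_mul]
        _ ≤ 1 := Real.exp_le_one_iff.2 (by push_cast; linarith)
  | succ m ih =>
    intro s hs hm
    -- Squaring `t = e^{-s}` doubles `s`; in return the exponent of the bound is halved.
    have h1 := ih (2 * s) (by linarith) (by rw [pow_succ] at hm; linarith)
    have h2 := hsq _ (Real.exp_pos (-s)).le (Real.exp_le_one_iff.2 (by linarith))
    have e : Real.exp (-s) ^ 2 = Real.exp (-(2 * s)) := by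
      rw [← Real.exp_nat_mul]; push_cast; ring_nf
    rw [e] at h2
    refine abs_le_of_sq_le_sq' ?_ (by positivity) |>.2
    calc V (Real.exp (-s)) ^ 2 ≤ V (Real.exp (-(2 * s))) * V 1 := h2
      _ ≤ (B * Real.exp (-(L / (2 * 2 ^ m)))) * V 1 := by gcongr
      _ ≤ (B * Real.exp (-(L / (2 * 2 ^ m)))) * B := by gcongr
      _ = (B * Real.exp (-(L / (2 * 2 ^ (m + 1))))) ^ 2 := by
        rw [mul_pow, ← Real.exp_nat_mul]
        have : ((2 : ℕ) : ℝ) * -(L / (2 * 2 ^ (m + 1))) = -(L / (2 * 2 ^ m)) := by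
          rw [pow_succ]; push_cast; field_simp
        rw [this]
        ring

/-- Write the argument as `e^{-s}` and take the least number `m` of doublings with `2^m s ≥ (log
n)/2`. By minimality `2^(m+1) log L < L` when `m > 0`, so the exponent `L / 2^(m+1)` still exceeds
`log L`. The factor `2 log n` in the argument is tuned for this. -/
lemma decay_le_div_log {V : ℝ → ℝ} {B L : ℝ} {n : ℕ} (hn : 2 ≤ n) (hL : 1 < L) (hB : 0 ≤ B)
    (hV1 : V 1 ≤ B) (hV0 : 0 ≤ V 1) (hsq : ∀ t, 0 ≤ t → t ≤ 1 → V t ^ 2 ≤ V (t ^ 2) * V 1)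
    (hsmall : ∀ t, 0 ≤ t → t ≤ 1 → (n : ℝ) * t ^ 2 ≤ 1 → V t ≤ B * Real.exp (-(L / 2))) :
    V (L ^ (-(2 * Real.log n) / L)) ≤ B * (1 / L) := by
  have hL0 : 0 < L := by linarith
  have hl : 0 < Real.log L := Real.log_pos hL
  have hs0 : 0 < Real.log n := Real.log_pos (by exact_mod_cast hn)
  set s := Real.log L * (2 * Real.log n) / L with hs
  have hspos : 0 < s := by positivity
  have e : L ^ (-(2 * Real.log n) / L) = Real.exp (-s) := by
    rw [Real.rpow_def_of_pos hL0]
    congr 1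
    rw [hs]; ring
  have hex : ∃ m : ℕ, Real.log n / 2 ≤ 2 ^ m * s := by
    obtain ⟨m, hm⟩ := pow_unbounded_of_one_lt (Real.log n / 2 / s) (one_lt_two : (1 : ℝ) < 2)
    exact ⟨m, ((div_lt_iff₀ hspos).1 hm).le⟩
  classical
  have hfind := Nat.find_spec hex
  have hmin := fun k => Nat.find_min (H := hex) (m := k)
  set m := Nat.find hex
  rw [e]
  refine (decay_of_sq_le hB hV1 hV0 hsq hsmall m s hspos.le hfind).trans ?_
  have hexp : Real.exp (-Real.log L) = 1 / L := by
    rw [Real.exp_neg, Real.exp_log hL0, one_div]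
  rw [← hexp]
  refine mul_le_mul_of_nonneg_left (Real.exp_le_exp.2 (neg_le_neg ?_)) hB
  rcases hm : m with _ | k
  -- Without any doubling, `log L ≤ L/2` is enough.
  · rw [pow_zero, mul_one]
    have h1 := Real.log_le_sub_one_of_pos (half_pos hL0)
    rw [Real.log_div hL0.ne' two_ne_zero] at h1
    have := Real.log_two_lt_d9
    linarith
  · have hk := hmin k (by omega)
    push Not at hk
    rw [le_div_iff₀ (by positivity), pow_succ]
    have h1 : 2 ^ k * (Real.log L * (2 * Real.log n)) < Real.log n / 2 * L := by
      rw [hs, ← mul_div_assoc, div_lt_iff₀ hL0] at hk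
      exact hk
    have h2 : Real.log n * (2 ^ k * Real.log L * 4) < Real.log n * L := by nlinarith
    have := lt_of_mul_lt_mul_left h2 hs0.le
    linarith

end Decay

/-! ### Every real law as the image of the standard Gaussian. -/

section GaussianRepresentation

lemma continuous_cdf_gaussianReal : Continuous (cdf (gaussianReal 0 1)) := by
  have := nullSingletonClass_gaussianReal (μ := 0) (v := 1) one_ne_zero
  refine continuous_iff_continuousAt.2 fun x => ?_
  have hm := (cdf (gaussianReal 0 1)).mono
  rw [hm.continuousAt_iff_leftLim_eq_rightLim, StieltjesFunction.rightLim_eq]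
  refine le_antisymm (hm.leftLim_le le_rfl) ?_
  have h := (cdf (gaussianReal 0 1)).measure_singleton x
  rw [measure_cdf, measure_singleton] at h
  linarith [ENNReal.ofReal_eq_zero.1 h.symm]

/-- By continuity and monotonicity a nonempty sublevel set is a half-line whose endpoint is mapped
exactly to `u`; an empty one can occur only for `u = 0`. -/
lemma gaussianReal_cdf_le {u : ℝ} (hu : 0 ≤ u) (hu1 : u < 1) :
    gaussianReal 0 1 {y | cdf (gaussianReal 0 1) y ≤ u} = ENNReal.ofReal u := by
  set Φ := cdf (gaussianReal 0 1) with hΦ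
  have hc : Continuous Φ := continuous_cdf_gaussianReal
  have hm : Monotone Φ := monotone_cdf _
  obtain ⟨B, hB⟩ := ((tendsto_cdf_atTop (gaussianReal 0 1)).eventually
    (lt_mem_nhds hu1)).exists
  have hbdd : BddAbove {y | Φ y ≤ u} := ⟨B, fun y hy => by
    by_contra! h
    exact absurd (hm h.le) (not_le.2 (lt_of_le_of_lt hy hB))⟩
  rcases Set.eq_empty_or_nonempty {y | Φ y ≤ u} with he | hne
  · rw [he, measure_empty]
    rcases hu.eq_or_lt with h0 | h0
    · rw [← h0, ENNReal.ofReal_zero]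
    · obtain ⟨y, hy⟩ := ((tendsto_cdf_atBot (gaussianReal 0 1)).eventually
        (gt_mem_nhds h0)).exists
      exact absurd (show y ∈ {y | Φ y ≤ u} from hy.le) (he ▸ Set.notMem_empty y)
  · have hcl : IsClosed {y | Φ y ≤ u} := isClosed_le hc continuous_const
    have hs := hcl.csSup_mem hne hbdd
    set s := sSup {y | Φ y ≤ u} with hs'
    have hset : {y | Φ y ≤ u} = Set.Iic s :=
      Set.Subset.antisymm (fun y hy => le_csSup hbdd hy) fun y hy => (hm hy).trans hs
    have heq : Φ s = u := by
      refine le_antisymm hs ?_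
      refine ge_of_tendsto (hc.continuousWithinAt (s := Set.Ioi s) (x := s)) ?_
      filter_upwards [self_mem_nhdsWithin] with y hy
      by_contra! h
      exact absurd (le_csSup hbdd (show y ∈ {y | Φ y ≤ u} from h.le)) (not_le.2 hy)
    rw [hset, ← ofReal_cdf, ← hΦ, heq]

/-- The Gaussian distribution function, as a map to the unit interval. -/
noncomputable def gaussianUniform (x : ℝ) : unitInterval :=
  ⟨cdf (gaussianReal 0 1) x, cdf_nonneg _ _, cdf_le_one _ _⟩

lemma measurable_gaussianUniform : Measurable gaussianUniform :=
  (continuous_cdf_gaussianReal.subtype_mk _).measurable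

lemma gaussianReal_map_gaussianUniform : (gaussianReal 0 1).map gaussianUniform = volume := by
  have : IsProbabilityMeasure ((gaussianReal 0 1).map gaussianUniform) :=
    Measure.isProbabilityMeasure_map measurable_gaussianUniform.aemeasurable
  refine Measure.ext_of_Iic _ _ fun u => ?_
  rw [Measure.map_apply measurable_gaussianUniform measurableSet_Iic]
  rcases u.2.2.eq_or_lt with h | h
  · have : Set.Iic u = Set.univ := by
      ext v
      simpa using Subtype.coe_le_coe.1 (v.2.2.trans h.ge)
    rw [this, Set.preimage_univ, measure_univ, measure_univ]
  · rw [unitInterval.volume_Iic, ← gaussianReal_cdf_le u.2.1 h]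
    rfl

/-- Every law on the real line is the law of a function of a standard Gaussian variable. -/
lemma exists_measurable_gaussianReal_map_eq (ν : Measure ℝ) [IsProbabilityMeasure ν] :
    ∃ f : ℝ → ℝ, Measurable f ∧ (gaussianReal 0 1).map f = ν := by
  obtain ⟨f, hf, hfν⟩ := ν.exists_measurable_map_eq
  refine ⟨f ∘ gaussianUniform, hf.comp measurable_gaussianUniform, ?_⟩
  rw [← Measure.map_map hf measurable_gaussianUniform, gaussianReal_map_gaussianUniform, hfν]

end GaussianRepresentation

/-! ### Continuity of `w` at 1 for square integrable `f`. -/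

section Continuity

variable {f : ℝ → ℝ} {ν : Measure ℝ}

open Filter Topology

lemma tendsto_integral_sq_sub_gaussPair (g : BoundedContinuousFunction ℝ ℝ) :
    Tendsto (fun t => ∫ p, (g p.1 - g p.2) ^ 2 ∂(gaussPair t)) (𝓝 1) (𝓝 0) := by
  have e : (fun t => ∫ p, (g p.1 - g p.2) ^ 2 ∂(gaussPair t)) = fun t =>
      ∫ p, (g (√t * p.1 + √(1 - t) * p.2.1) - g (√t * p.1 + √(1 - t) * p.2.2)) ^ 2
        ∂gaussTriple := by
    funext t
    rw [gaussPair, integral_map (by fun_prop) (by fun_prop)]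
  -- The real square root is 0 on negative numbers, so the integrand is continuous in `t` on the
  -- whole line and dominated convergence applies on both sides of 1.
  have hc : Continuous fun t => ∫ p, (g p.1 - g p.2) ^ 2 ∂(gaussPair t) := by
    rw [e]
    refine continuous_of_dominated (bound := fun _ => (‖g‖ + ‖g‖) ^ 2)
      (fun t => Continuous.aestronglyMeasurable (by fun_prop)) (fun t => .of_forall fun p => ?_)
      (integrable_const _) (.of_forall fun p => by fun_prop)
    rw [norm_pow]
    gcongr
    exact (norm_sub_le _ _).trans (add_le_add (g.norm_coe_le_norm _) (g.norm_coe_le_norm _))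
  have h1 : ∫ p, (g p.1 - g p.2) ^ 2 ∂(gaussPair 1) = 0 := by
    rw [gaussPair_one, integral_map (by fun_prop) (by fun_prop)]
    simp
  rw [← h1]
  exact hc.tendsto 1

/-- `1 - w(t)` is half the mean of `(f(U) - f(V))²`. Insert `g(U)` and `g(V)` and use that the
square of a sum of three terms is at most three times the sum of squares. -/
lemma one_sub_gaussCorrelation_le (hν : IsNormalizedDisorder ν) (hf : Measurable f)
    (hfν : (gaussianReal 0 1).map f = ν) (g : BoundedContinuousFunction ℝ ℝ) {t : ℝ} (ht : 0 ≤ t)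
    (ht1 : t ≤ 1) : 1 - gaussCorrelation f t ≤
      3 * ∫ x, (f x - g x) ^ 2 ∂(gaussianReal 0 1) +
        3 / 2 * ∫ p, (g p.1 - g p.2) ^ 2 ∂(gaussPair t) := by
  have hμ := pairMoments_disorderPair hν hf hfν ht ht1
  have p₁ : MeasurePreserving Prod.fst (gaussPair t) (gaussianReal 0 1) :=
    ⟨measurable_fst, gaussPair_map_fst ht ht1⟩
  have p₂ : MeasurePreserving Prod.snd (gaussPair t) (gaussianReal 0 1) :=
    ⟨measurable_snd, gaussPair_map_snd ht ht1⟩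
  have hgm : ∀ Q : Measure ℝ, IsProbabilityMeasure Q → MemLp g 2 Q := fun Q _ =>
    MemLp.of_bound g.continuous.aestronglyMeasurable ‖g‖ (.of_forall g.norm_coe_le_norm)
  have hfL := hν.memLp_comp hf hfν
  have hd : MemLp (fun x => f x - g x) 2 (gaussianReal 0 1) := hfL.sub (hgm _ inferInstance)
  have i₁ : Integrable (fun p : ℝ × ℝ => (f p.1 - g p.1) ^ 2) (gaussPair t) :=
    (hd.comp_measurePreserving p₁).integrable_sq
  have i₂ : Integrable (fun p : ℝ × ℝ => (f p.2 - g p.2) ^ 2) (gaussPair t) :=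
    (hd.comp_measurePreserving p₂).integrable_sq
  have i₃ : Integrable (fun p : ℝ × ℝ => (g p.1 - g p.2) ^ 2) (gaussPair t) :=
    (((hgm _ inferInstance).comp_measurePreserving p₁).sub
      ((hgm _ inferInstance).comp_measurePreserving p₂)).integrable_sq
  have e₁ : ∫ p : ℝ × ℝ, (f p.1 - g p.1) ^ 2 ∂(gaussPair t) =
      ∫ x, (f x - g x) ^ 2 ∂(gaussianReal 0 1) := by
    rw [← p₁.map_eq, integral_map (by fun_prop) (by fun_prop)]
  have e₂ : ∫ p : ℝ × ℝ, (f p.2 - g p.2) ^ 2 ∂(gaussPair t) =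
      ∫ x, (f x - g x) ^ 2 ∂(gaussianReal 0 1) := by
    rw [← p₂.map_eq, integral_map (by fun_prop) (by fun_prop)]
  have i₄ : Integrable (fun p : ℝ × ℝ => (f p.1 - f p.2) ^ 2) (gaussPair t) :=
    ((hfL.comp_measurePreserving p₁).sub (hfL.comp_measurePreserving p₂)).integrable_sq
  have e₄ : ∫ p : ℝ × ℝ, (f p.1 - f p.2) ^ 2 ∂(gaussPair t) =
      2 * (1 - gaussCorrelation f t) := by
    have h : ∫ p : ℝ × ℝ, (f p.1 - f p.2) ^ 2 ∂(gaussPair t) =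
        ∫ p : ℝ × ℝ, (p.1 ^ 2 + p.2 ^ 2 - 2 * (p.1 * p.2)) ∂(disorderPair f t) := by
      rw [disorderPair, integral_map (by fun_prop) (by fun_prop)]
      refine integral_congr_ae (.of_forall fun p => ?_)
      simp only [Prod.map_fst, Prod.map_snd]
      ring
    rw [h, integral_sub (hμ.integrable_sq_fst.fun_add hμ.integrable_sq_snd)
      (hμ.integrable_mul.const_mul 2), integral_add hμ.integrable_sq_fst hμ.integrable_sq_snd,
      integral_const_mul, hμ.sq_fst, hμ.sq_snd, hμ.cov]
    ring
  have hle : ∫ p : ℝ × ℝ, (f p.1 - f p.2) ^ 2 ∂(gaussPair t) ≤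
      ∫ p : ℝ × ℝ, 3 * ((f p.1 - g p.1) ^ 2 + (f p.2 - g p.2) ^ 2 + (g p.1 - g p.2) ^ 2)
        ∂(gaussPair t) := by
    refine integral_mono i₄ (((i₁.fun_add i₂).fun_add i₃).const_mul 3) fun p => ?_
    simp only
    nlinarith [sq_nonneg ((f p.1 - g p.1) + (f p.2 - g p.2)),
      sq_nonneg ((f p.1 - g p.1) - (g p.1 - g p.2)), sq_nonneg ((f p.2 - g p.2) + (g p.1 - g p.2))]
  rw [integral_const_mul, integral_add (i₁.fun_add i₂) i₃, integral_add i₁ i₂, e₁, e₂, e₄] at hle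
  linarith

lemma tendsto_gaussCorrelation (hν : IsNormalizedDisorder ν) (hf : Measurable f)
    (hfν : (gaussianReal 0 1).map f = ν) :
    Tendsto (gaussCorrelation f) (𝓝[Set.Icc 0 1] 1) (𝓝 1) := by
  refine Metric.tendsto_nhds.2 fun ε hε => ?_
  have hfL := hν.memLp_comp hf hfν
  rw [← ENNReal.ofReal_ofNat 2] at hfL
  -- The tolerances `ε/6` here and `ε/3` below contribute `ε/2` each.
  obtain ⟨g, hg, -⟩ := hfL.exists_boundedContinuous_integral_rpow_sub_le two_pos
    (show 0 < ε / 6 by positivity)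
  have hg' : ∫ x, (f x - g x) ^ 2 ∂(gaussianReal 0 1) ≤ ε / 6 := by
    simpa [Real.rpow_two] using hg
  have hlim := (tendsto_integral_sq_sub_gaussPair g).eventually
    (gt_mem_nhds (show 0 < ε / 3 by positivity))
  filter_upwards [nhdsWithin_le_nhds hlim, self_mem_nhdsWithin] with t h1 ht
  have h2 := one_sub_gaussCorrelation_le hν hf hfν g ht.1 ht.2
  have h3 := gaussCorrelation_le_one hν hf hfν ht.1 ht.2
  rw [Real.dist_eq, abs_sub_comm, abs_of_nonneg (by linarith)]
  linarith

end Continuity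

/-! ### The variance bound and superconcentration. -/

section Main

lemma randomFreeEnergy_eq {N : ℕ} (β : ℝ) {Ω : Type*} (h : Fin N → Fin N → Ω → ℝ) :
    randomFreeEnergy β h = logPartition (β / √(N : ℝ)) (spinPair (N := N)) ∘
      fun ω (k : Fin N × Fin N) => h k.1 k.2 ω := by
  funext ω
  exact freeEnergy_eq_logPartition β _

variable {N : ℕ} {β : ℝ} {f : ℝ → ℝ} {ν : Measure ℝ} {Ω : Type*} [MeasurableSpace Ω]
  {P : Measure Ω} {h : Fin N → Fin N → Ω → ℝ}

/-- The correlation `(log N)^{-c / log N}`, truncated at `1`. -/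
noncomputable def criticalCorrelation (c : ℝ) (N : ℕ) : ℝ :=
  min (Real.log N ^ (-c / Real.log N)) 1

lemma criticalCorrelation_mem (c : ℝ) (N : ℕ) : criticalCorrelation c N ∈ Set.Icc (0 : ℝ) 1 :=
  ⟨le_min (Real.rpow_nonneg (Real.log_natCast_nonneg N) _) zero_le_one, min_le_right _ _⟩

open Filter Topology in
-- `x^(-c/x) → 1` as `x = log N → ∞`, and truncation at 1 keeps the limit.
lemma tendsto_criticalCorrelation (c : ℝ) :
    Tendsto (criticalCorrelation c) atTop (𝓝[Set.Icc 0 1] 1) := by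
  refine tendsto_nhdsWithin_iff.2 ⟨?_, .of_forall (criticalCorrelation_mem c)⟩
  have h := (tendsto_rpow_div_mul_add (-c) 1 0 zero_ne_one).comp
    (Real.tendsto_log_atTop.comp tendsto_natCast_atTop_atTop)
  simp only [one_mul, add_zero] at h
  have h1 := h.min (tendsto_const_nhds (x := (1 : ℝ)))
  rw [min_self] at h1
  exact h1

lemma IsIIDArray.hasLaw (hh : IsIIDArray h ν P) :
    HasLaw (fun ω (k : Fin N × Fin N) => h k.1 k.2 ω) (Measure.pi fun _ => ν) P := by
  have hm : ∀ k : Fin N × Fin N, AEMeasurable (h k.1 k.2) P := fun k =>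
    (hh.2 k.1 k.2).aemeasurable
  refine ⟨aemeasurable_pi_iff.2 hm, ?_⟩
  have := hh.1.isProbabilityMeasure
  rw [(iIndepFun_iff_map_fun_eq_pi_map hm).1 hh.1]
  simp only [(hh.2 _ _).map_eq]

lemma IsIIDArray.memLp_randomFreeEnergy (hh : IsIIDArray h ν P) (hν : IsNormalizedDisorder ν)
    (hβ : 0 ≤ β) : MemLp (randomFreeEnergy β h) 2 P := by
  have hL := hν.memLp_logPartition (b := β / √(N : ℝ)) (by positivity) (abs_spinPair_le (N := N))
  have hX := hh.hasLaw
  rw [← hX.map_eq] at hL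
  rw [randomFreeEnergy_eq]
  exact hL.comp_of_map hX.aemeasurable

lemma IsIIDArray.variance_randomFreeEnergy (hh : IsIIDArray h ν P) (hν : IsNormalizedDisorder ν)
    (hf : Measurable f) (hfν : (gaussianReal 0 1).map f = ν) :
    variance (randomFreeEnergy β h) P = freeEnergyCorrelation N β f ν 1 := by
  have hX := hh.hasLaw
  rw [randomFreeEnergy_eq, ← variance_map (measurable_logPartition _ _).aemeasurable
    hX.aemeasurable, hX.map_eq, freeEnergyCorrelation,
    noiseCorrelation_centeredLogPartition_one hν hf hfν]

/-- The variance bound, for an arbitrary measurable representation of the disorder by a Gaussian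
variable. -/
theorem IsIIDArray.variance_randomFreeEnergy_le (hβ : 0 ≤ β) {n : ℕ} (hn : 2 ≤ n)
    (hβn : 256 * β ^ 4 ≤ n) (hν : IsNormalizedDisorder ν) (hf : Measurable f)
    (hfν : (gaussianReal 0 1).map f = ν) (hN : 2 ≤ N) (hh : IsIIDArray h ν P) :
    variance (randomFreeEnergy β h) P ≤
      (β ^ 2 + 4000 * β ^ 3 + 50) * ((∫ x, |x| ^ 3 ∂ν) + 1) * (N : ℝ) *
        (1 - gaussCorrelation f (criticalCorrelation (2 * Real.log n) N) + 1 / Real.log N) := by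
  have hV0 : 0 ≤ freeEnergyCorrelation N β f ν 1 := by
    rw [← hh.variance_randomFreeEnergy hν hf hfν]
    exact variance_nonneg _ _
  rw [hh.variance_randomFreeEnergy hν hf hfν]
  set r := criticalCorrelation (2 * Real.log n) N with hr
  obtain ⟨hr0, hr1⟩ := criticalCorrelation_mem (2 * Real.log n) N
  rw [← hr] at hr0 hr1
  have hN1 : 1 ≤ N := by omega
  have hN' : (2 : ℝ) ≤ N := by exact_mod_cast hN
  have hm0 : 0 ≤ ∫ x, |x| ^ 3 ∂ν := integral_nonneg fun x => by positivity
  have hw1 := gaussCorrelation_le_one hν hf hfν hr0 hr1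
  have hL0 : 0 < Real.log N := Real.log_pos (by linarith)
  have hVle := freeEnergyCorrelation_one_le hν hf hfν hβ hN1
  set m := ∫ x, |x| ^ 3 ∂ν
  set C := 4000 * β ^ 3 + 50 with hC
  have hC0 : 0 ≤ C := by positivity
  have hK : β ^ 2 + 4000 * β ^ 3 + 50 = β ^ 2 + C := by rw [hC]; ring
  rw [hK]
  have hβK : β ^ 2 ≤ (β ^ 2 + C) * (m + 1) := by
    nlinarith [sq_nonneg β, mul_nonneg (add_nonneg (sq_nonneg β) hC0) hm0]
  have hCK : C * (m + 1) ≤ (β ^ 2 + C) * (m + 1) := by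
    gcongr
    linarith [sq_nonneg β]
  set B := (β ^ 2 + C) * (m + 1) * (N : ℝ) with hBdef
  have hβB : β ^ 2 * N ≤ B := by rw [hBdef]; gcongr
  have hB : 0 ≤ B := by positivity
  -- If `log N ≤ 1`, then `1 / log N ≥ 1` and the trivial bound `V(1) ≤ β² N` is enough.
  rcases le_or_gt (Real.log N) 1 with hL | hL
  · have h1 : 1 ≤ 1 / Real.log N := (one_le_div hL0).2 hL
    calc _ ≤ B * 1 := by linarith
      _ ≤ _ := mul_le_mul_of_nonneg_left (by linarith) hB
  · have hrexp : r = Real.log N ^ (-(2 * Real.log n) / Real.log N) := by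
      rw [hr, criticalCorrelation, min_eq_left]
      refine Real.rpow_le_one_of_one_le_of_nonpos hL.le ?_
      have : 0 ≤ Real.log n := Real.log_natCast_nonneg n
      exact div_nonpos_of_nonpos_of_nonneg (by linarith) hL0.le
    -- The bound of order `√N`, written as `B ~ N` times `e^{-(log N)/2}`, to be fed into the decay
    -- lemma with `L = log N`.
    have hsmall : ∀ t, 0 ≤ t → t ≤ 1 → (n : ℝ) * t ^ 2 ≤ 1 →
        freeEnergyCorrelation N β f ν t ≤ B * Real.exp (-(Real.log N / 2)) := by
      intro t ht ht1 htn
      refine (freeEnergyCorrelation_le_sqrt hν hf hfν hβ hN1 ht ht1 (by omega) hβn htn).trans ?_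
      have hNpos : (0 : ℝ) < N := by linarith
      have hsq : (N : ℝ) * Real.exp (-(Real.log N / 2)) = √(N : ℝ) := by
        rw [Real.sqrt_eq_rpow, Real.rpow_def_of_pos hNpos]
        nth_rewrite 1 [← Real.exp_log hNpos]
        rw [← Real.exp_add]
        ring_nf
      rw [hBdef, mul_assoc _ (N : ℝ), hsq]
      gcongr
    have hdecay := decay_le_div_log hn hL hB (hVle.trans hβB) hV0
      (fun t ht ht1 => freeEnergyCorrelation_sq_le hν hf hfν hβ ht ht1) hsmall
    rw [← hrexp] at hdecay
    -- Now `V(1) = (V(1) - V(r)) + V(r)`, the two terms being bounded by `hdiff` and `hdecay`.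
    have hdiff := freeEnergyCorrelation_one_sub_le hν hf hfν hβ hN1 hr0 hr1
    have : β ^ 2 * N * (1 - gaussCorrelation f r) ≤ B * (1 - gaussCorrelation f r) :=
      mul_le_mul_of_nonneg_right hβB (by linarith)
    linarith

end Main

open Filter Topology in
/-- The free energy is superconcentrated. -/
theorem variance_randomFreeEnergy_isLittleO {β : ℝ} (hβ : 0 ≤ β) {ν : Measure ℝ}
    (hν : IsNormalizedDisorder ν) {Ω : ℕ → Type*} [∀ N, MeasurableSpace (Ω N)]
    {P : ∀ N, Measure (Ω N)} {h : ∀ N, Fin N → Fin N → Ω N → ℝ}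
    (hh : ∀ N, IsIIDArray (h N) ν (P N)) :
    (fun N : ℕ => variance (randomFreeEnergy β (h N)) (P N)) =o[atTop] fun N : ℕ => (N : ℝ) := by
  have := hν.isProbabilityMeasure
  -- Any measurable representation serves here: the variance bound and the continuity of `w` at 1
  -- both hold for it.
  obtain ⟨f, hf, hfν⟩ := exists_measurable_gaussianReal_map_eq ν
  obtain ⟨n, hn⟩ := exists_nat_ge (max 2 (256 * β ^ 4))
  have hn2 : 2 ≤ n := by exact_mod_cast (le_max_left _ _).trans hn
  have hβn := (le_max_right _ _).trans hn
  set K := (β ^ 2 + 4000 * β ^ 3 + 50) * ((∫ x, |x| ^ 3 ∂ν) + 1)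
  have hw := (tendsto_gaussCorrelation hν hf hfν).comp
    (tendsto_criticalCorrelation (2 * Real.log n))
  have hlog : Tendsto (fun N : ℕ => 1 / Real.log N) atTop (𝓝 0) :=
    (Real.tendsto_log_atTop.comp tendsto_natCast_atTop_atTop).const_div_atTop 1
  have hlim : Tendsto (fun N : ℕ => K * (1 - gaussCorrelation f
      (criticalCorrelation (2 * Real.log n) N) + 1 / Real.log N)) atTop (𝓝 0) := by
    simpa using (((tendsto_const_nhds (x := (1 : ℝ))).sub hw).add hlog).const_mul K
  refine Asymptotics.isLittleO_iff.2 fun ε hε => ?_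
  filter_upwards [hlim.eventually (gt_mem_nhds hε), eventually_ge_atTop 2] with N h1 h2
  rw [Real.norm_of_nonneg (variance_nonneg _ _), Real.norm_of_nonneg (Nat.cast_nonneg N)]
  refine ((hh N).variance_randomFreeEnergy_le hβ hn2 hβn hν hf hfν h2).trans ?_
  calc _ = K * (1 - gaussCorrelation f (criticalCorrelation (2 * Real.log n) N) +
        1 / Real.log N) * N := by ring
    _ ≤ ε * N := by gcongr

theorem theorem1 (β : ℝ) (hβ : 0 < β) :
    (∃ c K : ℝ, 0 < c ∧ 0 < K ∧
      ∀ ν : Measure ℝ, IsNormalizedDisorder ν →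
      ∀ f : ℝ → ℝ, Monotone f → (gaussianReal 0 1).map f = ν →
      ∀ N : ℕ, 2 ≤ N →
      ∀ (Ω : Type*) [MeasurableSpace Ω] (P : Measure Ω) [IsProbabilityMeasure P]
        (h : Fin N → Fin N → Ω → ℝ), IsIIDArray h ν P →
        MemLp (randomFreeEnergy β h) 2 P ∧
        variance (randomFreeEnergy β h) P ≤
          K * ((∫ x, |x| ^ 3 ∂ν) + 1) * (N : ℝ) *
            (1 - gaussCorrelation f (min (Real.log N ^ (-c / Real.log N)) 1)
              + 1 / Real.log N)) ∧
    (∀ ν : Measure ℝ, IsNormalizedDisorder ν →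
      ∀ (Ω : ℕ → Type*) [∀ N, MeasurableSpace (Ω N)] (P : ∀ N, Measure (Ω N))
        [∀ N, IsProbabilityMeasure (P N)] (h : ∀ N, Fin N → Fin N → Ω N → ℝ),
        (∀ N, IsIIDArray (h N) ν (P N)) →
        (fun N : ℕ => variance (randomFreeEnergy β (h N)) (P N))
          =o[Filter.atTop] (fun N : ℕ => (N : ℝ))) := by

  -- `n` depends on `β` alone, hence so does `c = 2 log n`; `n ≥ 2` makes `c` positive.
  obtain ⟨n, hn⟩ := exists_nat_ge (max 2 (256 * β ^ 4))
  have hn2 : 2 ≤ n := by exact_mod_cast (le_max_left _ _).trans hn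
  refine ⟨⟨2 * Real.log n, β ^ 2 + 4000 * β ^ 3 + 50, ?_, by positivity, ?_⟩, ?_⟩
  · have : 0 < Real.log n := Real.log_pos (by exact_mod_cast hn2)
    positivity
  · intro ν hν f hf hfν N hN Ω _ P _ h hh
    exact ⟨hh.memLp_randomFreeEnergy hν hβ.le, hh.variance_randomFreeEnergy_le hβ.le hn2
      ((le_max_right _ _).trans hn) hν hf.measurable hfν hN⟩
  · intro ν hν Ω _ P _ h hh
    exact variance_randomFreeEnergy_isLittleO hβ.le hν hh
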